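/- Let $M$ be a closed, oriented, smooth, simply-connected $4$-manifold, and let $\Sigma\subset M$ be a smoothly embedded, closed, connected, oriented surface of genus $g$ with trivial normal bundle. Fix a framing $\eta\colon\nu\Sigma\to D^2\times\Sigma$ of a closed tubular neighbourhood $\nu\Sigma$ of $\Sigma$. Let $\phi\colon\Sigma\to\Sigma$ be an orientation-reversing free smooth involution, that is, the deck transformation of a double covering $\Sigma\to\#_{g+1}\mathbb{RP}^2$. Let $M_0$ be the exterior of $\Sigma$ (the complement of the interior of $\nu\Sigma$), and let $\Phi=\eta^{-1}\circ(\mathrm{id}_{S^1}\times\phi)\circ\eta$ be the induced free involution of $\partial\nu\Sigma=\partial M_0$. The double $\widetilde X=M_0\cup_\Phi M_0$ is obtained from two copies of $M_0$ by gluing $x\in\partial M_0$ in the first copy to $\Phi(x)$ in the second. The $\mathbb{Z}_2$-construction of $M$ along $\Sigma$ is $X=\widetilde X/\tau$, where $\tau$ is the free involution of $\widetilde X$ that swaps the two copies of $M_0$. (1) If the meridian of $\Sigma$ (the boundary of a fibre of $\nu\Sigma\cong D^2\times\Sigma\to\Sigma$) is trivial in $\pi_1(M\setminus\Sigma)$,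 then $X$ is path connected and $\pi_1(X)\cong\mathbb{Z}_2$. (2) If there are a closed oriented surface $F$ (not necessarily connected) and a smooth immersion $f\colon F\to M$ such that the class $\alpha\in H_2(M;\mathbb{Z})$, the image under $f$ of the fundamental class of $F$, satisfies $\alpha\cdot[\Sigma]=0$ and $\alpha\cdot\alpha$ is odd, then $X$ has odd intersection form. That is, $X$ is orientable and, for a fundamental class $[X]\in H_4(X;\mathbb{Z})$, there is $a\in H^2(X;\mathbb{Z})$ with $\langle a\cup a,[X]\rangle$ odd. -/

import Mathlib

open CategoryTheory Limits Simplicial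
open scoped Manifold ContDiff

universe u

noncomputable section

namespace SingularHomology

/-! ### Singular homology and cohomology with integer coefficients -/

/-- The coefficient group `ℤ`, lifted to the universe of the spaces. -/
abbrev coeff : ModuleCat.{u} ℤ := ModuleCat.of ℤ (ULift.{u} ℤ)

/-- The singular simplicial set of a topological space. -/
abbrev sing (X : Type u) [TopologicalSpace X] : SSet.{u} := TopCat.toSSet.obj (TopCat.of X)

/-- The singular chain complex `C_*(X; ℤ)`. -/
abbrev chains (X : Type u) [TopologicalSpace X] : ChainComplex (ModuleCat.{u} ℤ) ℕ :=
  (sing X).chainComplex coeff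

/-- Singular homology `H_n(X; ℤ)`. -/
abbrev H (n : ℕ) (X : Type u) [TopologicalSpace X] : ModuleCat.{u} ℤ :=
  (sing X).homology coeff n

/-- The homomorphism `f_* : H_n(X; ℤ) → H_n(Y; ℤ)` induced by a continuous map. -/
def push {X Y : Type u} [TopologicalSpace X] [TopologicalSpace Y] (n : ℕ) (f : C(X, Y)) :
    H n X →ₗ[ℤ] H n Y :=
  (SSet.homologyMap (TopCat.toSSet.map (TopCat.ofHom f)) coeff n).hom

/-- The relative chain complex `C_*(X, X - x; ℤ) = C_*(X; ℤ) / C_*(X - x; ℤ)`. -/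
abbrev localChains (X : Type u) [TopologicalSpace X] (x : X) :
    ChainComplex (ModuleCat.{u} ℤ) ℕ :=
  cokernel (SSet.chainComplexMap (TopCat.toSSet.map
    (TopCat.ofHom (⟨Subtype.val, continuous_subtype_val⟩ : C({y : X // y ≠ x}, X)))) coeff)

/-- The restriction homomorphism `H_n(X; ℤ) → H_n(X, X - x; ℤ)`. -/
def restrictAt {X : Type u} [TopologicalSpace X] (n : ℕ) (x : X) :
    H n X →ₗ[ℤ] (localChains X x).homology n :=
  (HomologicalComplex.homologyMap (cokernel.π _ : chains X ⟶ localChains X x) n).hom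

/-- `μ ∈ H_n(X; ℤ)` is a fundamental class (that is, an orientation) of the closed
`n`-manifold `X`: at every point `x` it restricts to a generator of the infinite cyclic group
`H_n(X, X - x; ℤ)`. -/
def IsFundamentalClass {X : Type u} [TopologicalSpace X] (n : ℕ) (μ : H n X) : Prop :=
  ∀ (x : X) (y : (localChains X x).homology n), ∃ k : ℤ, y = k • restrictAt n x μ

/-- Singular `n`-cochains: integer valued functions on the singular `n`-simplices. -/
abbrev Cochain (n : ℕ) (X : Type u) [TopologicalSpace X] : Type u := (sing X) _⦋n⦌ → ℤ

/-- The vanishing of the coboundary of a cochain. -/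
def IsCocycle {n : ℕ} {X : Type u} [TopologicalSpace X] (a : Cochain n X) : Prop :=
  ∀ s : (sing X) _⦋n + 1⦌, ∑ i : Fin (n + 2), (-1) ^ i.val * a ((sing X).δ i s) = 0

/-- Singular `n`-cocycles. -/
abbrev Cocycle (n : ℕ) (X : Type u) [TopologicalSpace X] : Type u :=
  {a : Cochain n X // IsCocycle a}

/-- The homomorphism `C_n(X; ℤ) → ℤ` which is the linear extension of a cochain. -/
def Cochain.toHom {n : ℕ} {X : Type u} [TopologicalSpace X] (a : Cochain n X) :
    (chains X).X n ⟶ coeff :=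
  ((sing X).isColimitChainComplexXCofan coeff n).desc (Cofan.mk _ fun s => a s • 𝟙 coeff)

lemma Cochain.ι_toHom {n : ℕ} {X : Type u} [TopologicalSpace X] (a : Cochain n X)
    (s : (sing X) _⦋n⦌) :
    (sing X).ιChainComplex (R := coeff) s ≫ a.toHom = a s • 𝟙 coeff :=
  ((sing X).isColimitChainComplexXCofan coeff n).fac
    (Cofan.mk _ fun s => a s • 𝟙 coeff) ⟨s⟩

lemma IsCocycle.d_comp_toHom {n : ℕ} {X : Type u} [TopologicalSpace X] {a : Cochain n X}
    (ha : IsCocycle a) : (chains X).d (n + 1) n ≫ a.toHom = 0 := by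
  apply SSet.chainComplex_hom_ext
  intro s
  rw [SSet.ιChainComplex_d_assoc, Preadditive.sum_comp, comp_zero]
  trans ∑ i : Fin (n + 2), ((-1) ^ i.val * a ((sing X).δ i s)) • 𝟙 (coeff.{u})
  · refine Finset.sum_congr rfl fun i _ => ?_
    rw [Preadditive.zsmul_comp, Cochain.ι_toHom, smul_smul]
  · rw [← Finset.sum_smul, ha s, zero_smul]

/-- The Kronecker pairing `⟨a, h⟩ ∈ ℤ` of (the class of) a cocycle with a homology class. -/
def pairing {n : ℕ} {X : Type u} [TopologicalSpace X] (a : Cocycle n X) (h : H n X) : ℤ :=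
  (((chains X).homologyι n ≫ (chains X).descOpcycles a.1.toHom (n + 1) (by simp)
    a.2.d_comp_toHom).hom h).down

/-- The cup product of cochains:
`(a ∪ b)(s) = a(s restricted to [v_0, …, v_p]) * b(s restricted to [v_p, …, v_{p+q}])`. -/
def cupCochain {p q : ℕ} {X : Type u} [TopologicalSpace X] (a : Cochain p X) (b : Cochain q X) :
    Cochain (p + q) X := fun s =>
  a ((sing X).map (SimplexCategory.subinterval 0 p (by omega)).op s) *
    b ((sing X).map (SimplexCategory.subinterval p q le_rfl).op s)

lemma map_δ {n m : ℕ} {X : Type u} [TopologicalSpace X] (s : (sing X) _⦋n + 1⦌)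
    (i : Fin (n + 2)) (f : ⦋m⦌ ⟶ ⦋n⦌) (g : ⦋m⦌ ⟶ ⦋n + 1⦌) (h : f ≫ SimplexCategory.δ i = g) :
    (sing X).map f.op ((sing X).δ i s) = (sing X).map g.op s := by
  subst h
  simp [SimplicialObject.δ]

lemma δ_map {n m : ℕ} {X : Type u} [TopologicalSpace X] (s : (sing X) _⦋n⦌)
    (i : Fin (m + 2)) (f : ⦋m + 1⦌ ⟶ ⦋n⦌) (g : ⦋m⦌ ⟶ ⦋n⦌) (h : SimplexCategory.δ i ≫ f = g) :
    (sing X).δ i ((sing X).map f.op s) = (sing X).map g.op s := by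
  subst h
  simp [SimplicialObject.δ]

lemma front_δ : ∀ i : Fin 6, i.val ≤ 2 → ∀ k : Fin 3,
    ((SimplexCategory.subinterval 0 2 (by omega) : ⦋2⦌ ⟶ ⦋4⦌) ≫ SimplexCategory.δ i) k =
      (SimplexCategory.δ (Fin.ofNat 4 i) ≫
        (SimplexCategory.subinterval 0 3 (by omega) : ⦋3⦌ ⟶ ⦋5⦌)) k := by
  decide

lemma front_δ' : ∀ i : Fin 6, 3 ≤ i.val → ∀ k : Fin 3,
    ((SimplexCategory.subinterval 0 2 (by omega) : ⦋2⦌ ⟶ ⦋4⦌) ≫ SimplexCategory.δ i) k =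
      (SimplexCategory.δ 3 ≫
        (SimplexCategory.subinterval 0 3 (by omega) : ⦋3⦌ ⟶ ⦋5⦌)) k := by
  decide

lemma back_δ : ∀ i : Fin 6, i.val ≤ 2 → ∀ k : Fin 3,
    ((SimplexCategory.subinterval 2 2 le_rfl : ⦋2⦌ ⟶ ⦋4⦌) ≫ SimplexCategory.δ i) k =
      (SimplexCategory.δ 0 ≫
        (SimplexCategory.subinterval 2 3 (by omega) : ⦋3⦌ ⟶ ⦋5⦌)) k := by
  decide

lemma back_δ' : ∀ i : Fin 6, 3 ≤ i.val → ∀ k : Fin 3,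
    ((SimplexCategory.subinterval 2 2 le_rfl : ⦋2⦌ ⟶ ⦋4⦌) ≫ SimplexCategory.δ i) k =
      (SimplexCategory.δ (Fin.ofNat 4 (i - 2)) ≫
        (SimplexCategory.subinterval 2 3 (by omega) : ⦋3⦌ ⟶ ⦋5⦌)) k := by
  decide

lemma map_δ_eq {X : Type u} [TopologicalSpace X] (s : (sing X) _⦋5⦌)
    (i : Fin 6) (j : Fin 4) (f : ⦋2⦌ ⟶ ⦋4⦌) (g : ⦋3⦌ ⟶ ⦋5⦌)
    (h : ∀ k : Fin 3, (f ≫ SimplexCategory.δ i) k = (SimplexCategory.δ j ≫ g) k) :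
    (sing X).map f.op ((sing X).δ i s) = (sing X).δ j ((sing X).map g.op s) := by
  have h' : f ≫ SimplexCategory.δ i = SimplexCategory.δ j ≫ g := by
    ext k : 3
    exact h k
  rw [δ_map s j g _ rfl, map_δ s i f _ h']

lemma IsCocycle.cup {X : Type u} [TopologicalSpace X] {a b : Cochain 2 X}
    (ha : IsCocycle a) (hb : IsCocycle b) : IsCocycle (cupCochain a b) := by
  intro s
  have h1 := ha ((sing X).map (SimplexCategory.subinterval 0 3 (by omega) : ⦋3⦌ ⟶ ⦋5⦌).op s)
  have h2 := hb ((sing X).map (SimplexCategory.subinterval 2 3 (by omega) : ⦋3⦌ ⟶ ⦋5⦌).op s)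
  have f1 := fun i hi => map_δ_eq s i _ _ _ (front_δ i hi)
  have f2 := fun i hi => map_δ_eq s i _ _ _ (front_δ' i hi)
  have b1 := fun i hi => map_δ_eq s i _ _ _ (back_δ i hi)
  have b2 := fun i hi => map_δ_eq s i _ _ _ (back_δ' i hi)
  simp only [cupCochain]
  generalize (sing X).map (SimplexCategory.subinterval 0 3 (by omega) : ⦋3⦌ ⟶ ⦋5⦌).op s = t at *
  generalize (sing X).map (SimplexCategory.subinterval 2 3 (by omega) : ⦋3⦌ ⟶ ⦋5⦌).op s = r at *
  have e := Fin.sum_univ_six fun i : Fin 6 => (-1 : ℤ) ^ i.val *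
    (a ((sing X).map (SimplexCategory.subinterval 0 2 (by omega) : ⦋2⦌ ⟶ ⦋4⦌).op
      ((sing X).δ i s)) *
    b ((sing X).map (SimplexCategory.subinterval 2 2 le_rfl : ⦋2⦌ ⟶ ⦋4⦌).op ((sing X).δ i s)))
  refine e.trans ?_
  rw [Fin.sum_univ_four] at h1 h2
  rw [f1 0 (by decide), f1 1 (by decide), f1 2 (by decide), f2 3 (by decide), f2 4 (by decide),
    f2 5 (by decide), b1 0 (by decide), b1 1 (by decide), b1 2 (by decide), b2 3 (by decide),
    b2 4 (by decide), b2 5 (by decide)]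
  have c1 : Fin.ofNat 4 ((0 : Fin 6) : ℕ) = 0 := rfl
  have c2 : Fin.ofNat 4 ((1 : Fin 6) : ℕ) = 1 := rfl
  have c3 : Fin.ofNat 4 ((2 : Fin 6) : ℕ) = 2 := rfl
  have c4 : Fin.ofNat 4 (((3 : Fin 6) : ℕ) - 2) = 1 := rfl
  have c5 : Fin.ofNat 4 (((4 : Fin 6) : ℕ) - 2) = 2 := rfl
  have c6 : Fin.ofNat 4 (((5 : Fin 6) : ℕ) - 2) = 3 := rfl
  rw [c1, c2, c3, c4, c5, c6]
  norm_num [Fin.val_zero, Fin.val_one, Fin.val_two] at h1 h2 ⊢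
  generalize a ((sing X).δ 0 t) = a0 at *
  generalize a ((sing X).δ 1 t) = a1 at *
  generalize a ((sing X).δ 2 t) = a2 at *
  generalize a ((sing X).δ 3 t) = a3 at *
  generalize b ((sing X).δ 0 r) = b0 at *
  generalize b ((sing X).δ 1 r) = b1 at *
  generalize b ((sing X).δ 2 r) = b2 at *
  generalize b ((sing X).δ 3 r) = b3 at *
  linear_combination b0 * h1 + a3 * h2

/-- The intersection form `Q(a, b) = ⟨a ∪ b, μ⟩` of a closed oriented `4`-manifold with
fundamental class `μ`, on representing cocycles of classes in `H²(X; ℤ)`. -/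
def intersectionForm {X : Type u} [TopologicalSpace X] (μ : H 4 X) (a b : Cocycle 2 X) : ℤ :=
  pairing (⟨cupCochain a.1 b.1, a.2.cup b.2⟩ : Cocycle 4 X) μ

/-- The closed `4`-manifold `X` is orientable and its intersection form is odd: some class in
`H²(X; ℤ)` has odd square. (For connected `X` the parity does not depend on the orientation.) -/
def HasOddIntersectionForm (X : Type u) [TopologicalSpace X] : Prop :=
  ∃ μ : H 4 X, IsFundamentalClass 4 μ ∧ ∃ a : Cocycle 2 X, Odd (intersectionForm μ a a)

/-- The cocycle `a` is Poincaré dual to `h ∈ H_2(X; ℤ)`: one has `⟨c, h⟩ = ⟨c ∪ a, μ⟩` for all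
`c ∈ H²(X; ℤ)`. On a closed oriented `4`-manifold such an `a` exists for every `h`, and its class
is unique up to torsion. -/
def IsPoincareDual {X : Type u} [TopologicalSpace X] (μ : H 4 X) (h : H 2 X) (a : Cocycle 2 X) :
    Prop :=
  ∀ c : Cocycle 2 X, pairing c h = intersectionForm μ c a

open Classical in
/-- The intersection number `h · k ∈ ℤ` of two classes in `H_2(X; ℤ)`, for a closed oriented
`4`-manifold `X` with fundamental class `μ`: the value on `k` of a Poincaré dual of `h`.
It does not depend on the dual that is chosen; the default value `0` for a class without a dual is
never used on a closed oriented `4`-manifold. -/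
def intersectionNumber {X : Type u} [TopologicalSpace X] (μ : H 4 X) (h k : H 2 X) : ℤ :=
  if hd : ∃ a : Cocycle 2 X, IsPoincareDual μ h a then pairing hd.choose k else 0

end SingularHomology

namespace ZTwo

open SingularHomology

/-! ### Surfaces with trivial normal bundle and the `ℤ₂`-construction -/

/-- A surface `S` embedded in a `4`-manifold `M` with trivial normal bundle, together with a
framing: a diffeomorphism of `ℂ × S` onto an open subset of `M`. The embedded surface `Σ` is the
image of `{0} × S`, and the tubular neighbourhood `νΣ` is the image of `D² × S`, where `D²` is the
closed unit disc. -/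
structure FramedSurface (S M : Type u) [TopologicalSpace S] [TopologicalSpace M]
    [ChartedSpace (EuclideanSpace ℝ (Fin 2)) S] [ChartedSpace (EuclideanSpace ℝ (Fin 4)) M] where
  /-- The inverse of the framing. -/
  toFun : ℂ × S → M
  injective : Function.Injective toFun
  isLocalDiffeomorph : IsLocalDiffeomorph (𝓘(ℝ, ℂ).prod (𝓡 2)) (𝓡 4) ∞ toFun

/-- `φ` is an orientation reversing free smooth involution of the closed connected oriented surface
`S` with fundamental class `σ`. If `S` has genus `g`, these are precisely the deck transformations
of the double coverings of the nonorientable surface `#_{g+1} ℝP²` by `S`. -/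
structure IsReversingFreeInvolution {S : Type u} [TopologicalSpace S]
    [ChartedSpace (EuclideanSpace ℝ (Fin 2)) S] (σ : H 2 S) (φ : C(S, S)) : Prop where
  contMDiff : ContMDiff (𝓡 2) (𝓡 2) ∞ φ
  involutive : Function.Involutive φ
  free : ∀ s, φ s ≠ s
  reversing : push 2 φ σ = -σ

namespace FramedSurface

variable {S M : Type u} [TopologicalSpace S] [TopologicalSpace M]
  [ChartedSpace (EuclideanSpace ℝ (Fin 2)) S] [ChartedSpace (EuclideanSpace ℝ (Fin 4)) M]

lemma continuous_toFun (η : FramedSurface S M) : Continuous η.toFun :=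
  η.isLocalDiffeomorph.contMDiff.continuous

/-- The embedding of the surface `S` in `M`. -/
def emb (η : FramedSurface S M) : C(S, M) :=
  ⟨fun s => η.toFun (0, s), η.continuous_toFun.comp (by fun_prop)⟩

/-- The complement `M - Σ` of the surface. -/
abbrev Complement (η : FramedSurface S M) : Type u := {x : M // x ∉ Set.range η.emb}

/-- The point of `∂νΣ` with the coordinates `(z, s) ∈ S¹ × S`, in `M - Σ`. -/
def complementPoint (η : FramedSurface S M) (s : S) (z : Circle) : η.Complement :=
  ⟨η.toFun (z, s), by
    rintro ⟨t, ht⟩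
    have h := η.injective ht
    exact z.coe_ne_zero (congrArg Prod.fst h).symm⟩

/-- The meridian of `Σ` at `s`: the loop `t ↦ (exp(2πit), s)` in `∂νΣ ≅ S¹ × S`. -/
def meridian (η : FramedSurface S M) (s : S) :
    Path (η.complementPoint s 1) (η.complementPoint s 1) where
  toFun t := η.complementPoint s (Circle.exp (2 * Real.pi * (t : ℝ)))
  continuous_toFun := by
    refine Continuous.subtype_mk (η.continuous_toFun.comp ?_) _
    fun_prop
  source' := by simp
  target' := by simp

/-- The class of the meridian in `π₁(M - Σ)`. -/
def meridianClass (η : FramedSurface S M) (s : S) :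
    FundamentalGroup η.Complement (η.complementPoint s 1) :=
  FundamentalGroup.fromPath (Path.Homotopic.Quotient.mk (η.meridian s))

/-- The exterior `M ∖ νΣ`, as a compact manifold with boundary `∂νΣ`: the complement of the image
of the open unit disc bundle. -/
abbrev Exterior (η : FramedSurface S M) : Type u :=
  {x : M // x ∉ η.toFun '' (Metric.ball (0 : ℂ) 1 ×ˢ Set.univ)}

/-- The point of `∂νΣ` with the coordinates `(z, s) ∈ S¹ × S`, in the exterior. -/
def boundaryPoint (η : FramedSurface S M) (z : Circle) (s : S) : η.Exterior :=
  ⟨η.toFun (z, s), by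
    rintro ⟨⟨w, t⟩, ⟨hw, -⟩, ht⟩
    have h : w = z := congrArg Prod.fst (η.injective ht)
    rw [mem_ball_zero_iff, h, Circle.norm_coe] at hw
    exact lt_irrefl _ hw⟩

/-- The gluing of two copies of the exterior: `(x, false) ∼ (Φ x, true)` for `x ∈ ∂νΣ`, where
`Φ(z, s) = (z, φ s)` in the coordinates of the framing. -/
inductive Glue (η : FramedSurface S M) (φ : S → S) :
    η.Exterior × Bool → η.Exterior × Bool → Prop where
  | glue (z : Circle) (s : S) :
    Glue η φ (η.boundaryPoint z s, false) (η.boundaryPoint z (φ s), true)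

/-- The double `(M ∖ νΣ) ∪_Φ (M ∖ νΣ)` of `M` along `Σ`, with the quotient topology. -/
def Double (η : FramedSurface S M) (φ : S → S) : Type u := Quot (η.Glue φ)

instance (η : FramedSurface S M) (φ : S → S) : TopologicalSpace (η.Double φ) :=
  inferInstanceAs (TopologicalSpace (Quot (η.Glue φ)))

/-- The involution `τ` of the double that swaps the two copies of the exterior. -/
def swap (η : FramedSurface S M) (φ : S → S) (hφ : Function.Involutive φ) :
    η.Double φ → η.Double φ :=
  Quot.lift (fun p => Quot.mk _ (p.1, !p.2)) (by
    rintro _ _ ⟨z, s⟩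
    have h := Quot.sound (Glue.glue (η := η) (φ := φ) z (φ s))
    rw [hφ s] at h
    exact h.symm)

/-- The `ℤ₂`-construction of `M` along `Σ`: the quotient of the double by `τ`. -/
def Construction (η : FramedSurface S M) (φ : S → S) (hφ : Function.Involutive φ) : Type u :=
  Quot fun p q : η.Double φ => q = η.swap φ hφ p

instance (η : FramedSurface S M) (φ : S → S) (hφ : Function.Involutive φ) :
    TopologicalSpace (η.Construction φ hφ) :=
  inferInstanceAs (TopologicalSpace (Quot fun p q : η.Double φ => q = η.swap φ hφ p))

end FramedSurface

end ZTwo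

end

/-! On the punctured tube `ℂ* × S` consider the free involution `ρ(z, s) = (1/z̄, φ s)`. It
exchanges the inside and the outside of the unit circle bundle and equals `Φ` on that bundle. Hence
`X` is homeomorphic to `M - Σ` with each tube point `p` identified with `ρ p` (`homeoFolded`). The
projection `fold` from `M - Σ` is open and locally injective, so `X` is Hausdorff and has Euclidean
charts.

For (1), take a holonomy on `M - Σ` with values in its fundamental group. If the meridian is
trivial, a change of gauge makes it independent of the `ℂ*` coordinate on the tube, so it extends
over `Σ` to `M`. Since `M` is simply connected, every loop of `M - Σ` has trivial holonomy
(`simplyConnectedSpace_complement`). Two copies of `M - Σ` glued along the connected punctured tube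
are then simply connected (`simplyConnectedSpace_openDouble`), and `X` is the quotient of this
double by a free action of `ℤ/2` (`isAddQuotientCoveringMap_cover`).

For (2), let the cocycle `a` be Poincaré dual to `α`. As `α · [Σ] = 0`, it vanishes on the
fundamental cycle of `Σ`, so it is a coboundary there (`exists_primitive_surface`), and a coboundary
can be subtracted to make it vanish identically on the tube (`exists_vanishing_on_tube`). Cut a
fundamental cycle of `M` into a chain `c` outside the closed tube and a chain in the open tube
(`exists_cut`). The boundary of `c` is a 3-cycle in the punctured tube. The map from the punctured
tube to `X` factors up to homotopy through `S¹ × S/φ`, where this 3-cycle bounds because `S/φ` is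
nonorientable. So it is filled in by a chain `e` in the image of the tube (`exists_bd_foldTube`).
The cycle `c - e` in `X` generates the local homology at a point far from the tube, hence everywhere
(`GeneratesAt.move`), and is a fundamental cycle. The cocycle `a`, extended by zero, has the same
square on it as on `M`, because nothing in the tube contributes on either side.

The algebraic topology is developed on chains and cochains themselves: acyclic models on linear
chains, barycentric subdivision, Mayer–Vietoris for cochains restricted to open subsets, and
excision. `isFundamentalClass_iff` and `pairing_eq` translate the result to singular homology. -/

noncomputable section

/-! ### Singular chains, subdivision and homotopies by acyclic models -/

namespace Sing

/-! ### Linear chains -/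

/-- Ordered linear chains with vertices in `K`. -/
abbrev LCh (n : ℕ) (K : Type*) := (Fin (n + 1) → K) →₀ ℤ

/-- The linear simplex with the given vertices. -/
abbrev sg {α : Type*} (a : α) : α →₀ ℤ := Finsupp.single a 1

theorem lhom_ext {α M : Type*} [AddCommGroup M] {f g : (α →₀ ℤ) →ₗ[ℤ] M}
    (h : ∀ a, f (sg a) = g (sg a)) : f = g :=
  Finsupp.lhom_ext' fun a => LinearMap.ext_ring (h a)

theorem lhom_eq {α M : Type*} [AddCommGroup M] {f g : (α →₀ ℤ) →ₗ[ℤ] M}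
    (h : ∀ a, f (sg a) = g (sg a)) (x : α →₀ ℤ) : f x = g x := by
  rw [lhom_ext h]

section Linear

variable {K L : Type*}

/-- The boundary of linear chains. -/
def lbd (n : ℕ) : LCh (n + 1) K →ₗ[ℤ] LCh n K :=
  Finsupp.linearCombination ℤ fun v => ∑ i : Fin (n + 2), (-1 : ℤ) ^ (i : ℕ) • sg (v ∘ i.succAbove)

/-- The augmentation of a free abelian group. -/
def aug {α : Type*} : (α →₀ ℤ) →ₗ[ℤ] ℤ := Finsupp.linearCombination ℤ fun _ => (1 : ℤ)

/-- The cone with apex `b`. -/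
def cone (b : K) (n : ℕ) : LCh n K →ₗ[ℤ] LCh (n + 1) K :=
  Finsupp.linearCombination ℤ fun v => sg (Fin.cons b v : Fin (n + 2) → K)

/-- The map of linear chains given by a map of vertices. -/
def lmap (f : K → L) (n : ℕ) : LCh n K →ₗ[ℤ] LCh n L :=
  Finsupp.linearCombination ℤ fun v => sg (f ∘ v)

@[simp] theorem aug_sg {α : Type*} (a : α) : aug (sg a) = 1 := by simp [aug]

theorem lbd_sg (n : ℕ) (v : Fin (n + 2) → K) :
    lbd n (sg v) = ∑ i : Fin (n + 2), (-1 : ℤ) ^ (i : ℕ) • sg (v ∘ i.succAbove) := by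
  simp [lbd]

@[simp] theorem cone_sg (b : K) (n : ℕ) (v : Fin (n + 1) → K) :
    cone b n (sg v) = sg (Fin.cons b v : Fin (n + 2) → K) := by simp [cone]

@[simp] theorem lmap_sg (f : K → L) (n : ℕ) (v : Fin (n + 1) → K) :
    lmap f n (sg v) = sg (f ∘ v) := by simp [lmap]

theorem aug_lbd (x : LCh 1 K) : aug (lbd 0 x) = 0 := by
  refine lhom_eq (f := aug ∘ₗ lbd 0) (g := 0) (fun v => ?_) x
  simp [lbd_sg, Fin.sum_univ_two]

/-- In degree zero the cone formula has an apex term counted by the augmentation. This is why the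
cone homotopies below need two maps of equal augmentation. -/
theorem lbd_cone_zero (b : K) (x : LCh 0 K) :
    lbd 0 (cone b 0 x) = x - aug x • sg (fun _ => b) := by
  refine lhom_eq (f := lbd 0 ∘ₗ cone b 0) (g := LinearMap.id -
    aug.smulRight (sg (fun _ => b))) (fun v => ?_) x
  have h0 : (Fin.cons b v : Fin 2 → K) ∘ (0 : Fin 2).succAbove = v := by
    ext i; simp
  have h1 : (Fin.cons b v : Fin 2 → K) ∘ (1 : Fin 2).succAbove = fun _ => b := by
    ext i; fin_cases i; rfl
  simp [lbd_sg, Fin.sum_univ_two, h1, sub_eq_add_neg]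

theorem lbd_cone (b : K) (n : ℕ) (x : LCh (n + 1) K) :
    lbd (n + 1) (cone b (n + 1) x) = x - cone b n (lbd n x) := by
  refine lhom_eq (f := lbd (n + 1) ∘ₗ cone b (n + 1)) (g := LinearMap.id -
    cone b n ∘ₗ lbd n) (fun v => ?_) x
  have h0 : (Fin.cons b v : Fin (n + 3) → K) ∘ (0 : Fin (n + 3)).succAbove = v := by
    ext i; simp
  have h1 (i : Fin (n + 2)) : (Fin.cons b v : Fin (n + 3) → K) ∘ i.succ.succAbove =
      Fin.cons b (v ∘ i.succAbove) := by
    ext j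
    refine Fin.cases ?_ (fun j => ?_) j
    · simp
    · simp
  simp only [LinearMap.comp_apply, cone_sg, LinearMap.sub_apply, LinearMap.id_apply, lbd_sg]
  rw [Fin.sum_univ_succ]
  simp only [h0, h1, map_sum, map_smul, cone_sg, Fin.val_succ, pow_succ, Fin.val_zero, pow_zero,
    one_smul, mul_neg, mul_one, neg_smul, Finset.sum_neg_distrib, sub_eq_add_neg]

/-- With every linear simplex seen as a cone, `∂² = 0` follows from the cone formula and no double
sum over faces has to be reindexed. -/
theorem exists_cone (n : ℕ) (v : Fin (n + 2) → K) :
    sg v = cone (v 0) n (sg (v ∘ Fin.succ)) := by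
  rw [cone_sg]
  congr 1
  ext i
  refine Fin.cases rfl (fun i => rfl) i

theorem lbd_lbd (n : ℕ) (x : LCh (n + 2) K) : lbd n (lbd (n + 1) x) = 0 := by
  induction n with
  | zero =>
    refine lhom_eq (f := lbd 0 ∘ₗ lbd 1) (g := 0) (fun v => ?_) x
    simp only [LinearMap.comp_apply, LinearMap.zero_apply]
    rw [exists_cone, lbd_cone, map_sub, lbd_cone_zero, aug_lbd]
    simp
  | succ n ih =>
    refine lhom_eq (f := lbd (n + 1) ∘ₗ lbd (n + 2)) (g := 0) (fun v => ?_) x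
    simp only [LinearMap.comp_apply, LinearMap.zero_apply]
    rw [exists_cone, lbd_cone, map_sub, lbd_cone, ih]
    simp

theorem lmap_lbd (f : K → L) (n : ℕ) (x : LCh (n + 1) K) :
    lmap f n (lbd n x) = lbd n (lmap f (n + 1) x) := by
  refine lhom_eq (f := lmap f n ∘ₗ lbd n) (g := lbd n ∘ₗ lmap f (n + 1)) (fun v => ?_) x
  simp only [LinearMap.comp_apply, lbd_sg, lmap_sg, map_sum, map_smul, Function.comp_assoc]

theorem lmap_cone (f : K → L) (b : K) (n : ℕ) (x : LCh n K) :
    lmap f (n + 1) (cone b n x) = cone (f b) n (lmap f n x) := by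
  refine lhom_eq (f := lmap f (n + 1) ∘ₗ cone b n) (g := cone (f b) n ∘ₗ lmap f n) (fun v => ?_) x
  simp only [LinearMap.comp_apply, cone_sg, lmap_sg]
  congr 1
  exact Fin.comp_cons f b v

/-- The chain homotopy between two maps of linear chains that is obtained inductively by coning
off with the apexes `b`. -/
def coneHtpy (F₀ F₁ : ∀ n, LCh n K →ₗ[ℤ] LCh n L) (b : ∀ n, (Fin (n + 1) → K) → L) :
    ∀ n, LCh n K →ₗ[ℤ] LCh (n + 1) L :=
  fun n => Nat.rec
    (Finsupp.linearCombination ℤ fun v => cone (b 0 v) 0 (F₀ 0 (sg v) - F₁ 0 (sg v)))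
    (fun n h => Finsupp.linearCombination ℤ fun v => cone (b (n + 1) v) (n + 1)
      (F₀ (n + 1) (sg v) - F₁ (n + 1) (sg v) - h (lbd n (sg v)))) n

variable {F₀ F₁ : ∀ n, LCh n K →ₗ[ℤ] LCh n L} {b : ∀ n, (Fin (n + 1) → K) → L}

theorem coneHtpy_zero_sg (v : Fin 1 → K) :
    coneHtpy F₀ F₁ b 0 (sg v) = cone (b 0 v) 0 (F₀ 0 (sg v) - F₁ 0 (sg v)) := by
  simp [coneHtpy]

theorem coneHtpy_succ_sg (n : ℕ) (v : Fin (n + 2) → K) :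
    coneHtpy F₀ F₁ b (n + 1) (sg v) = cone (b (n + 1) v) (n + 1)
      (F₀ (n + 1) (sg v) - F₁ (n + 1) (sg v) - coneHtpy F₀ F₁ b n (lbd n (sg v))) := by
  simp [coneHtpy]

theorem lbd_coneHtpy_zero (ha : ∀ x, aug (F₀ 0 x) = aug (F₁ 0 x)) (x : LCh 0 K) :
    lbd 0 (coneHtpy F₀ F₁ b 0 x) = F₀ 0 x - F₁ 0 x := by
  refine lhom_eq (f := lbd 0 ∘ₗ coneHtpy F₀ F₁ b 0) (g := F₀ 0 - F₁ 0) (fun v => ?_) x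
  simp only [LinearMap.comp_apply, LinearMap.sub_apply, coneHtpy_zero_sg]
  rw [lbd_cone_zero, map_sub, ha, sub_self, zero_smul, sub_zero]

/-- Acyclic models: by the formula one degree lower, the chain that is coned off is a cycle, and the
cone on a cycle bounds that cycle. -/
theorem lbd_coneHtpy_succ (ha : ∀ x, aug (F₀ 0 x) = aug (F₁ 0 x))
    (h₀ : ∀ n x, lbd n (F₀ (n + 1) x) = F₀ n (lbd n x))
    (h₁ : ∀ n x, lbd n (F₁ (n + 1) x) = F₁ n (lbd n x)) (n : ℕ) (x : LCh (n + 1) K) :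
    lbd (n + 1) (coneHtpy F₀ F₁ b (n + 1) x) =
      F₀ (n + 1) x - F₁ (n + 1) x - coneHtpy F₀ F₁ b n (lbd n x) := by
  induction n with
  | zero =>
    refine lhom_eq (f := lbd 1 ∘ₗ coneHtpy F₀ F₁ b 1)
      (g := F₀ 1 - F₁ 1 - coneHtpy F₀ F₁ b 0 ∘ₗ lbd 0) (fun v => ?_) x
    simp only [LinearMap.comp_apply, LinearMap.sub_apply, coneHtpy_succ_sg]
    rw [lbd_cone]
    simp only [map_sub]
    rw [h₀, h₁, lbd_coneHtpy_zero ha]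
    simp
  | succ n ih =>
    refine lhom_eq (f := lbd (n + 2) ∘ₗ coneHtpy F₀ F₁ b (n + 2))
      (g := F₀ (n + 2) - F₁ (n + 2) - coneHtpy F₀ F₁ b (n + 1) ∘ₗ lbd (n + 1)) (fun v => ?_) x
    simp only [LinearMap.comp_apply, LinearMap.sub_apply, coneHtpy_succ_sg]
    rw [lbd_cone]
    simp only [map_sub]
    rw [h₀, h₁, ih, lbd_lbd]
    simp

/-- Natural apexes make the whole inductive construction natural. Operators can therefore be defined
on the standard simplex and carried to singular simplices. -/
theorem lmap_coneHtpy {K' L' : Type*} {F₀' F₁' : ∀ n, LCh n K' →ₗ[ℤ] LCh n L'}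
    {b' : ∀ n, (Fin (n + 1) → K') → L'} (f : K → K') (f' : L → L')
    (h₀ : ∀ n x, lmap f' n (F₀ n x) = F₀' n (lmap f n x))
    (h₁ : ∀ n x, lmap f' n (F₁ n x) = F₁' n (lmap f n x))
    (hb : ∀ n v, f' (b n v) = b' n (f ∘ v)) (n : ℕ) (x : LCh n K) :
    lmap f' (n + 1) (coneHtpy F₀ F₁ b n x) = coneHtpy F₀' F₁' b' n (lmap f n x) := by
  induction n with
  | zero =>
    refine lhom_eq (f := lmap f' 1 ∘ₗ coneHtpy F₀ F₁ b 0)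
      (g := coneHtpy F₀' F₁' b' 0 ∘ₗ lmap f 0) (fun v => ?_) x
    simp only [LinearMap.comp_apply, lmap_sg, coneHtpy_zero_sg]
    rw [lmap_cone, map_sub, h₀, h₁, hb, lmap_sg]
  | succ n ih =>
    refine lhom_eq (f := lmap f' (n + 2) ∘ₗ coneHtpy F₀ F₁ b (n + 1))
      (g := coneHtpy F₀' F₁' b' (n + 1) ∘ₗ lmap f (n + 1)) (fun v => ?_) x
    simp only [LinearMap.comp_apply, lmap_sg, coneHtpy_succ_sg]
    rw [lmap_cone]
    simp only [map_sub]
    rw [h₀, h₁, hb, ih, lmap_lbd, lmap_sg]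

/-- Subdivision of linear chains with respect to a choice of barycenters. -/
def lsd (b : ∀ n, (Fin (n + 1) → K) → K) : ∀ n, LCh n K →ₗ[ℤ] LCh n K :=
  fun n => Nat.rec LinearMap.id (fun n h => Finsupp.linearCombination ℤ fun v =>
    cone (b (n + 1) v) n (h (lbd n (sg v)))) n

theorem lsd_succ_sg (b : ∀ n, (Fin (n + 1) → K) → K) (n : ℕ) (v : Fin (n + 2) → K) :
    lsd b (n + 1) (sg v) = cone (b (n + 1) v) n (lsd b n (lbd n (sg v))) := by
  simp [lsd]

theorem lbd_lsd (b : ∀ n, (Fin (n + 1) → K) → K) (n : ℕ) (x : LCh (n + 1) K) :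
    lbd n (lsd b (n + 1) x) = lsd b n (lbd n x) := by
  induction n with
  | zero =>
    refine lhom_eq (f := lbd 0 ∘ₗ lsd b 1) (g := lsd b 0 ∘ₗ lbd 0) (fun v => ?_) x
    simp only [LinearMap.comp_apply, lsd_succ_sg]
    rw [lbd_cone_zero]
    simp [lsd, aug_lbd]
  | succ n ih =>
    refine lhom_eq (f := lbd (n + 1) ∘ₗ lsd b (n + 2)) (g := lsd b (n + 1) ∘ₗ lbd (n + 1))
      (fun v => ?_) x
    simp only [LinearMap.comp_apply, lsd_succ_sg]
    rw [lbd_cone, ih, lbd_lbd]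
    simp

theorem lmap_lsd {b : ∀ n, (Fin (n + 1) → K) → K} {b' : ∀ n, (Fin (n + 1) → L) → L} (f : K → L)
    (hb : ∀ n v, f (b n v) = b' n (f ∘ v)) (n : ℕ) (x : LCh n K) :
    lmap f n (lsd b n x) = lsd b' n (lmap f n x) := by
  induction n with
  | zero => rfl
  | succ n ih =>
    refine lhom_eq (f := lmap f (n + 1) ∘ₗ lsd b (n + 1)) (g := lsd b' (n + 1) ∘ₗ lmap f (n + 1))
      (fun v => ?_) x
    simp only [LinearMap.comp_apply, lmap_sg, lsd_succ_sg]
    rw [lmap_cone, hb, ih, lmap_lbd, lmap_sg]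

end Linear

/-! ### Spaces with convex combinations -/

/-- The standard topological simplex. -/
abbrev Δ (n : ℕ) := stdSimplex ℝ (Fin (n + 1))

/-- The point of a standard simplex given by a convex combination of points. -/
def mix {j k : ℕ} (v : Fin (j + 1) → Δ k) (p : Δ j) : Δ k :=
  ⟨fun l => ∑ i, p i * v i l, fun l => Finset.sum_nonneg fun i _ =>
      mul_nonneg (p.2.1 i) ((v i).2.1 l), by
    rw [Finset.sum_comm]
    simp_rw [← Finset.mul_sum]
    have h : ∀ i, ∑ l, v i l = 1 := fun i => (v i).2.2
    simp_rw [h, mul_one]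
    exact p.2.2⟩

theorem mix_apply {j k : ℕ} (v : Fin (j + 1) → Δ k) (p : Δ j) (l : Fin (k + 1)) :
    mix v p l = ∑ i, p i * v i l := rfl

theorem continuous_coord {n : ℕ} (i : Fin (n + 1)) : Continuous fun p : Δ n => p i :=
  (continuous_apply i).comp continuous_subtype_val

theorem continuous_mix {j k : ℕ} (v : Fin (j + 1) → Δ k) : Continuous (mix v) := by
  refine Continuous.subtype_mk (continuous_pi fun l => ?_) _
  exact continuous_finsetSum _ fun i _ => (continuous_coord i).mul continuous_const

/-- The vertices of the standard simplex. -/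
abbrev vx {n : ℕ} (i : Fin (n + 1)) : Δ n := stdSimplex.vertex i

theorem vx_apply {n : ℕ} (i j : Fin (n + 1)) : (vx i : Δ n) j = if j = i then 1 else 0 := by
  rw [stdSimplex.vertex_coe, Pi.single_apply]

/-- A topological space in which convex combinations of points are defined. -/
class ConvexLike (K : Type*) [TopologicalSpace K] where
  /-- The singular simplex of the convex combinations of given points. -/
  aff {k : ℕ} (v : Fin (k + 1) → K) : C(Δ k, K)
  aff_vx {k : ℕ} (v : Fin (k + 1) → K) (i : Fin (k + 1)) : aff v (vx i) = v i
  aff_mix {j k : ℕ} (w : Fin (k + 1) → K) (v : Fin (j + 1) → Δ k) (p : Δ j) :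
    aff w (mix v p) = aff (fun i => aff w (v i)) p

export ConvexLike (aff aff_vx aff_mix)

theorem mix_vx' {j k : ℕ} (v : Fin (j + 1) → Δ k) (i : Fin (j + 1)) : mix v (vx i) = v i := by
  apply stdSimplex.ext
  ext l
  simp [mix_apply, vx_apply]

instance (n : ℕ) : ConvexLike (Δ n) where
  aff v := ⟨mix v, continuous_mix v⟩
  aff_vx v i := mix_vx' v i
  aff_mix w v p := by
    apply stdSimplex.ext
    ext l
    simp only [ContinuousMap.coe_mk, mix_apply, Finset.mul_sum, Finset.sum_mul]
    rw [Finset.sum_comm]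
    simp only [mul_assoc]

theorem aff_simplex {j k : ℕ} (v : Fin (j + 1) → Δ k) (p : Δ j) : aff v p = mix v p := rfl

theorem mix_vx {n : ℕ} (p : Δ n) : mix vx p = p := by
  apply stdSimplex.ext
  ext l
  simp [mix_apply, vx_apply]

theorem aff_vertices {n : ℕ} : aff (vx : Fin (n + 1) → Δ n) = ContinuousMap.id _ :=
  ContinuousMap.ext mix_vx

instance : ConvexLike unitInterval where
  aff v := ⟨fun p => ⟨∑ i, p i * (v i : ℝ), Finset.sum_nonneg fun i _ =>
      mul_nonneg (p.2.1 i) (v i).2.1, by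
      calc ∑ i, p i * (v i : ℝ) ≤ ∑ i, p i * 1 := Finset.sum_le_sum fun i _ =>
            mul_le_mul_of_nonneg_left (v i).2.2 (p.2.1 i)
        _ = 1 := by simp only [mul_one]; exact p.2.2⟩,
    Continuous.subtype_mk (continuous_finsetSum _ fun i _ =>
      (continuous_coord i).mul continuous_const) _⟩
  aff_vx v i := by
    apply Subtype.ext
    simp [vx_apply]
  aff_mix w v p := by
    apply Subtype.ext
    simp only [ContinuousMap.coe_mk, mix_apply, Finset.mul_sum, Finset.sum_mul]
    rw [Finset.sum_comm]
    simp only [mul_assoc]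

instance {K L : Type*} [TopologicalSpace K] [TopologicalSpace L] [ConvexLike K] [ConvexLike L] :
    ConvexLike (K × L) where
  aff v := (aff fun i => (v i).1).prodMk (aff fun i => (v i).2)
  aff_vx v i := Prod.ext (aff_vx _ i) (aff_vx _ i)
  aff_mix w v p := Prod.ext (aff_mix _ v p) (aff_mix _ v p)

/-- Maps that preserve convex combinations. -/
def IsAff {K L : Type*} [TopologicalSpace K] [TopologicalSpace L] [ConvexLike K] [ConvexLike L]
    (f : C(K, L)) : Prop :=
  ∀ (k : ℕ) (v : Fin (k + 1) → K), f.comp (aff v) = aff (f ∘ v)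

theorem isAff_aff {K : Type*} [TopologicalSpace K] [ConvexLike K] {k : ℕ} (w : Fin (k + 1) → K) :
    IsAff (aff w) := fun _ v => ContinuousMap.ext fun p => aff_mix w v p

/-- A constant vertex map factors through the zero-simplex, which has only one point, so the axiom
`aff_mix` is enough. -/
theorem aff_const {K : Type*} [TopologicalSpace K] [ConvexLike K] {k : ℕ} (x : K) (p : Δ k) :
    aff (fun _ : Fin (k + 1) => x) p = x := by
  have h := aff_mix (fun _ : Fin 1 => x) (fun _ : Fin (k + 1) => vx 0) p
  have h0 : mix (fun _ : Fin (k + 1) => (vx 0 : Δ 0)) p = vx 0 := Subsingleton.elim _ _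
  rw [h0] at h
  simp only [aff_vx] at h
  exact h.symm

/-! ### Singular chains -/

section Singular

variable {X Y Z : Type*} [TopologicalSpace X] [TopologicalSpace Y] [TopologicalSpace Z]

/-- Singular simplices. -/
abbrev Simp (n : ℕ) (X : Type*) [TopologicalSpace X] := C(Δ n, X)

/-- Singular chains. -/
abbrev Ch (n : ℕ) (X : Type*) [TopologicalSpace X] := Simp n X →₀ ℤ

/-- The inclusion of a face of the standard simplex. -/
def face {n : ℕ} (i : Fin (n + 2)) : C(Δ n, Δ (n + 1)) := aff (vx ∘ i.succAbove)

/-- The boundary of singular chains. -/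
def bd (n : ℕ) : Ch (n + 1) X →ₗ[ℤ] Ch n X :=
  Finsupp.linearCombination ℤ fun s => ∑ i : Fin (n + 2), (-1 : ℤ) ^ (i : ℕ) • sg (s.comp (face i))

/-- The map of singular chains that is induced by a continuous map. -/
def cmap (f : C(X, Y)) (n : ℕ) : Ch n X →ₗ[ℤ] Ch n Y :=
  Finsupp.linearCombination ℤ fun s => sg (f.comp s)

theorem bd_sg (n : ℕ) (s : Simp (n + 1) X) :
    bd n (sg s) = ∑ i : Fin (n + 2), (-1 : ℤ) ^ (i : ℕ) • sg (s.comp (face i)) := by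
  simp [bd]

@[simp] theorem cmap_sg (f : C(X, Y)) (n : ℕ) (s : Simp n X) :
    cmap f n (sg s) = sg (f.comp s) := by simp [cmap]

theorem cmap_bd (f : C(X, Y)) (n : ℕ) (x : Ch (n + 1) X) :
    cmap f n (bd n x) = bd n (cmap f (n + 1) x) := by
  refine lhom_eq (f := cmap f n ∘ₗ bd n) (g := bd n ∘ₗ cmap f (n + 1)) (fun v => ?_) x
  simp only [LinearMap.comp_apply, bd_sg, cmap_sg, map_sum, map_smul, ContinuousMap.comp_assoc]

theorem cmap_cmap (g : C(Y, Z)) (f : C(X, Y)) (n : ℕ) (x : Ch n X) :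
    cmap g n (cmap f n x) = cmap (g.comp f) n x := by
  refine lhom_eq (f := cmap g n ∘ₗ cmap f n) (g := cmap (g.comp f) n) (fun v => ?_) x
  simp [ContinuousMap.comp_assoc]

/-- The singular chain that is the image of a linear chain. -/
def real {K : Type*} [TopologicalSpace K] [ConvexLike K] (s : C(K, X)) (n : ℕ) :
    LCh n K →ₗ[ℤ] Ch n X :=
  Finsupp.linearCombination ℤ fun v => sg (s.comp (aff v))

section

variable {K L : Type*} [TopologicalSpace K] [ConvexLike K] [TopologicalSpace L] [ConvexLike L]

@[simp] theorem real_sg (s : C(K, X)) (n : ℕ) (v : Fin (n + 1) → K) :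
    real s n (sg v) = sg (s.comp (aff v)) := by simp [real]

theorem aff_comp_face {n : ℕ} (v : Fin (n + 2) → K) (i : Fin (n + 2)) :
    (aff v).comp (face i) = aff (v ∘ i.succAbove) := by
  rw [face, isAff_aff v]
  congr 1
  ext j
  exact aff_vx v _

theorem bd_real (s : C(K, X)) (n : ℕ) (x : LCh (n + 1) K) :
    bd n (real s (n + 1) x) = real s n (lbd n x) := by
  refine lhom_eq (f := bd n ∘ₗ real s (n + 1)) (g := real s n ∘ₗ lbd n) (fun v => ?_) x
  simp only [LinearMap.comp_apply, bd_sg, lbd_sg, real_sg, map_sum, map_smul,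
    ContinuousMap.comp_assoc, aff_comp_face]

theorem real_comp (s : C(L, X)) (f : C(K, L)) (hf : IsAff f) (n : ℕ) (x : LCh n K) :
    real (s.comp f) n x = real s n (lmap f n x) := by
  refine lhom_eq (f := real (s.comp f) n) (g := real s n ∘ₗ lmap f n) (fun v => ?_) x
  simp only [LinearMap.comp_apply, real_sg, lmap_sg, ContinuousMap.comp_assoc]
  rw [hf n v]

end

theorem real_vertices (n : ℕ) (s : Simp n X) : real s n (sg vx) = sg s := by
  rw [real_sg, aff_vertices, ContinuousMap.comp_id]

/-- A singular simplex is the image of the linear simplex on the vertices, so the identity is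
inherited from linear chains. -/
theorem bd_bd (n : ℕ) (x : Ch (n + 2) X) : bd n (bd (n + 1) x) = 0 := by
  refine lhom_eq (f := bd n ∘ₗ bd (n + 1)) (g := 0) (fun s => ?_) x
  simp only [LinearMap.comp_apply, LinearMap.zero_apply]
  rw [← real_vertices, bd_real, bd_real, lbd_lbd, map_zero]

/-- A linear chain of the boundary of the standard simplex. -/
theorem bd_sg' (n : ℕ) (s : Simp (n + 1) X) : bd n (sg s) = real s n (lbd n (sg vx)) := by
  rw [← bd_real, real_vertices]

/-! ### Subdivision -/

/-- Barycenters. -/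
def bary {K : Type*} [TopologicalSpace K] [ConvexLike K] (n : ℕ) (v : Fin (n + 1) → K) : K :=
  aff v stdSimplex.barycenter

theorem IsAff.bary {K L : Type*} [TopologicalSpace K] [TopologicalSpace L] [ConvexLike K]
    [ConvexLike L] {f : C(K, L)} (hf : IsAff f) (n : ℕ) (v : Fin (n + 1) → K) :
    f (Sing.bary n v) = Sing.bary n (f ∘ v) := by
  rw [Sing.bary, Sing.bary, ← hf]
  rfl

/-- Barycentric subdivision of linear chains. -/
abbrev lSd (K : Type*) [TopologicalSpace K] [ConvexLike K] := lsd (K := K) bary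

/-- The homotopy between barycentric subdivision and the identity, on linear chains. -/
abbrev lDh (K : Type*) [TopologicalSpace K] [ConvexLike K] :=
  coneHtpy (K := K) (fun _ => LinearMap.id) (lSd K) bary

/-- Barycentric subdivision of singular chains. -/
def Sd (n : ℕ) : Ch n X →ₗ[ℤ] Ch n X :=
  Finsupp.linearCombination ℤ fun s => real s n (lSd (Δ n) n (sg vx))

/-- The homotopy between barycentric subdivision and the identity. -/
def Dh (n : ℕ) : Ch n X →ₗ[ℤ] Ch (n + 1) X :=
  Finsupp.linearCombination ℤ fun s => real s (n + 1) (lDh (Δ n) n (sg vx))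

theorem Sd_sg (n : ℕ) (s : Simp n X) : Sd n (sg s) = real s n (lSd (Δ n) n (sg vx)) := by
  simp [Sd]

theorem Dh_sg (n : ℕ) (s : Simp n X) : Dh n (sg s) = real s (n + 1) (lDh (Δ n) n (sg vx)) := by
  simp [Dh]

section

variable {K L : Type*} [TopologicalSpace K] [ConvexLike K] [TopologicalSpace L] [ConvexLike L]

theorem IsAff.lmap_lDh {f : C(K, L)} (hf : IsAff f) (n : ℕ) (x : LCh n K) :
    lmap f (n + 1) (lDh K n x) = lDh L n (lmap f n x) :=
  lmap_coneHtpy (F₀ := fun _ => LinearMap.id) (F₀' := fun _ => LinearMap.id) f f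
    (fun _ _ => rfl) (fun n x => lmap_lsd f hf.bary n x) hf.bary n x

theorem comp_aff_vx (v : ℕ) (w : Fin (v + 1) → K) : (aff w : Δ v → K) ∘ vx = w :=
  funext fun i => aff_vx w i

/-- Subdivision commutes with affine simplices. Iterated subdivisions can thus be computed on linear
chains, where diameters can be measured. -/
theorem Sd_real (s : C(K, X)) (n : ℕ) (x : LCh n K) :
    Sd n (real s n x) = real s n (lSd K n x) := by
  refine lhom_eq (f := Sd n ∘ₗ real s n) (g := real s n ∘ₗ lSd K n) (fun v => ?_) x
  simp only [LinearMap.comp_apply, real_sg, Sd_sg]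
  rw [real_comp _ _ (isAff_aff v), lmap_lsd _ (isAff_aff v).bary, lmap_sg, comp_aff_vx]

theorem Dh_real (s : C(K, X)) (n : ℕ) (x : LCh n K) :
    Dh n (real s n x) = real s (n + 1) (lDh K n x) := by
  refine lhom_eq (f := Dh n ∘ₗ real s n) (g := real s (n + 1) ∘ₗ lDh K n) (fun v => ?_) x
  simp only [LinearMap.comp_apply, real_sg, Dh_sg]
  rw [real_comp _ _ (isAff_aff v), (isAff_aff v).lmap_lDh, lmap_sg, comp_aff_vx]

end

theorem bd_Sd (n : ℕ) (x : Ch (n + 1) X) : bd n (Sd (n + 1) x) = Sd n (bd n x) := by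
  refine lhom_eq (f := bd n ∘ₗ Sd (n + 1)) (g := Sd n ∘ₗ bd n) (fun s => ?_) x
  simp only [LinearMap.comp_apply]
  rw [Sd_sg, bd_real, lbd_lsd, bd_sg', Sd_real]

theorem bd_Dh (n : ℕ) (x : Ch (n + 1) X) :
    bd (n + 1) (Dh (n + 1) x) = x - Sd (n + 1) x - Dh n (bd n x) := by
  refine lhom_eq (f := bd (n + 1) ∘ₗ Dh (n + 1)) (g := LinearMap.id - Sd (n + 1) - Dh n ∘ₗ bd n)
    (fun s => ?_) x
  simp only [LinearMap.comp_apply, LinearMap.sub_apply, LinearMap.id_apply]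
  rw [Dh_sg, bd_real, lbd_coneHtpy_succ (F₀ := fun _ => LinearMap.id)
    (F₁ := lSd _) (fun _ => rfl) (fun _ _ => rfl) (fun n x => lbd_lsd _ n x),
    map_sub, map_sub, bd_sg', Dh_real, Sd_sg, LinearMap.id_apply, real_vertices]

/-! ### Homotopies -/

/-- The prism operator on linear chains. -/
abbrev lPr (K : Type*) := coneHtpy (K := K) (L := K × unitInterval)
  (fun n => lmap (fun x => (x, 0)) n) (fun n => lmap (fun x => (x, 1)) n) fun _ v => (v 0, 0)

/-- The chain homotopy that is induced by a homotopy. -/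
def prism {f g : C(X, Y)} (H : f.Homotopy g) (n : ℕ) : Ch n X →ₗ[ℤ] Ch (n + 1) Y :=
  Finsupp.linearCombination ℤ fun s =>
    real (H.toContinuousMap.comp (ContinuousMap.prodSwap.comp (s.prodMap (ContinuousMap.id _))))
      (n + 1) (lPr (Δ n) n (sg vx))

theorem prism_sg {f g : C(X, Y)} (H : f.Homotopy g) (n : ℕ) (s : Simp n X) :
    prism H n (sg s) =
      real (H.toContinuousMap.comp (ContinuousMap.prodSwap.comp (s.prodMap (ContinuousMap.id _))))
      (n + 1) (lPr (Δ n) n (sg vx)) := by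
  simp [prism]

theorem aug_lmap {K L : Type*} (f : K → L) (n : ℕ) (x : LCh n K) : aug (lmap f n x) = aug x := by
  refine lhom_eq (f := aug ∘ₗ lmap f n) (g := aug) (fun s => ?_) x
  simp

theorem IsAff.prodMap_id {K L : Type*} [TopologicalSpace K] [ConvexLike K] [TopologicalSpace L]
    [ConvexLike L] {f : C(K, L)} (hf : IsAff f) :
    IsAff (f.prodMap (ContinuousMap.id unitInterval)) := by
  intro k v
  refine ContinuousMap.ext fun p => Prod.ext ?_ rfl
  exact DFunLike.congr_fun (hf k fun i => (v i).1) p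

theorem prism_real {f g : C(X, Y)} (H : f.Homotopy g) (n : ℕ) {K : Type*} [TopologicalSpace K]
    [ConvexLike K] (s : C(K, X)) (x : LCh n K) :
    prism H n (real s n x) =
      real (H.toContinuousMap.comp (ContinuousMap.prodSwap.comp (s.prodMap (ContinuousMap.id _))))
      (n + 1) (lPr K n x) := by
  refine lhom_eq (f := prism H n ∘ₗ real s n) (g := real (H.toContinuousMap.comp
    (ContinuousMap.prodSwap.comp (s.prodMap (ContinuousMap.id _)))) (n + 1) ∘ₗ lPr K n)
    (fun v => ?_) x
  simp only [LinearMap.comp_apply, real_sg, prism_sg]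
  have h : lmap ((aff v).prodMap (ContinuousMap.id unitInterval)) (n + 1) (lPr (Δ n) n (sg vx)) =
      lPr K n (lmap (aff v) n (sg vx)) := by
    refine lmap_coneHtpy _ _ (fun n x => ?_) (fun n x => ?_) (fun n v => rfl) n _
    · refine lhom_eq (f := lmap _ n ∘ₗ lmap _ n) (g := lmap _ n ∘ₗ lmap _ n) (fun s => ?_) x
      simp only [LinearMap.comp_apply, lmap_sg]
      rfl
    · refine lhom_eq (f := lmap _ n ∘ₗ lmap _ n) (g := lmap _ n ∘ₗ lmap _ n) (fun s => ?_) x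
      simp only [LinearMap.comp_apply, lmap_sg]
      rfl
  rw [lmap_sg, comp_aff_vx] at h
  rw [← h, ← real_comp _ _ (isAff_aff v).prodMap_id]
  rfl

/-- Evaluates the two ends `t = 0` and `t = 1` of the prism in the homotopy formula. -/
theorem real_lmap_incl {f g : C(X, Y)} (H : f.Homotopy g) (n : ℕ) (t : unitInterval) (F : C(X, Y))
    (hF : ∀ x, H (t, x) = F x) (s : Simp n X) :
    real (H.toContinuousMap.comp (ContinuousMap.prodSwap.comp (s.prodMap (ContinuousMap.id _)))) n
      (lmap (fun x => (x, t)) n (sg vx)) = sg (F.comp s) := by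
  rw [lmap_sg, real_sg]
  congr 1
  ext p
  have h2 : aff (fun _ : Fin (n + 1) => t) p = t := aff_const t p
  have h1 : aff (vx : Fin (n + 1) → Δ n) p = p := mix_vx p
  have h : aff ((fun x => (x, t)) ∘ (vx : Fin (n + 1) → Δ n)) p = (p, t) := Prod.ext h1 h2
  simp only [ContinuousMap.comp_apply, h]
  exact hF _

theorem bd_prism {f g : C(X, Y)} (H : f.Homotopy g) (n : ℕ) (x : Ch (n + 1) X) :
    bd (n + 1) (prism H (n + 1) x) =
      cmap f (n + 1) x - cmap g (n + 1) x - prism H n (bd n x) := by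
  refine lhom_eq (f := bd (n + 1) ∘ₗ prism H (n + 1))
    (g := cmap f (n + 1) - cmap g (n + 1) - prism H n ∘ₗ bd n) (fun s => ?_) x
  simp only [LinearMap.comp_apply, LinearMap.sub_apply, cmap_sg]
  rw [prism_sg, bd_real, lbd_coneHtpy_succ (fun _ => by simp only [aug_lmap])
    (fun n x => (lmap_lbd _ n x).symm) (fun n x => (lmap_lbd _ n x).symm), map_sub, map_sub,
    real_lmap_incl H _ 0 f (fun x => H.apply_zero x),
    real_lmap_incl H _ 1 g (fun x => H.apply_one x), bd_sg', prism_real]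

end Singular

end Sing

end


/-! ### Small chains: every chain can be subdivided to fit an open cover -/

noncomputable section

namespace Sing

/-! ### Supports of chains -/

theorem map_supported {α M : Type*} [AddCommGroup M] {S : Set α} (N : Submodule ℤ M)
    (φ : (α →₀ ℤ) →ₗ[ℤ] M) (h : ∀ a ∈ S, φ (sg a) ∈ N) {x : α →₀ ℤ}
    (hx : x ∈ Finsupp.supported ℤ ℤ S) : φ x ∈ N := by
  rw [Finsupp.supported_eq_span_single] at hx
  induction hx using Submodule.span_induction with
  | mem y hy => obtain ⟨a, ha, rfl⟩ := hy; exact h a ha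
  | zero => rw [map_zero]; exact N.zero_mem
  | add y z _ _ hy hz => rw [map_add]; exact N.add_mem hy hz
  | smul c y _ hy => rw [map_smul]; exact N.smul_mem c hy

theorem sg_mem {α : Type*} {S : Set α} {a : α} (h : a ∈ S) : sg a ∈ Finsupp.supported ℤ ℤ S :=
  Finsupp.single_mem_supported ℤ 1 h

/-! ### The mesh of the barycentric subdivision -/

section Mesh

variable {m : ℕ}

theorem dist_le_iff {p q : Δ m} {r : ℝ} (hr : 0 ≤ r) : dist p q ≤ r ↔ ∀ l, abs (p l - q l) ≤ r := by
  rw [Subtype.dist_eq, dist_pi_le_iff hr]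
  rfl

theorem sum_coord {k : ℕ} (p : Δ k) : ∑ i, p i = 1 := p.2.2

theorem mix_sub {k : ℕ} (v : Fin (k + 1) → Δ m) (p : Δ k) (x : Δ m) (l : Fin (m + 1)) :
    mix v p l - x l = ∑ i, p i * (v i l - x l) := by
  simp_rw [mul_sub]
  rw [Finset.sum_sub_distrib, ← Finset.sum_mul, sum_coord, one_mul, mix_apply]

theorem dist_mix_le {k : ℕ} {v : Fin (k + 1) → Δ m} {x : Δ m} {r : ℝ}
    (h : ∀ i, dist (v i) x ≤ r) (p : Δ k) : dist (mix v p) x ≤ r := by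
  have hr : 0 ≤ r := dist_nonneg.trans (h 0)
  rw [dist_le_iff hr]
  intro l
  rw [mix_sub]
  calc abs (∑ i, p i * (v i l - x l)) ≤ ∑ i, abs (p i * (v i l - x l)) := Finset.abs_sum_le_sum_abs _ _
    _ ≤ ∑ i, p i * r := Finset.sum_le_sum fun i _ => by
        rw [abs_mul, abs_of_nonneg (show 0 ≤ p i from p.2.1 i)]
        exact mul_le_mul_of_nonneg_left ((dist_le_iff hr).1 (h i) l) (p.2.1 i)
    _ = r := by rw [← Finset.sum_mul, sum_coord, one_mul]

/-- In the average over `n + 1` vertices the vertex `v j` contributes zero, and the other `n`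
contribute at most `D` each. -/
theorem dist_bary_le {n : ℕ} {v : Fin (n + 1) → Δ m} {D : ℝ} (h : ∀ i j, dist (v i) (v j) ≤ D)
    (j : Fin (n + 1)) : dist (bary n v) (v j) ≤ n / (n + 1) * D := by
  have hD : 0 ≤ D := dist_nonneg.trans (h 0 0)
  rw [dist_le_iff (by positivity)]
  intro l
  have e : ∀ i : Fin (n + 1), (stdSimplex.barycenter : Δ n) i = (n + 1 : ℝ)⁻¹ := fun i => by
    exact (stdSimplex.barycenter_apply i).trans (by simp)
  change abs (mix v _ l - _) ≤ _
  rw [mix_sub]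
  calc |∑ i, (stdSimplex.barycenter : Δ n) i * (v i l - v j l)|
      ≤ ∑ i, abs ((stdSimplex.barycenter : Δ n) i * (v i l - v j l)) := Finset.abs_sum_le_sum_abs _ _
    _ ≤ ∑ i, (n + 1 : ℝ)⁻¹ * (if i = j then 0 else D) := Finset.sum_le_sum fun i _ => by
        rw [abs_mul, e, abs_of_nonneg (by positivity)]
        refine mul_le_mul_of_nonneg_left ?_ (by positivity)
        split_ifs with hij
        · simp [hij]
        · exact (dist_le_iff hD).1 (h i j) l
    _ = n / (n + 1) * D := by
        rw [← Finset.mul_sum]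
        have : ∑ i : Fin (n + 1), (if i = j then 0 else D) = n * D := by
          rw [Finset.sum_ite, Finset.sum_const_zero, zero_add, Finset.sum_const,
            Finset.filter_ne' Finset.univ j, Finset.card_erase_of_mem (Finset.mem_univ j)]
          simp
        rw [this]
        ring

/-- Linear simplices within distance `r` of the point `x`. -/
abbrev Near (n : ℕ) (x : Δ m) (r : ℝ) : Set (Fin (n + 1) → Δ m) := {v | ∀ i, dist (v i) x ≤ r}

/-- Linear simplices of diameter at most `D`. -/
abbrev Thin (n m : ℕ) (D : ℝ) : Set (Fin (n + 1) → Δ m) := {v | ∀ i j, dist (v i) (v j) ≤ D}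

theorem cone_supported {K : Type*} {n : ℕ} {S : Set (Fin (n + 1) → K)} {S' : Set (Fin (n + 2) → K)}
    {b : K} (h : ∀ v ∈ S, (Fin.cons b v : Fin (n + 2) → K) ∈ S') {x : LCh n K}
    (hx : x ∈ Finsupp.supported ℤ ℤ S) : cone b n x ∈ Finsupp.supported ℤ ℤ S' :=
  map_supported _ _ (fun v hv => by rw [cone_sg]; exact sg_mem (h v hv)) hx

theorem lbd_sg_supported {K : Type*} {n : ℕ} {S : Set (Fin (n + 1) → K)} {v : Fin (n + 2) → K}
    (h : ∀ i : Fin (n + 2), v ∘ i.succAbove ∈ S) : lbd n (sg v) ∈ Finsupp.supported ℤ ℤ S := by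
  rw [lbd_sg]
  exact Submodule.sum_mem _ fun i _ => Submodule.smul_mem _ _ (sg_mem (h i))

/-- Subdivision does not leave a convex set, here a ball. In `lSd_mesh` it bounds the distance from
the barycenter to the new vertices of the subdivided faces. -/
theorem lSd_hull (n : ℕ) (x : Δ m) (r : ℝ) {z : LCh n (Δ m)}
    (hz : z ∈ Finsupp.supported ℤ ℤ (Near n x r)) :
    lSd (Δ m) n z ∈ Finsupp.supported ℤ ℤ (Near n x r) := by
  induction n with
  | zero => exact hz
  | succ n ih =>
    refine map_supported _ _ (fun v hv => ?_) hz
    rw [lsd_succ_sg]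
    refine cone_supported (fun w hw => ?_) (ih (lbd_sg_supported fun i j => hv _))
    exact Fin.cases (dist_mix_le hv _) hw

/-- Two vertices of a new simplex either both belong to a subdivided face, where induction gives the
better ratio `n / (n + 1)`, or one of them is the barycenter of the whole simplex. -/
theorem lSd_mesh (n : ℕ) (D : ℝ) {z : LCh n (Δ m)}
    (hz : z ∈ Finsupp.supported ℤ ℤ (Thin n m D)) :
    lSd (Δ m) n z ∈ Finsupp.supported ℤ ℤ (Thin n m (n / (n + 1) * D)) := by
  induction n with
  | zero =>
    refine map_supported _ LinearMap.id (fun v _ => sg_mem fun i j => ?_) hz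
    rw [show i = j from Subsingleton.elim (α := Fin 1) i j]
    simp
  | succ n ih =>
    refine map_supported _ _ (fun v hv => ?_) hz
    have hD : 0 ≤ D := dist_nonneg.trans (hv 0 0)
    rw [lsd_succ_sg]
    have h1 := ih (lbd_sg_supported (S := Thin n m D)
      fun i j k => hv (i.succAbove j) (i.succAbove k))
    have h2 := lSd_hull n (bary (n + 1) v) (((n + 1 : ℕ) : ℝ) / ((n + 1 : ℕ) + 1) * D)
      (lbd_sg_supported (v := v) fun i j => by
        rw [dist_comm]; exact dist_bary_le hv (i.succAbove j))
    have h3 := Submodule.mem_inf.2 ⟨h1, h2⟩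
    rw [← Finsupp.supported_inter] at h3
    refine cone_supported (fun w hw => ?_) h3
    have h4 : (n / (n + 1) * D : ℝ) ≤ ((n + 1 : ℕ) : ℝ) / ((n + 1 : ℕ) + 1) * D := by
      refine mul_le_mul_of_nonneg_right ?_ hD
      rw [div_le_div_iff₀ (by positivity) (by positivity)]
      push_cast
      nlinarith
    intro i j
    refine Fin.cases ?_ (fun i => ?_) i <;> refine Fin.cases ?_ (fun j => ?_) j
    · simp only [Fin.cons_zero, dist_self]
      positivity
    · simp only [Fin.cons_zero, Fin.cons_succ]
      rw [dist_comm]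
      exact hw.2 j
    · simp only [Fin.cons_zero, Fin.cons_succ]
      exact hw.2 i
    · simp only [Fin.cons_succ]
      exact (hw.1 i j).trans h4

theorem face_apply_succAbove {n : ℕ} (i : Fin (n + 2)) (p : Δ n) (j : Fin (n + 1)) :
    face i p (i.succAbove j) = p j := by
  change mix _ p _ = _
  simp [mix_apply, vx_apply, Fin.succAbove_right_inj]

theorem face_apply_self {n : ℕ} (i : Fin (n + 2)) (p : Δ n) : face i p i = 0 := by
  change mix _ p _ = _
  simp [mix_apply, vx_apply, (Fin.succAbove_ne i _).symm]

theorem dist_face_le {n : ℕ} (i : Fin (n + 2)) (p q : Δ n) :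
    dist (face i p) (face i q) ≤ dist p q := by
  rw [dist_le_iff dist_nonneg]
  intro l
  rcases Fin.eq_self_or_eq_succAbove i l with rfl | ⟨j, rfl⟩
  · simp [face_apply_self]
  · rw [face_apply_succAbove, face_apply_succAbove]
    exact (dist_le_iff dist_nonneg).1 le_rfl j

theorem dist_simplex_le (p q : Δ m) : dist p q ≤ 1 := by
  rw [dist_le_iff zero_le_one]
  intro l
  have h0 := p.2.1 l
  have h1 := q.2.1 l
  have h2 := stdSimplex.le_one p l
  have h3 := stdSimplex.le_one q l
  exact abs_le.2 ⟨by linarith! [show 0 ≤ p l from h0], by linarith! [show 0 ≤ q l from h1]⟩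

end Mesh

/-! ### Small chains -/

section Small

variable {X Y : Type*} [TopologicalSpace X] [TopologicalSpace Y]

/-- The singular chains all of whose simplices lie in a member of a family of subsets. -/
def Cs (𝒜 : Set (Set X)) (n : ℕ) : Submodule ℤ (Ch n X) :=
  Finsupp.supported ℤ ℤ {s | ∃ A ∈ 𝒜, Set.range s ⊆ A}

theorem sg_mem_Cs {𝒜 : Set (Set X)} {n : ℕ} {s : Simp n X} {A : Set X} (hA : A ∈ 𝒜)
    (h : Set.range s ⊆ A) : sg s ∈ Cs 𝒜 n := sg_mem ⟨A, hA, h⟩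

theorem Cs_mono {𝒜 ℬ : Set (Set X)} (h : ∀ A ∈ 𝒜, ∃ B ∈ ℬ, A ⊆ B) (n : ℕ) : Cs 𝒜 n ≤ Cs ℬ n :=
  Finsupp.supported_mono fun _ ⟨A, hA, hs⟩ =>
    let ⟨B, hB, hAB⟩ := h A hA
    ⟨B, hB, hs.trans hAB⟩

/-- A linear map of chains that does not increase supports. -/
def IsLocal {n k : ℕ} (φ : Ch n X →ₗ[ℤ] Ch k X) : Prop :=
  ∀ s : Simp n X, φ (sg s) ∈ Cs {Set.range s} k

theorem IsLocal.mem {n k : ℕ} {φ : Ch n X →ₗ[ℤ] Ch k X} (h : IsLocal φ) {𝒜 : Set (Set X)}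
    {x : Ch n X} (hx : x ∈ Cs 𝒜 n) : φ x ∈ Cs 𝒜 k := by
  refine map_supported _ _ (fun s hs => ?_) hx
  obtain ⟨A, hA, hs⟩ := hs
  refine Cs_mono ?_ k (h s)
  rintro _ rfl
  exact ⟨A, hA, hs⟩

theorem real_mem {K : Type*} [TopologicalSpace K] [ConvexLike K] (s : C(K, X)) (n : ℕ)
    (x : LCh n K) : real s n x ∈ Cs {Set.range s} n :=
  map_supported (S := Set.univ) _ _ (fun v _ => by
    rw [real_sg]
    exact sg_mem_Cs rfl (by rintro _ ⟨p, rfl⟩; exact ⟨_, rfl⟩)) (by simp)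

theorem isLocal_bd (n : ℕ) : IsLocal (bd (X := X) n) := fun s => by
  rw [bd_sg']
  exact real_mem _ _ _

theorem isLocal_Sd (n : ℕ) : IsLocal (Sd (X := X) n) := fun s => by
  rw [Sd_sg]
  exact real_mem _ _ _

theorem isLocal_Dh (n : ℕ) : IsLocal (Dh (X := X) n) := fun s => by
  rw [Dh_sg]
  exact real_mem _ _ _

/-- Iterated barycentric subdivision. -/
def SdPow (m n : ℕ) : Ch n X →ₗ[ℤ] Ch n X := (Sd n : Module.End ℤ (Ch n X)) ^ m

theorem SdPow_succ (m n : ℕ) (x : Ch n X) : SdPow (m + 1) n x = Sd n (SdPow m n x) := by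
  rw [SdPow, pow_succ']
  rfl

theorem bd_SdPow (m n : ℕ) (x : Ch (n + 1) X) : bd n (SdPow m (n + 1) x) = SdPow m n (bd n x) := by
  induction m with
  | zero => rfl
  | succ m ih => rw [SdPow_succ, bd_Sd, ih, SdPow_succ]

/-- The homotopy between an iterated subdivision and the identity. -/
def DhPow (m n : ℕ) : Ch n X →ₗ[ℤ] Ch (n + 1) X :=
  ∑ j ∈ Finset.range m, Dh n ∘ₗ SdPow j n

theorem DhPow_apply (m n : ℕ) (x : Ch n X) :
    DhPow m n x = ∑ j ∈ Finset.range m, Dh n (SdPow j n x) := by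
  simp [DhPow]

theorem bd_DhPow (m n : ℕ) (x : Ch (n + 1) X) :
    bd (n + 1) (DhPow m (n + 1) x) = x - SdPow m (n + 1) x - DhPow m n (bd n x) := by
  induction m with
  | zero => simp [DhPow, SdPow]
  | succ m ih =>
    rw [DhPow_apply, Finset.sum_range_succ, ← DhPow_apply, map_add, ih, bd_Dh, bd_SdPow,
      DhPow_apply (m + 1), Finset.sum_range_succ, ← DhPow_apply, SdPow_succ]
    abel

theorem isLocal_SdPow (m n : ℕ) : IsLocal (SdPow (X := X) m n) := fun s => by
  induction m with
  | zero => exact sg_mem_Cs rfl subset_rfl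
  | succ m ih =>
    rw [SdPow_succ]
    exact (isLocal_Sd n).mem ih

theorem isLocal_DhPow (m n : ℕ) : IsLocal (DhPow (X := X) m n) := fun s => by
  rw [DhPow_apply]
  exact Submodule.sum_mem _ fun j _ => (isLocal_Dh n).mem (isLocal_SdPow j n s)

/-- The singular simplex `s` maps sets of small diameter into `A` or into `B`. -/
def Good (A B : Set X) (ε : ℝ) {n : ℕ} (s : Simp n X) : Prop :=
  ∀ Q : Set (Δ n), (∀ p ∈ Q, ∀ q ∈ Q, dist p q ≤ ε) → s '' Q ⊆ A ∨ s '' Q ⊆ B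

variable {A B : Set X}

theorem Good.mono {ε ε' : ℝ} (h : ε ≤ ε') {n : ℕ} {s : Simp n X} (hs : Good A B ε' s) :
    Good A B ε s :=
  fun Q hQ => hs Q fun p hp q hq => (hQ p hp q hq).trans h

theorem Good.face {ε : ℝ} {n : ℕ} {s : Simp (n + 1) X} (hs : Good A B ε s) (i : Fin (n + 2)) :
    Good A B ε (s.comp (face i)) := fun Q hQ => by
  have h := hs (Sing.face i '' Q) (by
    rintro _ ⟨p, hp, rfl⟩ _ ⟨q, hq, rfl⟩
    exact (dist_face_le i p q).trans (hQ p hp q hq))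
  rw [← Set.image_comp] at h
  exact h

theorem good_of_subset {n : ℕ} {s : Simp n X} (h : Set.range s ⊆ A ∨ Set.range s ⊆ B) (ε : ℝ) :
    Good A B ε s := fun Q _ =>
  h.imp (fun h => (Set.image_subset_range _ _).trans h) fun h =>
    (Set.image_subset_range _ _).trans h

theorem exists_good (hA : IsOpen A) (hB : IsOpen B) {n : ℕ} {s : Simp n X}
    (h : Set.range s ⊆ A ∪ B) : ∃ ε > 0, Good A B ε s := by
  obtain ⟨δ, hδ, H⟩ := lebesgue_number_lemma_of_metric (s := (Set.univ : Set (Δ n)))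
    (c := fun b : Bool => cond b (s ⁻¹' A) (s ⁻¹' B)) isCompact_univ (by
      rintro (_ | _)
      · exact hB.preimage s.continuous
      · exact hA.preimage s.continuous) (by
      intro p _
      rcases h ⟨p, rfl⟩ with h | h
      · exact Set.mem_iUnion.2 ⟨true, h⟩
      · exact Set.mem_iUnion.2 ⟨false, h⟩)
  -- Half the Lebesgue number, since `Good` has a non-strict bound while the balls of radius `δ` are
  -- open.
  refine ⟨δ / 2, half_pos hδ, fun Q hQ => ?_⟩
  rcases Q.eq_empty_or_nonempty with rfl | ⟨p, hp⟩
  · simp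
  obtain ⟨b, hb⟩ := H p (Set.mem_univ p)
  have hQ' : Q ⊆ Metric.ball p δ := fun q hq => (hQ q hq p hp).trans_lt (half_lt_self hδ)
  cases b
  · exact Or.inr (Set.image_subset_iff.2 (hQ'.trans hb))
  · exact Or.inl (Set.image_subset_iff.2 (hQ'.trans hb))

/-- The factor by which subdivision decreases the diameter of simplices. -/
abbrev ratio (n : ℕ) : ℝ := n / (n + 1)

theorem ratio_nonneg (n : ℕ) : 0 ≤ ratio n := by unfold ratio; positivity

theorem ratio_lt_one (n : ℕ) : ratio n < 1 := by
  unfold ratio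
  rw [div_lt_one (by positivity)]
  linarith

theorem ratio_le_succ (n : ℕ) : ratio n ≤ ratio (n + 1) := by
  unfold ratio
  rw [div_le_div_iff₀ (by positivity) (by positivity)]
  push_cast
  nlinarith

/-- The standard simplex has diameter at most one in the sup distance, so the pieces of its `m`-th
subdivision have diameter at most `ratio n ^ m`. -/
theorem SdPow_small {n m : ℕ} {s : Simp n X} (hs : Good A B (ratio n ^ m) s) :
    SdPow m n (sg s) ∈ Cs {A, B} n := by
  have h : ∀ m : ℕ, ∃ z ∈ Finsupp.supported ℤ ℤ (Thin n n (ratio n ^ m)),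
      SdPow m n (sg s) = real s n z := by
    intro m
    induction m with
    | zero =>
      exact ⟨sg vx, sg_mem fun i j => by rw [pow_zero]; exact dist_simplex_le _ _,
        (real_vertices n s).symm⟩
    | succ m ih =>
      obtain ⟨z, hz, e⟩ := ih
      refine ⟨lSd (Δ n) n z, ?_, by rw [SdPow_succ, e, Sd_real]⟩
      rw [pow_succ']
      exact lSd_mesh n _ hz
  obtain ⟨z, hz, e⟩ := h m
  rw [e]
  refine map_supported _ _ (fun v hv => ?_) hz
  rw [real_sg]
  have h1 := hs (Set.range (mix v)) (by
    rintro _ ⟨p, rfl⟩ _ ⟨q, rfl⟩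
    refine dist_mix_le (fun i => ?_) p
    rw [dist_comm]
    exact dist_mix_le (fun j => hv j i) q)
  rw [← Set.range_comp] at h1
  rcases h1 with h1 | h1
  · exact sg_mem_Cs (Set.mem_insert _ _) h1
  · exact sg_mem_Cs (Set.mem_insert_of_mem _ rfl) h1

/-- The number of subdivisions after which a simplex is small. -/
def level (A B : Set X) {n : ℕ} (s : Simp n X) : ℕ := sInf {m | Good A B (ratio n ^ m) s}

/-- A Lebesgue number shows that the set defining `level` is nonempty. Without `Set.range s ⊆ A ∪ B`
it may be empty, and `level` is then the meaningless value zero. -/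
theorem good_level (hA : IsOpen A) (hB : IsOpen B) {n : ℕ} {s : Simp n X}
    (h : Set.range s ⊆ A ∪ B) : Good A B (ratio n ^ level A B s) s := by
  obtain ⟨ε, hε, hs⟩ := exists_good hA hB h
  obtain ⟨m, hm⟩ := exists_pow_lt_of_lt_one hε (ratio_lt_one n)
  exact Nat.sInf_mem (s := {m | Good A B (ratio n ^ m) s}) ⟨m, hs.mono hm.le⟩

/-- Face inclusions do not increase distances, and the ratio is smaller in lower dimension. This
monotonicity makes the correction term in `toSmall_mem` small. -/
theorem level_face_le (hA : IsOpen A) (hB : IsOpen B) {n : ℕ} {s : Simp (n + 1) X}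
    (h : Set.range s ⊆ A ∪ B) (i : Fin (n + 2)) : level A B (s.comp (face i)) ≤ level A B s :=
  Nat.sInf_le (((good_level hA hB h).face i).mono
    (pow_le_pow_left₀ (ratio_nonneg n) (ratio_le_succ n) _))

theorem level_eq_zero {n : ℕ} {s : Simp n X} (h : Set.range s ⊆ A ∨ Set.range s ⊆ B) :
    level A B s = 0 :=
  Nat.sInf_eq_zero.2 (Or.inl (good_of_subset h _))

/-- The homotopy between the identity and a chain map to small chains. -/
def smallHtpy (A B : Set X) (n : ℕ) : Ch n X →ₗ[ℤ] Ch (n + 1) X :=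
  Finsupp.linearCombination ℤ fun s => DhPow (level A B s) n (sg s)

theorem smallHtpy_sg (A B : Set X) (n : ℕ) (s : Simp n X) :
    smallHtpy A B n (sg s) = DhPow (level A B s) n (sg s) := by simp [smallHtpy]

theorem isLocal_smallHtpy (A B : Set X) (n : ℕ) : IsLocal (smallHtpy A B n) := fun s => by
  rw [smallHtpy_sg]
  exact isLocal_DhPow _ _ _

theorem smallHtpy_eq_zero {n : ℕ} {x : Ch n X} (hx : x ∈ Cs {A, B} n) : smallHtpy A B n x = 0 := by
  refine (Submodule.mem_bot ℤ).1 (map_supported ⊥ (smallHtpy A B n) (fun s hs => ?_) hx)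
  rw [smallHtpy_sg, level_eq_zero (by simpa using hs), DhPow_apply]
  simp

/-- The chain map to small chains. -/
def toSmall (A B : Set X) (n : ℕ) : Ch (n + 1) X →ₗ[ℤ] Ch (n + 1) X :=
  LinearMap.id - bd (n + 1) ∘ₗ smallHtpy A B (n + 1) - smallHtpy A B n ∘ₗ bd n

theorem toSmall_apply (A B : Set X) (n : ℕ) (x : Ch (n + 1) X) :
    toSmall A B n x = x - bd (n + 1) (smallHtpy A B (n + 1) x) - smallHtpy A B n (bd n x) := rfl

/-- The number of subdivisions depends on the simplex, so subdividing as often as needed is not a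
chain map. `toSmall` repairs this by means of the homotopy, and the correction consists of
subdivided faces that are small already. -/
theorem toSmall_mem (hA : IsOpen A) (hB : IsOpen B) {n : ℕ} {x : Ch (n + 1) X}
    (hx : x ∈ Cs {A ∪ B} (n + 1)) : toSmall A B n x ∈ Cs {A, B} (n + 1) := by
  refine map_supported _ _ (fun s hs => ?_) hx
  replace hs : Set.range s ⊆ A ∪ B := by simpa using hs
  rw [toSmall_apply, smallHtpy_sg, bd_DhPow]
  have e : smallHtpy A B n (bd n (sg s)) - DhPow (level A B s) n (bd n (sg s)) ∈ Cs {A, B} (n + 1) := by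
    rw [bd_sg]
    simp only [map_sum, map_smul]
    rw [← Finset.sum_sub_distrib]
    refine Submodule.sum_mem _ fun i _ => ?_
    rw [← smul_sub]
    refine Submodule.smul_mem _ _ ?_
    have hi : Set.range (s.comp (face i)) ⊆ A ∪ B := by
      rintro _ ⟨p, rfl⟩
      exact hs ⟨_, rfl⟩
    -- The two homotopies on a face differ by the terms `Dh (SdPow j _)` with `j` from the level of
    -- the face up to the level of `s`. For these `j` the face has been subdivided often enough.
    rw [smallHtpy_sg, DhPow_apply, DhPow_apply, ← neg_sub,
      Finset.sum_range_sub_sum_range (level_face_le hA hB hs i)]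
    refine Submodule.neg_mem _ (Submodule.sum_mem _ fun j hj => (isLocal_Dh n).mem
      (SdPow_small ((good_level hA hB hi).mono ?_)))
    exact pow_le_pow_of_le_one (ratio_nonneg n) (ratio_lt_one n).le (Finset.mem_filter.1 hj).2
  have e2 := Submodule.sub_mem _ (SdPow_small (good_level hA hB hs)) e
  convert e2 using 1
  abel

theorem toSmall_of_small {n : ℕ} {x : Ch (n + 1) X} (hx : x ∈ Cs {A, B} (n + 1)) :
    toSmall A B n x = x := by
  rw [toSmall_apply, smallHtpy_eq_zero hx, smallHtpy_eq_zero ((isLocal_bd n).mem hx)]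
  simp

theorem isLocal_toSmall (A B : Set X) (n : ℕ) : IsLocal (toSmall A B n) := fun s => by
  rw [toSmall_apply]
  have h : sg s ∈ Cs {Set.range s} (n + 1) := sg_mem_Cs rfl subset_rfl
  exact Submodule.sub_mem _ (Submodule.sub_mem _ h
    ((isLocal_bd _).mem ((isLocal_smallHtpy A B _).mem h)))
    ((isLocal_smallHtpy A B _).mem ((isLocal_bd _).mem h))

theorem bd_toSmall (A B : Set X) (n : ℕ) (x : Ch (n + 2) X) :
    bd (n + 1) (toSmall A B (n + 1) x) = toSmall A B n (bd (n + 1) x) := by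
  rw [toSmall_apply, toSmall_apply, map_sub, map_sub, bd_bd, bd_bd, map_zero]
  abel

/-- A small chain is the sum of a chain in `A` and a chain in `B`. -/
theorem exists_add_of_mem_Cs {n : ℕ} {x : Ch n X} (hx : x ∈ Cs {A, B} n) :
    ∃ y ∈ Cs {A} n, ∃ z ∈ Cs {B} n, x = y + z := by
  have h : Cs {A, B} n = Cs {A} n ⊔ Cs {B} n := by
    rw [Cs, Cs, Cs, ← Finsupp.supported_union]
    congr 1
    ext s
    simp
  rw [h] at hx
  obtain ⟨y, hy, z, hz, e⟩ := Submodule.mem_sup.1 hx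
  exact ⟨y, hy, z, hz, e.symm⟩

theorem Cs_inter (n : ℕ) : Cs {A ∩ B} n = Cs {A} n ⊓ Cs {B} n := by
  rw [Cs, Cs, Cs, ← Finsupp.supported_inter]
  congr 1
  ext s
  simp

theorem mem_Cs_univ {n : ℕ} (x : Ch n X) : x ∈ Cs {Set.univ} n := by
  simp [Cs]

theorem cmap_mem (f : C(X, Y)) {A : Set X} {B : Set Y} (h : Set.MapsTo f A B) {n : ℕ} {x : Ch n X}
    (hx : x ∈ Cs {A} n) : cmap f n x ∈ Cs {B} n := by
  refine map_supported _ _ (fun s hs => ?_) hx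
  obtain ⟨_, rfl, hs⟩ := hs
  rw [cmap_sg]
  refine sg_mem_Cs rfl ?_
  rintro _ ⟨p, rfl⟩
  exact h (hs ⟨p, rfl⟩)

theorem prism_mem {f g : C(X, Y)} (H : f.Homotopy g) {A : Set X} {B : Set Y}
    (h : ∀ t, ∀ x ∈ A, H (t, x) ∈ B) {n : ℕ} {x : Ch n X} (hx : x ∈ Cs {A} n) :
    prism H n x ∈ Cs {B} (n + 1) := by
  refine map_supported _ _ (fun s hs => ?_) hx
  obtain ⟨_, rfl, hs⟩ := hs
  rw [prism_sg]
  refine Cs_mono ?_ _ (real_mem _ _ _)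
  rintro _ rfl
  refine ⟨B, rfl, ?_⟩
  rintro _ ⟨⟨p, t⟩, rfl⟩
  exact h t _ (hs ⟨p, rfl⟩)

end Small

end Sing

end


/-! ### Cohomology of subsets: Mayer–Vietoris, homotopy invariance, embeddings -/

noncomputable section

namespace Sing

/-! ### Cochains -/

section Cochains

variable {X Y Z : Type*} [TopologicalSpace X] [TopologicalSpace Y] [TopologicalSpace Z]
variable {G : Type*} [AddCommGroup G]

/-- Singular cochains. -/
abbrev Co (n : ℕ) (X : Type*) [TopologicalSpace X] (G : Type*) := Simp n X → G

/-- The evaluation of a cochain on chains. -/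
def ev {n : ℕ} (c : Co n X G) : Ch n X →ₗ[ℤ] G := Finsupp.linearCombination ℤ c

@[simp] theorem ev_sg {n : ℕ} (c : Co n X G) (s : Simp n X) : ev c (sg s) = c s := by simp [ev]

theorem ev_add {n : ℕ} (c c' : Co n X G) (x : Ch n X) : ev (c + c') x = ev c x + ev c' x :=
  lhom_eq (f := ev (c + c')) (g := ev c + ev c') (fun s => by simp) x

theorem ev_sub {n : ℕ} (c c' : Co n X G) (x : Ch n X) : ev (c - c') x = ev c x - ev c' x :=
  lhom_eq (f := ev (c - c')) (g := ev c - ev c') (fun s => by simp) x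

theorem ev_zero {n : ℕ} (x : Ch n X) : ev (0 : Co n X G) x = 0 :=
  lhom_eq (f := ev (0 : Co n X G)) (g := 0) (fun s => by simp) x

/-- The coboundary. -/
def cb (n : ℕ) (c : Co n X G) : Co (n + 1) X G := fun s => ev c (bd n (sg s))

theorem cb_add (n : ℕ) (c c' : Co n X G) : cb n (c + c') = cb n c + cb n c' :=
  funext fun _ => ev_add c c' _

theorem cb_sub (n : ℕ) (c c' : Co n X G) : cb n (c - c') = cb n c - cb n c' :=
  funext fun _ => ev_sub c c' _

@[simp] theorem cb_zero (n : ℕ) : cb n (0 : Co n X G) = 0 := funext fun _ => ev_zero _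

theorem cb_apply (n : ℕ) (c : Co n X G) (s : Simp (n + 1) X) : cb n c s = ev c (bd n (sg s)) := rfl

theorem ev_cb {n : ℕ} (c : Co n X G) (x : Ch (n + 1) X) : ev (cb n c) x = ev c (bd n x) :=
  lhom_eq (f := ev (cb n c)) (g := ev c ∘ₗ bd n) (fun s => by simp [cb_apply]) x

theorem cb_cb (n : ℕ) (c : Co n X G) : cb (n + 1) (cb n c) = 0 := by
  ext s
  rw [cb_apply, ev_cb, bd_bd, map_zero]
  rfl

/-- The pullback of cochains. -/
def pull (f : C(X, Y)) (n : ℕ) (c : Co n Y G) : Co n X G := fun s => c (f.comp s)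

theorem pull_apply (f : C(X, Y)) (n : ℕ) (c : Co n Y G) (s : Simp n X) :
    pull f n c s = c (f.comp s) := rfl

theorem ev_pull (f : C(X, Y)) {n : ℕ} (c : Co n Y G) (x : Ch n X) :
    ev (pull f n c) x = ev c (cmap f n x) :=
  lhom_eq (f := ev (pull f n c)) (g := ev c ∘ₗ cmap f n) (fun s => by simp [pull_apply]) x

theorem cb_pull (f : C(X, Y)) (n : ℕ) (c : Co n Y G) : cb n (pull f n c) = pull f (n + 1) (cb n c) := by
  ext s
  rw [cb_apply, ev_pull, cmap_bd, cmap_sg]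
  rfl

/-- Two cochains agree on all simplices in `W`. -/
def AgreeOn (W : Set X) {n : ℕ} (c c' : Co n X G) : Prop :=
  ∀ s : Simp n X, Set.range s ⊆ W → c s = c' s

namespace AgreeOn

variable {V W : Set X} {n : ℕ} {c c' c'' d d' : Co n X G}

theorem refl (W : Set X) (c : Co n X G) : AgreeOn W c c := fun _ _ => rfl

theorem symm (h : AgreeOn W c c') : AgreeOn W c' c := fun s hs => (h s hs).symm

theorem trans (h : AgreeOn W c c') (h' : AgreeOn W c' c'') : AgreeOn W c c'' :=
  fun s hs => (h s hs).trans (h' s hs)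

theorem mono (h : AgreeOn W c c') (hVW : V ⊆ W) : AgreeOn V c c' :=
  fun s hs => h s (hs.trans hVW)

theorem add (h : AgreeOn W c c') (h' : AgreeOn W d d') : AgreeOn W (c + d) (c' + d') :=
  fun s hs => congrArg₂ _ (h s hs) (h' s hs)

theorem sub (h : AgreeOn W c c') (h' : AgreeOn W d d') : AgreeOn W (c - d) (c' - d') :=
  fun s hs => congrArg₂ _ (h s hs) (h' s hs)

theorem of_eq (h : c = c') : AgreeOn W c c' := h ▸ refl _ _

theorem ev_eq (h : AgreeOn W c c') {x : Ch n X} (hx : x ∈ Cs {W} n) : ev c x = ev c' x := by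
  have : ev (c - c') x ∈ (⊥ : Submodule ℤ G) := by
    refine map_supported _ _ (fun s hs => ?_) hx
    obtain ⟨_, rfl, hs⟩ := hs
    simp [h s hs]
  rw [ev_sub] at this
  exact sub_eq_zero.1 this

theorem cb (h : AgreeOn W c c') : AgreeOn W (cb n c) (cb n c') := fun s hs => by
  rw [cb_apply, cb_apply]
  exact h.ev_eq ((isLocal_bd n).mem (sg_mem_Cs rfl hs))

theorem pull {f : C(Y, X)} {V : Set Y} (h : AgreeOn W c c') (hf : Set.MapsTo f V W) :
    AgreeOn V (pull f n c) (Sing.pull f n c') := fun s hs => h _ (by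
  rintro _ ⟨p, rfl⟩
  exact hf (hs ⟨p, rfl⟩))

theorem eq (h : AgreeOn Set.univ c c') : c = c' := funext fun s => h s (Set.subset_univ _)

end AgreeOn

theorem ev_eq_zero_of_small {A B : Set X} {n : ℕ} {c : Co n X G} (hA : AgreeOn A c 0)
    (hB : AgreeOn B c 0) {x : Ch n X} (hx : x ∈ Cs {A, B} n) : ev c x = 0 := by
  obtain ⟨y, hy, z, hz, rfl⟩ := exists_add_of_mem_Cs hx
  rw [map_add, hA.ev_eq hy, hB.ev_eq hz, ev_zero, ev_zero, add_zero]

/-- Cochains are arbitrary functions on simplices, so openness plays no role. The simplices that lie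
in neither set matter only when a coboundary on the union is taken. -/
theorem exists_glue {A B : Set X} {n : ℕ} {p q : Co n X G} (h : AgreeOn (A ∩ B) p q) :
    ∃ r : Co n X G, AgreeOn A r p ∧ AgreeOn B r q := by
  classical
  refine ⟨fun s => if Set.range s ⊆ A then p s else q s, fun s hs => if_pos hs, fun s hs => ?_⟩
  by_cases hA : Set.range s ⊆ A
  · simp only [hA, if_true]
    exact h s (Set.subset_inter hA hs)
  · simp only [hA, if_false]

variable {A B : Set X}

/-- A cocycle on small simplices extends to a cocycle. -/
theorem exists_extension (hA : IsOpen A) (hB : IsOpen B) {n : ℕ} {p : Co (n + 1) X G}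
    (hpA : AgreeOn A (cb _ p) 0) (hpB : AgreeOn B (cb _ p) 0) :
    ∃ r : Co (n + 1) X G, AgreeOn (A ∪ B) (cb _ r) 0 ∧ AgreeOn A r p ∧ AgreeOn B r p := by
  have e : ∀ x, ev (fun s => ev p (toSmall A B n (sg s))) x = ev p (toSmall A B n x) :=
    lhom_eq (f := ev fun s => ev p (toSmall A B n (sg s))) (g := ev p ∘ₗ toSmall A B n)
      fun s => by simp
  -- Precomposition with the chain map `toSmall` uses only the values of `p` on small simplices, and
  -- `toSmall` fixes small simplices.
  refine ⟨fun s => ev p (toSmall A B n (sg s)), fun s hs => ?_, fun s hs => ?_, fun s hs => ?_⟩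
  · rw [cb_apply, e, ← bd_toSmall, ← ev_cb]
    exact ev_eq_zero_of_small hpA hpB (toSmall_mem hA hB (sg_mem_Cs rfl hs))
  · change ev p (toSmall A B n (sg s)) = p s
    rw [toSmall_of_small (sg_mem_Cs (Set.mem_insert A {B}) hs), ev_sg]
  · change ev p (toSmall A B n (sg s)) = p s
    rw [toSmall_of_small (sg_mem_Cs (Set.mem_insert_of_mem A (Set.mem_singleton B)) hs), ev_sg]

/-- A cocycle which is a coboundary on small simplices is a coboundary. -/
theorem exists_primitive (hA : IsOpen A) (hB : IsOpen B) {n : ℕ} {c : Co (n + 1) X G}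
    (hc : AgreeOn (A ∪ B) (cb _ c) 0) {p : Co n X G} (hpA : AgreeOn A c (cb _ p))
    (hpB : AgreeOn B c (cb _ p)) :
    ∃ r : Co n X G, AgreeOn (A ∪ B) c (cb _ r) ∧ AgreeOn A r p ∧ AgreeOn B r p := by
  set v := c - cb n p with hv
  have hvA : AgreeOn A v 0 := fun s hs => sub_eq_zero.2 (hpA s hs)
  have hvB : AgreeOn B v 0 := fun s hs => sub_eq_zero.2 (hpB s hs)
  have hvc : AgreeOn (A ∪ B) (cb _ v) 0 := by
    rw [hv, cb_sub, cb_cb, sub_zero]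
    exact hc
  -- The defect `v` vanishes on small chains, so `v ∘ toSmall = 0`. The chain homotopy from
  -- `toSmall` to the identity then exhibits `v` as the coboundary of `q`.
  set q : Co n X G := fun s => ev v (smallHtpy A B n (sg s)) with hq
  have e : ∀ x, ev q x = ev v (smallHtpy A B n x) :=
    lhom_eq (f := ev q) (g := ev v ∘ₗ smallHtpy A B n) fun s => by simp [hq]
  refine ⟨p + q, fun s hs => ?_, fun s hs => ?_, fun s hs => ?_⟩
  · have h1 := ev_eq_zero_of_small hvA hvB (toSmall_mem hA hB (sg_mem_Cs rfl hs))
    rw [toSmall_apply, map_sub, map_sub, ← e, ← ev_cb v, ev_sg] at h1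
    have h2 := hvc.ev_eq ((isLocal_smallHtpy A B (n + 1)).mem
      (sg_mem_Cs (s := s) (A := A ∪ B) rfl hs))
    rw [h2, ev_zero, sub_zero, ← cb_apply, sub_eq_zero] at h1
    rw [cb_add, Pi.add_apply, ← h1, hv]
    simp
  · simp [hq, smallHtpy_eq_zero (sg_mem_Cs (s := s) (Set.mem_insert A {B}) hs)]
  · simp [hq, smallHtpy_eq_zero (sg_mem_Cs (s := s) (Set.mem_insert_of_mem A (Set.mem_singleton B)) hs)]

/-- Coboundaries on two open subsets with equal primitives on the intersection. -/
theorem exists_primitive_of_eq (hA : IsOpen A) (hB : IsOpen B) {n : ℕ} {c : Co (n + 1) X G}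
    (hc : AgreeOn (A ∪ B) (cb _ c) 0) {a b : Co n X G} (ha : AgreeOn A c (cb _ a))
    (hb : AgreeOn B c (cb _ b)) (hab : AgreeOn (A ∩ B) a b) :
    ∃ r : Co n X G, AgreeOn (A ∪ B) c (cb _ r) ∧ AgreeOn A r a ∧ AgreeOn B r b := by
  obtain ⟨p, hpA, hpB⟩ := exists_glue hab
  obtain ⟨r, hr, hrA, hrB⟩ := exists_primitive hA hB hc (ha.trans hpA.cb.symm)
    (hb.trans hpB.cb.symm)
  exact ⟨r, hr, hrA.trans hpA, hrB.trans hpB⟩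

/-- Coboundaries on two open subsets with cohomologous primitives on the intersection. -/
theorem exists_primitive_of_cohomologous (hA : IsOpen A) (hB : IsOpen B) {n : ℕ}
    {c : Co (n + 2) X G} (hc : AgreeOn (A ∪ B) (cb _ c) 0) {a b : Co (n + 1) X G} {e : Co n X G}
    (ha : AgreeOn A c (cb _ a)) (hb : AgreeOn B c (cb _ b))
    (hab : AgreeOn (A ∩ B) (a - b) (cb _ e)) :
    ∃ r : Co (n + 1) X G, AgreeOn (A ∪ B) c (cb _ r) ∧ AgreeOn B r b := by
  -- The cochain `e` is defined on the whole space, so subtracting `cb _ e` from `a` makes the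
  -- primitives equal on the intersection and leaves the coboundary of `a` unchanged.
  obtain ⟨r, hr, -, hrB⟩ := exists_primitive_of_eq hA hB hc (a := a - cb _ e) (b := b)
    (by rw [cb_sub, cb_cb, sub_zero]; exact ha) hb (fun s hs => by
      have := hab s hs
      simp only [Pi.sub_apply] at this ⊢
      rw [← this]
      abel)
  exact ⟨r, hr, hrB⟩

/-- The vanishing of the cohomology group `H^{n+1}(W; G)` of a subset `W`. -/
def VanOn (G : Type*) [AddCommGroup G] (n : ℕ) (W : Set X) : Prop :=
  ∀ c : Co (n + 1) X G, AgreeOn W (cb _ c) 0 → ∃ b : Co n X G, AgreeOn W c (cb _ b)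

theorem AgreeOn.cocycle_of_sub {n : ℕ} {W : Set X} {c : Co (n + 1) X G} {a b : Co n X G}
    (ha : AgreeOn W c (Sing.cb _ a)) (hb : AgreeOn W c (Sing.cb _ b)) :
    AgreeOn W (Sing.cb _ (a - b)) 0 := by
  rw [cb_sub]
  exact fun s hs => sub_eq_zero.2 ((ha s hs).symm.trans (hb s hs))

/-- Mayer–Vietoris, with the shift that `VanOn G n` concerns degree `n + 1`: the difference of
primitives on `A` and on `B` is a class in `H^{n+1}(A ∩ B)`, the only obstruction to gluing them. -/
theorem VanOn.union (hA : IsOpen A) (hB : IsOpen B) {n : ℕ} (h₁ : VanOn G (n + 1) A)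
    (h₂ : VanOn G (n + 1) B) (h₃ : VanOn G n (A ∩ B)) : VanOn G (n + 1) (A ∪ B) := by
  intro c hc
  obtain ⟨a, ha⟩ := h₁ c (hc.mono Set.subset_union_left)
  obtain ⟨b, hb⟩ := h₂ c (hc.mono Set.subset_union_right)
  obtain ⟨e, he⟩ := h₃ (a - b) ((ha.mono Set.inter_subset_left).cocycle_of_sub
    (hb.mono Set.inter_subset_right))
  obtain ⟨r, hr, -⟩ := exists_primitive_of_cohomologous hA hB hc ha hb he
  exact ⟨r, hr⟩

theorem VanOn.union_of_disjoint (hA : IsOpen A) (hB : IsOpen B) (hAB : A ∩ B = ∅) {n : ℕ}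
    (h₁ : VanOn G n A) (h₂ : VanOn G n B) : VanOn G n (A ∪ B) := by
  intro c hc
  obtain ⟨a, ha⟩ := h₁ c (hc.mono Set.subset_union_left)
  obtain ⟨b, hb⟩ := h₂ c (hc.mono Set.subset_union_right)
  obtain ⟨r, hr, -⟩ := exists_primitive_of_eq hA hB hc ha hb (fun s hs => by
    rw [hAB] at hs
    exact absurd (hs ⟨vx 0, rfl⟩) (Set.notMem_empty _))
  exact ⟨r, hr⟩

/-- The connecting homomorphism sends the class of `c` to the cocycle `r` that is a coboundary `cb _
c'` on `A` and zero on `B`. If `r = cb _ g`, then `c' - g` is closed on `A` and `g` is closed on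
`B`; these have primitives and their sum is `c` on `A ∩ B`. -/
theorem VanOn.inter (hA : IsOpen A) (hB : IsOpen B) {n : ℕ} (h₁ : VanOn G n A)
    (h₂ : VanOn G n B) (h₃ : VanOn G (n + 1) (A ∪ B)) : VanOn G n (A ∩ B) := by
  classical
  intro c hc
  set c' : Co (n + 1) X G := fun s => if Set.range s ⊆ B then c s else 0 with hc'
  have hcB : AgreeOn B c' c := fun s hs => if_pos hs
  obtain ⟨p, hpA, hpB⟩ := exists_glue (A := A) (B := B) (p := cb _ c') (q := 0)
    (((hcB.mono Set.inter_subset_right).cb).trans hc)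
  obtain ⟨r, hr, hrA, hrB⟩ := exists_extension hA hB (p := p)
    (by simpa [cb_cb] using hpA.cb) (by simpa using hpB.cb)
  obtain ⟨g, hg⟩ := h₃ r hr
  obtain ⟨a, ha⟩ := h₁ (c' - g) (by
    rw [cb_sub]
    exact fun s hs => sub_eq_zero.2 (((hpA.symm.trans hrA.symm).trans
      (hg.mono Set.subset_union_left)) s hs))
  obtain ⟨b, hb⟩ := h₂ g (((hg.mono Set.subset_union_right).symm.trans hrB).trans hpB)
  refine ⟨a + b, fun s hs => ?_⟩
  have h1 := ha s (hs.trans Set.inter_subset_left)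
  have h2 := hb s (hs.trans Set.inter_subset_right)
  have h3 := hcB s (hs.trans Set.inter_subset_right)
  simp only [Pi.sub_apply] at h1
  rw [cb_add, Pi.add_apply, ← h1, ← h2, ← h3]
  abel

/-! ### Homotopy invariance -/

/-- The primitive is `c` evaluated on prisms. The homotopy has to stay in `B`, where `c` is closed,
for the boundary of the prism to be killed. -/
theorem exists_primitive_of_homotopy {f g : C(X, Y)} (H : f.Homotopy g) {A : Set X} {B : Set Y}
    (h : ∀ t, ∀ x ∈ A, H (t, x) ∈ B) {n : ℕ} {c : Co (n + 1) Y G} (hc : AgreeOn B (cb _ c) 0) :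
    ∃ b : Co n X G, AgreeOn A (pull f _ c - pull g _ c) (cb _ b) := by
  refine ⟨fun s => ev c (prism H n (sg s)), fun s hs => ?_⟩
  have e : ∀ x, ev (fun s => ev c (prism H n (sg s))) x = ev c (prism H n x) :=
    lhom_eq (f := ev fun s => ev c (prism H n (sg s))) (g := ev c ∘ₗ prism H n) fun s => by simp
  rw [cb_apply, e]
  have h1 := hc.ev_eq (prism_mem H h (sg_mem_Cs (s := s) rfl hs))
  rw [ev_zero, ev_cb, bd_prism, map_sub, map_sub, cmap_sg, cmap_sg, ev_sg, ev_sg, sub_eq_zero] at h1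
  rw [← h1]
  rfl

theorem VanOn.of_homotopy {A : Set X} {B : Set Y} (f : C(X, Y)) (g : C(Y, X))
    (H : (ContinuousMap.id X).Homotopy (g.comp f)) (hH : ∀ t, ∀ x ∈ A, H (t, x) ∈ A)
    (hf : Set.MapsTo f A B) (hg : Set.MapsTo g B A) {n : ℕ} (h : VanOn G n B) : VanOn G n A := by
  intro c hc
  obtain ⟨b, hb⟩ := exists_primitive_of_homotopy H hH hc
  obtain ⟨d, hd⟩ := h (pull g _ c) (by rw [cb_pull]; exact hc.pull hg)
  have h1 := hd.pull hf
  refine ⟨b + pull f _ d, fun s hs => ?_⟩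
  have h2 := hb s hs
  have h3 := h1 s hs
  rw [cb_add, cb_pull, Pi.add_apply, ← h2, ← h3]
  simp only [Pi.sub_apply, pull_apply, ContinuousMap.id_comp, ContinuousMap.comp_assoc]
  abel

/-- There is one simplex in each degree, and the coboundary multiplies by an alternating sum of
ones, which is zero or one according to parity. -/
theorem vanOn_point (n : ℕ) : VanOn G n (Set.univ : Set Unit) := by
  intro c hc
  have hs : ∀ (k : ℕ) (s t : Simp k Unit), s = t := fun k s t => Subsingleton.elim s t
  have e : ∀ (k : ℕ) (d : Co k Unit G) (s : Simp (k + 1) PUnit) (t : Simp k Unit),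
      cb k d s = (∑ i : Fin (k + 2), (-1 : ℤ) ^ (i : ℕ)) • d t := by
    intro k d s t
    rw [cb_apply, bd_sg, map_sum, Finset.sum_smul]
    refine Finset.sum_congr rfl fun i _ => ?_
    rw [map_smul, ev_sg, hs k (s.comp (face i)) t]
  have e2 : ∀ k : ℕ, (∑ i : Fin k, (-1 : ℤ) ^ (i : ℕ)) = if Even k then 0 else 1 := by
    intro k
    rw [Fin.sum_univ_eq_sum_range (fun i => (-1 : ℤ) ^ i), neg_one_geom_sum]
  rcases Nat.even_or_odd n with hn | hn
  · refine ⟨0, fun s _ => ?_⟩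
    have h := hc ⟨fun _ => (), continuous_const⟩ (Set.subset_univ _)
    have h3 : ¬ Even (n + 1 + 2) := by
      rw [Nat.not_even_iff_odd]
      obtain ⟨k, rfl⟩ := hn
      exact ⟨k + 1, by ring⟩
    rw [e (n + 1) c _ s, e2, if_neg h3, one_smul] at h
    simp [h]
  · refine ⟨fun _ => c ⟨fun _ => (), continuous_const⟩, fun s _ => ?_⟩
    have h3 : ¬ Even (n + 2) := by
      rw [Nat.not_even_iff_odd]
      obtain ⟨k, rfl⟩ := hn
      exact ⟨k + 1, by ring⟩
    rw [e n _ s ⟨fun _ => (), continuous_const⟩, e2, if_neg h3, one_smul]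

section Star

variable {E : Type*} [AddCommGroup E] [Module ℝ E] [TopologicalSpace E] [IsTopologicalAddGroup E]
  [ContinuousSMul ℝ E]

/-- The linear contraction of a product with a vector space. -/
def contraction (p : E) (Z : Type*) [TopologicalSpace Z] :
    (ContinuousMap.id (E × Z)).Homotopy (((ContinuousMap.const Z p).prodMk (ContinuousMap.id Z)).comp
      (ContinuousMap.snd : C(E × Z, Z))) where
  toFun x := ((1 - (x.1 : ℝ)) • x.2.1 + (x.1 : ℝ) • p, x.2.2)
  continuous_toFun := by fun_prop
  map_zero_left x := by simp
  map_one_left x := by simp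

theorem contraction_mem {P : Set E} {p : E} (hP : StarConvex ℝ p P) (t : unitInterval)
    (x : E × Z) (hx : x ∈ P ×ˢ (Set.univ : Set Z)) :
    contraction p Z (t, x) ∈ P ×ˢ (Set.univ : Set Z) := by
  refine ⟨?_, trivial⟩
  change (1 - (t : ℝ)) • x.1 + (t : ℝ) • p ∈ P
  rw [add_comm]
  exact hP hx.1 t.2.1 (sub_nonneg.2 t.2.2) (by ring)

theorem vanOn_prod {P : Set E} {p : E} (hP : StarConvex ℝ p P) (hp : p ∈ P) {n : ℕ}
    (h : VanOn G n (Set.univ : Set Z)) : VanOn G n (P ×ˢ (Set.univ : Set Z)) :=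
  h.of_homotopy _ _ (contraction p Z) (contraction_mem hP) (fun _ _ => Set.mem_univ _)
    fun _ _ => ⟨hp, Set.mem_univ _⟩

theorem vanOn_starConvex {P : Set E} {p : E} (hP : StarConvex ℝ p P) (hp : p ∈ P) (n : ℕ) :
    VanOn G n P := by
  let H : (ContinuousMap.id E).Homotopy
      ((ContinuousMap.const Unit p).comp (ContinuousMap.const E ())) :=
    { toFun := fun x => (1 - (x.1 : ℝ)) • x.2 + (x.1 : ℝ) • p
      continuous_toFun := by fun_prop
      map_zero_left := fun x => by simp
      map_one_left := fun x => by simp }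
  refine (vanOn_point n).of_homotopy _ _ H (fun t x hx => ?_) (fun _ _ => Set.mem_univ _) fun _ _ => hp
  change (1 - (t : ℝ)) • x + (t : ℝ) • p ∈ P
  rw [add_comm]
  exact hP hx t.2.1 (sub_nonneg.2 t.2.2) (by ring)

end Star

/-! ### Embeddings -/

theorem exists_lift {ε : X → Y} (hε : Topology.IsEmbedding ε) {n : ℕ} {W : Set X} (t : Simp n Y)
    (ht : Set.range t ⊆ ε '' W) :
    ∃ s : Simp n X, (⟨ε, hε.continuous⟩ : C(X, Y)).comp s = t ∧ Set.range s ⊆ W := by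
  have h : ∀ p, t p ∈ Set.range ε := fun p => Set.image_subset_range _ _ (ht ⟨p, rfl⟩)
  have h' : ∀ p, ε (hε.toHomeomorph.symm ⟨t p, h p⟩) = t p := fun p =>
    congrArg Subtype.val (hε.toHomeomorph.apply_symm_apply ⟨t p, h p⟩)
  refine ⟨⟨fun p => hε.toHomeomorph.symm ⟨t p, h p⟩, hε.toHomeomorph.symm.continuous.comp
    (t.continuous.subtype_mk h)⟩, ContinuousMap.ext h', ?_⟩
  rintro _ ⟨p, rfl⟩
  obtain ⟨x, hx, e⟩ := ht ⟨p, rfl⟩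
  rw [← h' p] at e
  exact hε.injective e ▸ hx

theorem comp_left_injective {f : C(X, Y)} (hf : Function.Injective f) {n : ℕ} {s t : Simp n X}
    (h : f.comp s = f.comp t) : s = t :=
  ContinuousMap.ext fun p => hf (DFunLike.congr_fun h p)

/-- Extension by zero to the simplices off the image. Cochains constructed in a chart become
cochains of the whole space in this way. -/
theorem exists_pull_eq {f : C(X, Y)} (hf : Function.Injective f) {n : ℕ} (c : Co n X G) :
    ∃ d : Co n Y G, pull f n d = c := by
  refine ⟨Function.extend (fun s => f.comp s) c 0, funext fun s => ?_⟩
  exact Function.Injective.extend_apply (fun s t h => comp_left_injective hf h) c 0 s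

theorem agreeOn_image {ε : X → Y} (hε : Topology.IsEmbedding ε) {n : ℕ} {W : Set X}
    {c d : Co n Y G} (h : AgreeOn W (pull (⟨ε, hε.continuous⟩ : C(X, Y)) n c)
      (pull (⟨ε, hε.continuous⟩ : C(X, Y)) n d)) : AgreeOn (ε '' W) c d := fun t ht => by
  obtain ⟨s, rfl, hs⟩ := exists_lift hε t ht
  exact h s hs

/-- A chain in the image of an embedding lifts. -/
theorem exists_cmap_eq {ε : X → Y} (hε : Topology.IsEmbedding ε) {n : ℕ} {W : Set X} {y : Ch n Y}
    (hy : y ∈ Cs {ε '' W} n) : ∃ x ∈ Cs {W} n, cmap ⟨ε, hε.continuous⟩ n x = y := by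
  refine (Submodule.mem_map (f := cmap ⟨ε, hε.continuous⟩ n)).1
    (map_supported _ LinearMap.id (fun t ht => ?_) hy)
  obtain ⟨_, rfl, ht⟩ := ht
  obtain ⟨s, rfl, hs⟩ := exists_lift hε t ht
  exact ⟨sg s, sg_mem_Cs rfl hs, cmap_sg _ _ _⟩

theorem cmap_injective {f : C(X, Y)} (hf : Function.Injective f) (n : ℕ) :
    Function.Injective (cmap f n) := by
  have h : ⇑(cmap f n) = Finsupp.mapDomain (fun s : Simp n X => f.comp s) := by
    ext x : 1
    rw [cmap, Finsupp.linearCombination_apply, Finsupp.mapDomain]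
    simp
  rw [h]
  exact Finsupp.mapDomain_injective fun s t h => comp_left_injective hf h

theorem mem_Cs_of_cmap {f : C(X, Y)} (hf : Function.Injective f) {n : ℕ} {x : Ch n X} {B : Set Y}
    (h : cmap f n x ∈ Cs {B} n) : x ∈ Cs {f ⁻¹' B} n := by
  have e : cmap f n x = Finsupp.mapDomain (fun s : Simp n X => f.comp s) x := by
    rw [cmap, Finsupp.linearCombination_apply, Finsupp.mapDomain]
    simp
  classical
  rw [e] at h
  intro s hs
  have h1 : f.comp s ∈ (Finsupp.mapDomain (fun s : Simp n X => f.comp s) x).support := by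
    rw [Finsupp.mapDomain_support_of_injective fun s t h => comp_left_injective hf h]
    exact Finset.mem_image_of_mem _ hs
  obtain ⟨_, rfl, h2⟩ := h h1
  refine ⟨_, rfl, ?_⟩
  rintro _ ⟨p, rfl⟩
  exact h2 ⟨p, rfl⟩

end Cochains

end Sing

end


/-! ### Cohomology of complements in the plane, and radial pushing -/

noncomputable section

namespace Sing

/-! ### Complements in vector spaces -/

section Planar

variable {G : Type*} [AddCommGroup G]

theorem vanOn_convex {E : Type*} [AddCommGroup E] [Module ℝ E] [TopologicalSpace E]
    [IsTopologicalAddGroup E] [ContinuousSMul ℝ E] {P : Set E} (hP : Convex ℝ P) (n : ℕ) :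
    VanOn G n P := by
  rcases P.eq_empty_or_nonempty with rfl | ⟨p, hp⟩
  · exact fun c _ => ⟨0, fun s hs => absurd (hs ⟨vx 0, rfl⟩) (Set.notMem_empty _)⟩
  · exact vanOn_starConvex (hP.starConvex hp) hp n

/-- Slide horizontally to the line `x = a - 1`. A point off the half-strip has its height outside
`[c, d]` or its abscissa below `a`, and the slide preserves either property. -/
theorem vanOn_compl_left (a c d : ℝ) (n : ℕ) :
    VanOn G n ((Set.Ici a ×ˢ Set.Icc c d)ᶜ : Set (ℝ × ℝ)) := by
  let H : (ContinuousMap.id (ℝ × ℝ)).Homotopy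
      ((⟨fun y : ℝ => (a - 1, y), by fun_prop⟩ : C(ℝ, ℝ × ℝ)).comp ContinuousMap.snd) :=
    { toFun := fun x => ((1 - (x.1 : ℝ)) * x.2.1 + (x.1 : ℝ) * (a - 1), x.2.2)
      continuous_toFun := by fun_prop
      map_zero_left := fun x => by simp
      map_one_left := fun x => by simp }
  refine (vanOn_convex (G := G) convex_univ n).of_homotopy _ _ H (fun t x hx => ?_)
    (fun _ _ => Set.mem_univ _) (fun y _ => fun hy => ?_)
  · rintro ⟨h1, h2⟩
    change (1 - (t : ℝ)) * x.1 + (t : ℝ) * (a - 1) ≥ a at h1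
    refine hx ⟨?_, h2⟩
    by_contra h3
    rw [Set.mem_Ici, not_le] at h3
    have h4 := t.2.1
    have h5 := mul_nonneg (sub_nonneg.2 t.2.2) (sub_nonneg.2 h3.le)
    have h6 : (t : ℝ) = 0 := by linarith
    rw [h6] at h1
    linarith
  · have : a ≤ a - 1 := hy.1
    linarith

theorem vanOn_compl_right (b c d : ℝ) (n : ℕ) :
    VanOn G n ((Set.Iic b ×ˢ Set.Icc c d)ᶜ : Set (ℝ × ℝ)) := by
  let H : (ContinuousMap.id (ℝ × ℝ)).Homotopy
      ((⟨fun y : ℝ => (b + 1, y), by fun_prop⟩ : C(ℝ, ℝ × ℝ)).comp ContinuousMap.snd) :=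
    { toFun := fun x => ((1 - (x.1 : ℝ)) * x.2.1 + (x.1 : ℝ) * (b + 1), x.2.2)
      continuous_toFun := by fun_prop
      map_zero_left := fun x => by simp
      map_one_left := fun x => by simp }
  refine (vanOn_convex (G := G) convex_univ n).of_homotopy _ _ H (fun t x hx => ?_)
    (fun _ _ => Set.mem_univ _) (fun y _ => fun hy => ?_)
  · rintro ⟨h1, h2⟩
    change (1 - (t : ℝ)) * x.1 + (t : ℝ) * (b + 1) ≤ b at h1
    refine hx ⟨?_, h2⟩
    by_contra h3
    rw [Set.mem_Iic, not_le] at h3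
    have h4 := t.2.1
    have h5 := mul_nonneg (sub_nonneg.2 t.2.2) (sub_nonneg.2 h3.le)
    have h6 : (t : ℝ) = 0 := by linarith
    rw [h6] at h1
    linarith
  · have : b + 1 ≤ b := hy.1
    linarith

/-- The rectangle `[r.1, r.2] × [s.1, s.2]`. -/
def rect (r : (ℝ × ℝ) × (ℝ × ℝ)) : Set (ℝ × ℝ) := Set.Icc r.1.1 r.1.2 ×ˢ Set.Icc r.2.1 r.2.2

theorem isCompact_rect (r : (ℝ × ℝ) × (ℝ × ℝ)) : IsCompact (rect r) :=
  isCompact_Icc.prod isCompact_Icc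

/-- The complement is covered by the complements of two half-strips, which meet in two disjoint
half-planes. Degree one is excluded by the index `n + 1`, as it must be for an annulus. -/
theorem vanOn_compl_rect (r : (ℝ × ℝ) × (ℝ × ℝ)) (n : ℕ) : VanOn G (n + 1) (rect r)ᶜ := by
  obtain ⟨⟨a, b⟩, c, d⟩ := r
  rcases (rect ((a, b), (c, d))).eq_empty_or_nonempty with h | ⟨⟨x, y⟩, ⟨h1, h2⟩, h3, h4⟩
  · rw [h, Set.compl_empty]
    exact vanOn_convex convex_univ _
  have hA : IsOpen ((Set.Ici a ×ˢ Set.Icc c d)ᶜ : Set (ℝ × ℝ)) :=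
    (isClosed_Ici.prod isClosed_Icc).isOpen_compl
  have hB : IsOpen ((Set.Iic b ×ˢ Set.Icc c d)ᶜ : Set (ℝ × ℝ)) :=
    (isClosed_Iic.prod isClosed_Icc).isOpen_compl
  have e : (rect ((a, b), (c, d)))ᶜ =
      (Set.Ici a ×ˢ Set.Icc c d)ᶜ ∪ (Set.Iic b ×ˢ Set.Icc c d)ᶜ := by
    rw [← Set.compl_inter, Set.prod_inter_prod, Set.inter_self, Set.Ici_inter_Iic]
    rfl
  rw [e]
  refine (vanOn_compl_left a c d _).union hA hB (vanOn_compl_right b c d _) ?_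
  have e2 : ((Set.Ici a ×ˢ Set.Icc c d)ᶜ ∩ (Set.Iic b ×ˢ Set.Icc c d)ᶜ : Set (ℝ × ℝ)) =
      (Set.univ ×ˢ Set.Iio c) ∪ (Set.univ ×ˢ Set.Ioi d) := by
    ext ⟨u, v⟩
    simp only [Set.mem_inter_iff, Set.mem_compl_iff, Set.mem_prod, Set.mem_Ici, Set.mem_Icc,
      Set.mem_Iic, Set.mem_union, Set.mem_univ, true_and, Set.mem_Iio, Set.mem_Ioi]
    dsimp only at h1 h2 h3 h4
    constructor
    · rintro ⟨h5, h6⟩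
      by_contra! h7
      rcases le_total a u with h | h
      · exact h5 ⟨h, h7⟩
      · exact h6 ⟨by linarith, h7⟩
    · rintro (h | h)
      · exact ⟨fun h' => by linarith [h'.2.1], fun h' => by linarith [h'.2.1]⟩
      · exact ⟨fun h' => by linarith [h'.2.2], fun h' => by linarith [h'.2.2]⟩
  rw [e2]
  refine VanOn.union_of_disjoint (isOpen_univ.prod isOpen_Iio) (isOpen_univ.prod isOpen_Ioi) ?_
    (vanOn_convex (convex_univ.prod (convex_Iio c)) n)
    (vanOn_convex (convex_univ.prod (convex_Ioi d)) n)
  ext ⟨u, v⟩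
  dsimp only at h1 h2 h3 h4
  simp only [Set.mem_inter_iff, Set.mem_prod, Set.mem_univ, true_and, Set.mem_Iio, Set.mem_Ioi,
    Set.mem_empty_iff_false, iff_false, not_and, not_lt]
  intro h
  linarith

/-- The union of a list of rectangles. -/
def rects : List ((ℝ × ℝ) × (ℝ × ℝ)) → Set (ℝ × ℝ) := List.foldr (fun r K => rect r ∪ K) ∅

theorem rects_cons (r) (L) : rects (r :: L) = rect r ∪ rects L := rfl

theorem rects_append (L L') : rects (L ++ L') = rects L ∪ rects L' := by
  induction L with
  | nil => exact (Set.empty_union _).symm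
  | cons r L ih => rw [List.cons_append, rects_cons, rects_cons, ih, Set.union_assoc]

theorem isCompact_rects (L) : IsCompact (rects L) := by
  induction L with
  | nil => exact isCompact_empty
  | cons r L ih => exact (isCompact_rect r).union ih

/-- The intersection of rectangles. -/
def rectInter (r r' : (ℝ × ℝ) × (ℝ × ℝ)) : (ℝ × ℝ) × (ℝ × ℝ) :=
  ((r.1.1 ⊔ r'.1.1, r.1.2 ⊓ r'.1.2), (r.2.1 ⊔ r'.2.1, r.2.2 ⊓ r'.2.2))

theorem rect_rectInter (r r') : rect (rectInter r r') = rect r ∩ rect r' := by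
  rw [rect, rect, rect, Set.prod_inter_prod, Set.Icc_inter_Icc, Set.Icc_inter_Icc]
  rfl

theorem rects_map (r) (L : List _) : rects (L.map (rectInter r)) = rect r ∩ rects L := by
  induction L with
  | nil => exact (Set.inter_empty _).symm
  | cons r' L ih => rw [List.map_cons, rects_cons, rects_cons, ih, rect_rectInter,
      Set.inter_union_distrib_left]

/-- By `VanOn.inter` one more rectangle `r` costs a vanishing one degree higher for the complement
of `rect r ∩ rects L`. That set is again a union of as many rectangles as `L` has, so the induction
runs over the length with `L` and `n` free. -/
theorem vanOn_compl_rects (L) (n : ℕ) : VanOn G (n + 1) (rects L)ᶜ := by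
  induction h : L.length generalizing L n with
  | zero =>
    rw [List.length_eq_zero_iff.1 h]
    change VanOn G (n + 1) (∅ : Set (ℝ × ℝ))ᶜ
    rw [Set.compl_empty]
    exact vanOn_convex convex_univ _
  | succ k ih =>
    cases L with
    | nil => simp at h
    | cons r L =>
      have h' : L.length = k := by simpa using h
      rw [rects_cons, Set.compl_union]
      refine VanOn.inter (isCompact_rect r).isClosed.isOpen_compl
        (isCompact_rects L).isClosed.isOpen_compl (vanOn_compl_rect r n) (ih L n h') ?_
      rw [← Set.compl_inter, ← rects_map]
      exact ih _ _ (by simpa using h')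

theorem exists_rects {K O : Set (ℝ × ℝ)} (hK : IsCompact K) (hO : IsOpen O) (h : K ⊆ O) :
    ∃ L, K ⊆ rects L ∧ rects L ⊆ O := by
  refine hK.induction_on (p := fun s => ∃ L, s ⊆ rects L ∧ rects L ⊆ O)
    ⟨[], Set.empty_subset _, Set.empty_subset _⟩ ?_ ?_ fun x hx => ?_
  · rintro s t hst ⟨L, h1, h2⟩
    exact ⟨L, hst.trans h1, h2⟩
  · rintro s t ⟨L, h1, h2⟩ ⟨L', h3, h4⟩
    refine ⟨L ++ L', ?_, ?_⟩ <;> rw [rects_append]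
    exacts [Set.union_subset_union h1 h3, Set.union_subset h2 h4]
  -- The product carries the sup distance, so a closed ball of the plane is a square.
  · obtain ⟨r, hr, h1⟩ := Metric.nhds_basis_closedBall.mem_iff.1 (hO.mem_nhds (h hx))
    refine ⟨_, mem_nhdsWithin_of_mem_nhds (Metric.closedBall_mem_nhds x hr),
      [((x.1 - r, x.1 + r), (x.2 - r, x.2 + r))], ?_⟩
    rw [← Prod.mk.eta (p := x), ← closedBall_prod_same, Real.closedBall_eq_Icc,
      Real.closedBall_eq_Icc] at h1 ⊢
    rw [rects_cons]
    change _ ⊆ rect _ ∪ ∅ ∧ rect _ ∪ ∅ ⊆ O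
    rw [Set.union_empty]
    exact ⟨subset_rfl, h1⟩

end Planar

section Push

variable {E : Type*} [NormedAddCommGroup E] [NormedSpace ℝ E]

theorem push_aux (x v : E) (hv : v ≠ x) {k : ℝ} (hk : 0 ≤ k) :
    ‖(1 + k / ‖v - x‖) • (v - x)‖ = ‖v - x‖ + k := by
  have h : 0 < ‖v - x‖ := norm_pos_iff.2 (sub_ne_zero.2 hv)
  rw [norm_smul, Real.norm_of_nonneg (by positivity)]
  field_simp

/-- The map which pushes a punctured vector space away from the puncture. -/
def pushOut (x : E) (k : ℝ) (hk : 0 ≤ k) : C({v : E // v ≠ x}, {v : E // v ≠ x}) where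
  toFun v := ⟨x + (1 + k / ‖v.1 - x‖) • (v.1 - x), fun h => by
    have h1 := push_aux x v.1 v.2 hk
    have h2 : 0 < ‖v.1 - x‖ := norm_pos_iff.2 (sub_ne_zero.2 v.2)
    rw [add_eq_left.1 h, norm_zero] at h1
    linarith⟩
  continuous_toFun := by
    refine Continuous.subtype_mk ?_ _
    have : ∀ v : {v : E // v ≠ x}, ‖v.1 - x‖ ≠ 0 := fun v => norm_ne_zero_iff.2 (sub_ne_zero.2 v.2)
    fun_prop (disch := exact this)

theorem norm_pushOut (x : E) {k : ℝ} (hk : 0 ≤ k) (v : {v : E // v ≠ x}) :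
    ‖(pushOut x k hk v).1 - x‖ = ‖v.1 - x‖ + k := by
  rw [← push_aux x v.1 v.2 hk]
  exact congrArg norm (add_sub_cancel_left _ _)

/-- The linear homotopy from the identity to `pushOut`. -/
def pushHtpy (x : E) (k : ℝ) (hk : 0 ≤ k) :
    (ContinuousMap.id {v : E // v ≠ x}).Homotopy (pushOut x k hk) where
  toFun p := pushOut x (p.1 * k) (mul_nonneg p.1.2.1 hk) p.2
  continuous_toFun := by
    refine Continuous.subtype_mk ?_ _
    have : ∀ v : unitInterval × {v : E // v ≠ x}, ‖v.2.1 - x‖ ≠ 0 :=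
      fun v => norm_ne_zero_iff.2 (sub_ne_zero.2 v.2.2)
    fun_prop (disch := exact this)
  map_zero_left v := Subtype.ext (by simp [pushOut])
  map_one_left v := Subtype.ext (by simp [pushOut])

theorem norm_pushHtpy (x : E) {k : ℝ} (hk : 0 ≤ k) (t : unitInterval) (v : {v : E // v ≠ x}) :
    ‖(pushHtpy x k hk (t, v)).1 - x‖ = ‖v.1 - x‖ + t * k :=
  norm_pushOut x (mul_nonneg t.2.1 hk) v

end Push

end Sing

end


/-! ### Top cohomology of closed surfaces -/

noncomputable section

namespace Sing

/-! ### Cocycles with supports in charts -/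

section Charts

variable {E Y G : Type*} [NormedAddCommGroup E] [NormedSpace ℝ E] [TopologicalSpace Y]
  [AddCommGroup G]

/-- In the chart `c` has a primitive `b`, which is closed off `K`. As `H^{n+1}(Kᶜ) = 0`, it can be
corrected by a coboundary to vanish off `K`, and it then extends by zero. -/
theorem exists_supported_primitive {ε : E → Y} (hε : Topology.IsOpenEmbedding ε) {K : Set E}
    (hK : IsClosed (ε '' K)) {n : ℕ} (hv : VanOn G n Kᶜ) {c : Co (n + 2) Y G} (hc : cb _ c = 0)
    (h0 : AgreeOn (ε '' K)ᶜ c 0) :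
    ∃ q : Co (n + 1) Y G, c = cb _ q ∧ AgreeOn (ε '' K)ᶜ q 0 := by
  set f : C(E, Y) := ⟨ε, hε.continuous⟩ with hf
  have hm : Set.MapsTo f Kᶜ (ε '' K)ᶜ := fun v hv h => hv ((hε.injective.mem_set_image).1 h)
  obtain ⟨b, hb⟩ := vanOn_convex (G := G) (convex_univ (𝕜 := ℝ) (E := E)) (n + 1) (pull f _ c)
    (AgreeOn.of_eq (by rw [cb_pull, hc]; rfl))
  obtain ⟨e, he⟩ := hv b ((hb.symm.mono (Set.subset_univ _)).trans (h0.pull hm))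
  obtain ⟨d, hd⟩ := exists_pull_eq (f := f) hε.injective (b - cb _ e)
  obtain ⟨q, hq, -, hq0⟩ := exists_primitive_of_eq (c := c) (a := d) (b := 0)
    hε.isOpen_range hK.isOpen_compl (AgreeOn.of_eq hc)
    (by
      rw [← Set.image_univ]
      refine agreeOn_image hε.isEmbedding ?_
      rw [← cb_pull]
      change AgreeOn _ (pull f _ c) (cb _ (pull f _ d))
      rw [hd, cb_sub, cb_cb, sub_zero]
      exact hb)
    (by rw [cb_zero]; exact h0)
    (by
      have : Set.range ε ∩ (ε '' K)ᶜ = ε '' Kᶜ := by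
        rw [← Set.image_univ, ← Set.diff_eq, ← Set.image_diff hε.injective, Set.compl_eq_univ_diff]
      rw [this]
      refine agreeOn_image hε.isEmbedding ?_
      change AgreeOn _ (pull f _ d) 0
      rw [hd]
      exact fun s hs => sub_eq_zero.2 (he s hs))
  refine ⟨q, AgreeOn.eq (hq.mono fun y _ => ?_), hq0⟩
  by_cases h : y ∈ ε '' K
  · exact Or.inl (Set.image_subset_range _ _ h)
  · exact Or.inr h

/-- A cocycle with support in a closed ball in a chart is cohomologous to a cocycle with support
in the centre of the ball. -/
theorem exists_point_support [T1Space Y] {ε : E → Y} (hε : Topology.IsOpenEmbedding ε) (x : E)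
    {r : ℝ} (hr : 0 ≤ r) (hK : IsClosed (ε '' Metric.closedBall x r)) {n : ℕ}
    {c : Co (n + 2) Y G} (hc : cb _ c = 0) (h0 : AgreeOn (ε '' Metric.closedBall x r)ᶜ c 0) :
    ∃ (c' : Co (n + 2) Y G) (q : Co (n + 1) Y G), cb _ c' = 0 ∧ AgreeOn {ε x}ᶜ c' 0 ∧
      c - c' = cb _ q := by
  set K := Metric.closedBall x r with hKd
  set f : C(E, Y) := ⟨ε, hε.continuous⟩ with hf
  have hm : Set.MapsTo f Kᶜ (ε '' K)ᶜ := fun v hv h => hv ((hε.injective.mem_set_image).1 h)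
  obtain ⟨b, hb⟩ := vanOn_convex (G := G) (convex_univ (𝕜 := ℝ) (E := E)) (n + 1) (pull f _ c)
    (AgreeOn.of_eq (by rw [cb_pull, hc]; rfl))
  have hbK : AgreeOn Kᶜ (cb _ b) 0 := (hb.symm.mono (Set.subset_univ _)).trans (h0.pull hm)
  set ι : C({v : E // v ≠ x}, E) := ⟨Subtype.val, continuous_subtype_val⟩ with hι
  have hpush : ∀ t v, v ∈ ι ⁻¹' Kᶜ → pushHtpy x r hr (t, v) ∈ ι ⁻¹' Kᶜ := by
    intro t v hv h
    refine hv (mem_closedBall_iff_norm.2 ?_)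
    have h1 := mem_closedBall_iff_norm.1 h
    change ‖(pushHtpy x r hr (t, v)).1 - x‖ ≤ r at h1
    rw [norm_pushHtpy] at h1
    have := mul_nonneg t.2.1 hr
    change ‖v.1 - x‖ ≤ r
    linarith
  -- Off the ball `b` is closed, and pushing outwards is homotopic to the identity within the
  -- complement of the ball. There `b` and its pushed version are cohomologous.
  obtain ⟨e, he⟩ := exists_primitive_of_homotopy (pushHtpy x r hr) (A := ι ⁻¹' Kᶜ)
    (B := ι ⁻¹' Kᶜ) hpush (c := pull ι _ b) (by
      rw [cb_pull]
      exact hbK.pull (Set.mapsTo_preimage _ _))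
  -- The pushed version is closed on all of `E - x`, because `pushOut` lands outside the ball.
  have h2 : cb _ (pull (pushOut x r hr) _ (pull ι _ b)) = 0 := by
    rw [cb_pull, cb_pull]
    refine AgreeOn.eq ((hbK.pull (Set.mapsTo_preimage ι _)).pull fun v _ => ?_)
    intro h
    have h1 := mem_closedBall_iff_norm.1 h
    change ‖(pushOut x r hr v).1 - x‖ ≤ r at h1
    rw [norm_pushOut] at h1
    have : 0 < ‖v.1 - x‖ := norm_pos_iff.2 (sub_ne_zero.2 v.2)
    linarith
  obtain ⟨b3, hb3⟩ := exists_pull_eq (f := ι) Subtype.val_injective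
    (pull (pushOut x r hr) _ (pull ι _ b))
  obtain ⟨e3, rfl⟩ := exists_pull_eq (f := ι) Subtype.val_injective e
  obtain ⟨d3, hd3⟩ := exists_pull_eq (f := f) hε.injective b3
  obtain ⟨d, hd⟩ := exists_pull_eq (f := f) hε.injective (b - b3 - cb _ e3)
  have hx : AgreeOn (Set.range ε ∩ {ε x}ᶜ) (cb _ d3) 0 := by
    have : Set.range ε ∩ {ε x}ᶜ = ε '' (Subtype.val '' (Set.univ : Set {v : E // v ≠ x})) := by
      rw [← Set.image_univ, ← Set.diff_eq, ← Set.image_singleton, ← Set.image_diff hε.injective,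
        ← Set.compl_eq_univ_diff, Set.image_univ]
      exact congrArg _ Subtype.range_val_subtype.symm
    rw [this]
    refine agreeOn_image hε.isEmbedding (agreeOn_image Topology.IsEmbedding.subtypeVal ?_)
    change AgreeOn _ (pull ι _ (pull f _ (cb _ d3))) 0
    rw [← cb_pull, hd3, ← cb_pull, hb3, h2]
    exact AgreeOn.refl _ _
  -- The coboundary of the pushed primitive vanishes off the centre. Continued by zero outside the
  -- chart, it is the desired cocycle at the centre.
  obtain ⟨p, hp1, hp2⟩ := exists_glue hx
  obtain ⟨c', hc', hc1, hc2⟩ := exists_extension hε.isOpen_range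
    (isClosed_singleton (x := ε x)).isOpen_compl (p := p) (by simpa [cb_cb] using hp1.cb)
    (by simpa using hp2.cb)
  have hc0 : cb _ c' = 0 := AgreeOn.eq (hc'.mono fun y _ => by
    by_cases h : y = ε x
    · exact Or.inl ⟨x, h.symm⟩
    · exact Or.inr h)
  obtain ⟨q, hq, -, -⟩ := exists_primitive_of_eq (c := c - c') (a := d) (b := 0)
    hε.isOpen_range hK.isOpen_compl (AgreeOn.of_eq (by rw [cb_sub, hc, hc0, sub_zero]))
    (by
      have h4 : AgreeOn (Set.range ε) c' (cb _ d3) := hc1.trans hp1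
      refine ((AgreeOn.refl _ c).sub h4).trans ?_
      rw [← Set.image_univ]
      refine agreeOn_image hε.isEmbedding ?_
      rw [← cb_pull]
      change AgreeOn _ (pull f _ c - pull f _ (cb _ d3)) (cb _ (pull f _ d))
      rw [hd, cb_sub, cb_sub, cb_cb, sub_zero, ← cb_pull, hd3]
      exact hb.sub (AgreeOn.refl _ _))
    (by
      rw [cb_zero]
      have h4 : AgreeOn (ε '' K)ᶜ c' 0 := (hc2.trans hp2).mono (Set.compl_subset_compl.2 (by
        rintro _ rfl
        exact ⟨x, Metric.mem_closedBall_self hr, rfl⟩))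
      simpa using h0.sub h4)
    (by
      have : Set.range ε ∩ (ε '' K)ᶜ = ε '' (Subtype.val '' (ι ⁻¹' Kᶜ)) := by
        rw [← Set.image_univ, ← Set.diff_eq, ← Set.image_diff hε.injective,
          ← Set.compl_eq_univ_diff]
        congr 1
        ext v
        constructor
        · intro hv
          refine ⟨⟨v, ?_⟩, hv, rfl⟩
          rintro rfl
          exact hv (Metric.mem_closedBall_self hr)
        · rintro ⟨w, hw, rfl⟩
          exact hw
      rw [this]
      refine agreeOn_image hε.isEmbedding (agreeOn_image Topology.IsEmbedding.subtypeVal ?_)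
      change AgreeOn _ (pull ι _ (pull f _ d)) 0
      rw [hd]
      intro s hs
      have h5 := he s hs
      have h6 := congrFun hb3 s
      have h7 := congrFun (cb_pull ι _ e3) s
      simp only [Pi.sub_apply, pull_apply, ContinuousMap.id_comp] at h5 h6 h7 ⊢
      rw [h6, ← h7, ← h5]
      abel_nf
      rfl)
  refine ⟨c', q, hc0, hc2.trans hp2, AgreeOn.eq (hq.mono fun y _ => ?_)⟩
  by_cases h : y ∈ ε '' K
  · exact Or.inl (Set.image_subset_range _ _ h)
  · exact Or.inr h

/-- Every point is in the image of an open embedding of the vector space `E`. -/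
def HasCharts (E Y : Type*) [TopologicalSpace E] [TopologicalSpace Y] : Prop :=
  ∀ y : Y, ∃ ε : E → Y, Topology.IsOpenEmbedding ε ∧ y ∈ Set.range ε

/-- The set where `Q` holds is open and closed, since it contains each chart entirely or not at all.
-/
theorem HasCharts.induction [PreconnectedSpace Y] (h : HasCharts E Y) {Q : Y → Prop}
    (hQ : ∀ ε : E → Y, Topology.IsOpenEmbedding ε → ∀ p p', Q (ε p) → Q (ε p')) {x : Y} (hx : Q x)
    (y : Y) : Q y := by
  have hc : IsClopen {y | Q y} := by
    constructor
    · rw [← isOpen_compl_iff, isOpen_iff_mem_nhds]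
      intro y hy
      obtain ⟨ε, hε, p, rfl⟩ := h y
      filter_upwards [hε.isOpen_range.mem_nhds ⟨p, rfl⟩]
      rintro _ ⟨p', rfl⟩ hp'
      exact hy (hQ ε hε _ _ hp')
    · rw [isOpen_iff_mem_nhds]
      intro y hy
      obtain ⟨ε, hε, p, rfl⟩ := h y
      filter_upwards [hε.isOpen_range.mem_nhds ⟨p, rfl⟩]
      rintro _ ⟨p', rfl⟩
      exact hQ ε hε _ _ hy
  exact Set.eq_univ_iff_forall.1 (hc.eq_univ ⟨x, hx⟩) y

end Charts

section Surface

variable {Y G : Type*} [TopologicalSpace Y] [T2Space Y] [AddCommGroup G]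

/-- Peels off one chart at a time, as with a partition of unity. Cutting `c` off to a compact part
`T₁` in one chart creates a coboundary on `T₁ ∩ T₂`, which is removed by a primitive supported in
rectangles of that chart. -/
theorem cocycle_induction_aux {n : ℕ} {P : Co (n + 2) Y G → Prop} (h0 : P 0)
    (hadd : ∀ c c', P c → P c' → P (c + c'))
    (hP : ∀ ε : ℝ × ℝ → Y, Topology.IsOpenEmbedding ε → ∀ L c, cb _ c = 0 →
      AgreeOn (ε '' rects L)ᶜ c 0 → P c)
    (l : List {ε : ℝ × ℝ → Y // Topology.IsOpenEmbedding ε}) (T : Set Y) (hT : IsCompact T)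
    (hTl : T ⊆ ⋃ ε ∈ l, Set.range ε.1) (c : Co (n + 2) Y G) (hc : cb _ c = 0)
    (hcT : AgreeOn Tᶜ c 0) : P c := by
  induction l generalizing T c with
  | nil =>
    have : T = ∅ := by simpa using hTl
    rw [this, Set.compl_empty] at hcT
    rwa [hcT.eq]
  | cons ε l ih =>
    obtain ⟨ε, hε⟩ := ε
    set O : Set Y := ⋃ ε ∈ l, Set.range ε.1 with hO
    have hOo : IsOpen O := isOpen_biUnion fun ε _ => ε.2.isOpen_range
    have hTl' : T ⊆ Set.range ε ∪ O := by
      refine hTl.trans (subset_of_eq ?_)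
      simp [hO]
    obtain ⟨T₁, T₂, hT₁, hT₂, h₁, h₂, rfl⟩ := hT.binary_compact_cover hε.isOpen_range hOo hTl'
    have hpre : ∀ {T : Set Y}, IsCompact T → T ⊆ Set.range ε → IsCompact (ε ⁻¹' T) :=
      fun hT h => hε.isInducing.isCompact_preimage' hT h
    -- The rectangles are taken inside the preimage of `O`, so that the correction supported in them
    -- is also covered by the remaining charts.
    obtain ⟨L, hL, hLO⟩ := exists_rects (hpre (hT₁.inter hT₂) (Set.inter_subset_left.trans h₁))
      (hOo.preimage hε.continuous) (Set.preimage_mono (Set.inter_subset_right.trans h₂))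
    have hLc : IsCompact (ε '' rects L) := (isCompact_rects L).image hε.continuous
    have hL' : T₁ ∩ T₂ ⊆ ε '' rects L := by
      rintro y hy
      obtain ⟨v, rfl⟩ := h₁ hy.1
      exact ⟨v, hL hy, rfl⟩
    -- The cut-off of `c`: zero off `T₁` and equal to `c` off `T₂`. These agree off `T₁ ∪ T₂`, where
    -- `c` vanishes.
    obtain ⟨p, hp1, hp2⟩ := exists_glue (A := T₁ᶜ) (B := T₂ᶜ) (p := 0) (q := c) (by
      rw [← Set.compl_union]
      exact hcT.symm)
    obtain ⟨r, hr, hr1, hr2⟩ := exists_extension hT₁.isClosed.isOpen_compl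
      hT₂.isClosed.isOpen_compl (p := p) (by simpa using hp1.cb) (by simpa [hc] using hp2.cb)
    rw [← Set.compl_inter] at hr
    obtain ⟨q, hq, hq0⟩ := exists_supported_primitive hε hLc.isClosed (vanOn_compl_rects L n)
      (cb_cb _ r) (hr.mono (Set.compl_subset_compl.2 hL'))
    have hcr : cb _ (r - q) = 0 := by rw [cb_sub, ← hq, sub_self]
    obtain ⟨L', hL₁, -⟩ := exists_rects
      (hpre (hT₁.union hLc) (Set.union_subset h₁ (Set.image_subset_range _ _))) isOpen_univ
      (Set.subset_univ _)
    have hP1 : P (r - q) := by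
      refine hP ε hε L' _ hcr ?_
      have h3 : AgreeOn (T₁ ∪ ε '' rects L)ᶜ (r - q) 0 := by
        rw [Set.compl_union]
        simpa using ((hr1.trans hp1).mono Set.inter_subset_left).sub
          (hq0.mono Set.inter_subset_right)
      refine h3.mono (Set.compl_subset_compl.2 ?_)
      intro y hy
      obtain ⟨v, rfl⟩ := Set.union_subset h₁ (Set.image_subset_range _ _) hy
      exact ⟨v, hL₁ hy, rfl⟩
    have hP2 : P (c - (r - q)) := by
      refine ih (T₂ ∪ ε '' rects L) (hT₂.union hLc)
        (Set.union_subset h₂ (Set.image_subset_iff.2 hLO)) _ (by rw [cb_sub, hc, hcr, sub_zero]) ?_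
      rw [Set.compl_union]
      simpa using (AgreeOn.refl _ c).sub (((hr2.trans hp2).mono Set.inter_subset_left).sub
          (hq0.mono Set.inter_subset_right))
    simpa using hadd _ _ hP1 hP2

/-- Every cocycle of a closed surface is a sum of cocycles with supports in charts. -/
theorem cocycle_induction [CompactSpace Y] (hY : HasCharts (ℝ × ℝ) Y) {n : ℕ}
    {P : Co (n + 2) Y G → Prop} (h0 : P 0)
    (hadd : ∀ c c', P c → P c' → P (c + c'))
    (hP : ∀ ε : ℝ × ℝ → Y, Topology.IsOpenEmbedding ε → ∀ L c, cb _ c = 0 →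
      AgreeOn (ε '' rects L)ᶜ c 0 → P c) (c : Co (n + 2) Y G) (hc : cb _ c = 0) : P c := by
  choose ε hε hy using hY
  obtain ⟨t, ht⟩ := isCompact_univ.elim_finite_subcover (fun y => Set.range (ε y))
    (fun y => (hε y).isOpen_range) (fun y _ => Set.mem_iUnion.2 ⟨y, hy y⟩)
  refine cocycle_induction_aux h0 hadd hP (t.toList.map fun y => ⟨ε y, hε y⟩) Set.univ
    isCompact_univ ?_ c hc ?_
  · simpa using ht
  · rw [Set.compl_univ]
    exact fun s hs => absurd (hs ⟨vx 0, rfl⟩) (Set.notMem_empty _)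

/-- With the shift in `VanOn`, this is degree `n + 3`. A cocycle of degree at least three supported
in rectangles of a chart already has a primitive supported there. -/
theorem vanOn_surface [CompactSpace Y] (hY : HasCharts (ℝ × ℝ) Y) (n : ℕ) :
    VanOn G (n + 2) (Set.univ : Set Y) := by
  intro c hc
  obtain ⟨q, hq⟩ := cocycle_induction hY (P := fun c : Co (n + 3) Y G => ∃ q, c = cb _ q)
    ⟨0, by simp⟩ (by
      rintro _ _ ⟨q, rfl⟩ ⟨q', rfl⟩
      exact ⟨q + q', (cb_add _ _ _).symm⟩) (fun ε hε L c hc h => by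
      obtain ⟨q, hq, -⟩ := exists_supported_primitive hε
        ((isCompact_rects L).image hε.continuous).isClosed (vanOn_compl_rects L n) hc h
      exact ⟨q, hq⟩) c hc.eq
  exact ⟨q, AgreeOn.of_eq hq⟩

/-- Cut a cocycle into pieces in charts, collapse each piece to the centre of a ball by
`exists_point_support`, and transport the points to `x`: within a chart, collapsing a ball around
`p` that contains `p'` moves the support from `p'` to `p`. -/
theorem exists_support_singleton [CompactSpace Y] [PreconnectedSpace Y]
    (hY : HasCharts (ℝ × ℝ) Y) (x : Y) (c : Co 2 Y G) (hc : cb _ c = 0) :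
    ∃ (c' : Co 2 Y G) (q : Co 1 Y G), cb _ c' = 0 ∧ AgreeOn {x}ᶜ c' 0 ∧ c - c' = cb _ q := by
  have move : ∀ y (c : Co 2 Y G), cb _ c = 0 → AgreeOn {y}ᶜ c 0 →
      ∃ (c' : Co 2 Y G) (q : Co 1 Y G), cb _ c' = 0 ∧ AgreeOn {x}ᶜ c' 0 ∧ c - c' = cb _ q := by
    intro y
    refine hY.induction (Q := fun y => ∀ c : Co 2 Y G, cb _ c = 0 → AgreeOn {y}ᶜ c 0 →
      ∃ (c' : Co 2 Y G) (q : Co 1 Y G), cb _ c' = 0 ∧ AgreeOn {x}ᶜ c' 0 ∧ c - c' = cb _ q)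
      (fun ε hε p p' h c hc hcp => ?_) (x := x) (fun c hc hcx => ⟨c, 0, hc, hcx, by simp⟩) y
    obtain ⟨c₁, q₁, h₁, h₂, h₃⟩ := exists_point_support hε p (norm_nonneg (p' - p))
      ((isCompact_closedBall _ _).image hε.continuous).isClosed hc
      (hcp.mono (Set.compl_subset_compl.2 (by
        rintro _ rfl
        exact ⟨p', mem_closedBall_iff_norm.2 le_rfl, rfl⟩)))
    obtain ⟨c₂, q₂, h₄, h₅, h₆⟩ := h c₁ h₁ h₂
    exact ⟨c₂, q₁ + q₂, h₄, h₅, by rw [cb_add, ← h₃, ← h₆]; abel⟩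
  refine cocycle_induction hY (P := fun c : Co 2 Y G => ∃ (c' : Co 2 Y G) (q : Co 1 Y G),
    cb _ c' = 0 ∧ AgreeOn {x}ᶜ c' 0 ∧ c - c' = cb _ q) ⟨0, 0, by simp, AgreeOn.refl _ _, by simp⟩
    ?_ (fun ε hε L c hc hcL => ?_) c hc
  · rintro c₁ c₂ ⟨c₁', q₁, h₁, h₂, h₃⟩ ⟨c₂', q₂, h₄, h₅, h₆⟩
    refine ⟨c₁' + c₂', q₁ + q₂, by rw [cb_add, h₁, h₄, add_zero], by simpa using h₂.add h₅, ?_⟩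
    rw [cb_add, ← h₃, ← h₆]
    abel
  · obtain ⟨r, hr, hL⟩ := (isCompact_rects L).isBounded.subset_closedBall_lt 0 0
    obtain ⟨c₁, q₁, h₁, h₂, h₃⟩ := exists_point_support hε 0 hr.le
      ((isCompact_closedBall _ _).image hε.continuous).isClosed hc
      (hcL.mono (Set.compl_subset_compl.2 (Set.image_mono hL)))
    obtain ⟨c₂, q₂, h₄, h₅, h₆⟩ := move _ c₁ h₁ h₂
    exact ⟨c₂, q₁ + q₂, h₄, h₅, by rw [cb_add, ← h₃, ← h₆]; abel⟩

/-- The constant simplex. -/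
def pt (n : ℕ) {X : Type*} [TopologicalSpace X] (x : X) : Simp n X := ContinuousMap.const _ x

theorem eq_pt {X : Type*} [TopologicalSpace X] (s : Simp 0 X) : s = pt 0 (s (vx 0)) :=
  ContinuousMap.ext fun p => congrArg s (Subsingleton.elim _ _)

theorem face_vx {n : ℕ} (i : Fin (n + 2)) (j : Fin (n + 1)) : face i (vx j) = vx (i.succAbove j) :=
  ConvexLike.aff_vx _ _

theorem bd_zero_sg {X : Type*} [TopologicalSpace X] (s : Simp 1 X) :
    bd 0 (sg s) = sg (pt 0 (s (vx 1))) - sg (pt 0 (s (vx 0))) := by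
  rw [bd_sg, Fin.sum_univ_two, eq_pt (s.comp (face 0)), eq_pt (s.comp (face 1))]
  simp only [ContinuousMap.comp_apply, face_vx]
  simp [sub_eq_add_neg]

/-- The simplex of a path. -/
def simpOfPath {X : Type*} [TopologicalSpace X] {x y : X} (γ : Path x y) : Simp 1 X :=
  ⟨fun p => γ ⟨p 1, mem_Icc_of_mem_stdSimplex p.2 1⟩,
    γ.continuous.comp ((continuous_coord 1).subtype_mk _)⟩

theorem bd_simpOfPath {X : Type*} [TopologicalSpace X] {x y : X} (γ : Path x y) :
    bd 0 (sg (simpOfPath γ)) = sg (pt 0 y) - sg (pt 0 x) := by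
  rw [bd_zero_sg]
  congr 3
  · refine (congrArg γ (Subtype.ext ?_)).trans γ.target
    exact (vx_apply (1 : Fin 2) 1).trans (if_pos rfl)
  · refine (congrArg γ (Subtype.ext ?_)).trans γ.source
    exact (vx_apply (0 : Fin 2) 1).trans (if_neg (by decide))

/-- Integrate `e` along chosen paths from a base point. An edge together with the paths to its two
ends forms a cycle, on which `e` vanishes. -/
theorem exists_primitive_of_cycles {X : Type*} [TopologicalSpace X] {W : Set X}
    (hW : IsPathConnected W) {e : Co 1 X G} (h : ∀ x ∈ Cs {W} 1, bd 0 x = 0 → ev e x = 0) :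
    ∃ f : Co 0 X G, AgreeOn W e (cb 0 f) := by
  classical
  obtain ⟨x₀, hx₀, hj⟩ := hW
  have hγ : ∀ x, ∃ t : Simp 1 X, x ∈ W → Set.range t ⊆ W ∧
      bd 0 (sg t) = sg (pt 0 x) - sg (pt 0 x₀) := by
    intro x
    by_cases hx : x ∈ W
    · obtain ⟨γ, hγ⟩ := hj hx
      refine ⟨simpOfPath γ, fun _ => ⟨?_, bd_simpOfPath γ⟩⟩
      rintro _ ⟨p, rfl⟩
      exact hγ _
    · exact ⟨pt 1 x, fun h => absurd h hx⟩
  choose t ht using hγ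
  refine ⟨fun s => e (t (s (vx 0))), fun s hs => ?_⟩
  have h0 := ht _ (hs ⟨vx 0, rfl⟩)
  have h1 := ht _ (hs ⟨vx 1, rfl⟩)
  have h2 := h (sg s - sg (t (s (vx 1))) + sg (t (s (vx 0))))
    (Submodule.add_mem _ (Submodule.sub_mem _ (sg_mem_Cs rfl hs) (sg_mem_Cs rfl h1.1))
      (sg_mem_Cs rfl h0.1)) (by
    rw [map_add, map_sub, h0.2, h1.2, bd_zero_sg]
    abel)
  rw [map_add, map_sub, ev_sg, ev_sg, ev_sg] at h2
  rw [cb_apply, bd_zero_sg, map_sub, ev_sg, ev_sg]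
  change e s = e (t (s (vx 1))) - e (t (s (vx 0)))
  rw [← sub_eq_zero, ← h2]
  abel

/-- The prism of the contraction to the origin joins the cycle to constant simplices. A constant
1-simplex bounds the constant 2-simplex, as `1 - 1 + 1 = 1`. -/
theorem exists_bd_of_cycle {E : Type*} [AddCommGroup E] [Module ℝ E] [TopologicalSpace E]
    [IsTopologicalAddGroup E] [ContinuousSMul ℝ E] (x : Ch 1 E) (hx : bd 0 x = 0) :
    ∃ y : Ch 2 E, bd 1 y = x := by
  let H : (ContinuousMap.id E).Homotopy (ContinuousMap.const E 0) :=
    { toFun := fun x => (1 - (x.1 : ℝ)) • x.2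
      continuous_toFun := by fun_prop
      map_zero_left := fun x => by simp
      map_one_left := fun x => by simp }
  have h := bd_prism H 0 x
  rw [hx, map_zero, sub_zero] at h
  have h1 : cmap (ContinuousMap.id E) 1 x = x :=
    lhom_eq (f := cmap (ContinuousMap.id E) 1) (g := LinearMap.id) (fun s => by
      rw [cmap_sg, ContinuousMap.id_comp]; rfl) x
  have h2 : cmap (ContinuousMap.const E 0) 1 x =
      bd 1 (cmap (ContinuousMap.const E (0 : E)) 2 (Finsupp.linearCombination ℤ
        (fun _ => sg (pt 2 (0 : E))) x)) :=
    lhom_eq (f := cmap (ContinuousMap.const E 0) 1) (g := bd 1 ∘ₗ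
      cmap (ContinuousMap.const E (0 : E)) 2 ∘ₗ Finsupp.linearCombination ℤ
        (fun _ => sg (pt 2 (0 : E)))) (fun s => by
      rw [LinearMap.comp_apply, LinearMap.comp_apply, Finsupp.linearCombination_single, one_smul,
        cmap_sg, cmap_sg, bd_sg, Fin.sum_univ_three]
      have : ∀ i : Fin 3, (((ContinuousMap.const E (0 : E)).comp (pt 2 (0 : E))).comp (face i)) =
        (ContinuousMap.const E (0 : E)).comp s := fun i => ContinuousMap.ext fun _ => rfl
      rw [this, this, this]
      simp) x
  refine ⟨prism H 1 x + cmap (ContinuousMap.const E (0 : E)) 2 (Finsupp.linearCombination ℤ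
        (fun _ => sg (pt 2 (0 : E))) x), ?_⟩
  rw [map_add, h, ← h2, h1]
  abel

/-- The chain `z` generates the local homology `H_{n+1}(Y, Y - x)`. -/
def GeneratesAt {X : Type*} [TopologicalSpace X] (n : ℕ) (z : Ch (n + 1) X) (x : X) : Prop :=
  ∀ y : Ch (n + 1) X, bd n y ∈ Cs {{x}ᶜ} n → ∃ (k : ℤ) (w : Ch (n + 2) X) (f : Ch (n + 1) X),
    f ∈ Cs {{x}ᶜ} (n + 1) ∧ y = k • z + bd (n + 1) w + f

/-- On a closed connected surface, a cocycle which vanishes on the fundamental cycle is a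
coboundary. -/
theorem exists_primitive_surface [CompactSpace Y] [PreconnectedSpace Y]
    (hY : HasCharts (ℝ × ℝ) Y) {z : Ch 2 Y} (hz : bd 1 z = 0) {x : Y} (hx : GeneratesAt 1 z x)
    {c : Co 2 Y G} (hc : cb _ c = 0) (hcz : ev c z = 0) : ∃ b, c = cb 1 b := by
  obtain ⟨c', q, h1, h2, h3⟩ := exists_support_singleton hY x c hc
  have h4 : ev c' z = 0 := by
    have := congrArg (fun c => ev c z) h3
    simp only [ev_sub, ev_cb, hz, map_zero, hcz] at this
    simpa using this
  suffices h : ∃ b, c' = cb 1 b by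
    obtain ⟨b, hb⟩ := h
    refine ⟨q + b, ?_⟩
    rw [cb_add, ← h3, ← hb]
    abel
  obtain ⟨ε, hε, p, rfl⟩ := hY x
  set f : C(ℝ × ℝ, Y) := ⟨ε, hε.continuous⟩ with hf
  have hm : Set.MapsTo f {p}ᶜ {ε p}ᶜ := fun v hv h => hv (hε.injective h)
  obtain ⟨e, he⟩ := vanOn_convex (G := G) (convex_univ (𝕜 := ℝ) (E := ℝ × ℝ)) 1 (pull f _ c')
    (AgreeOn.of_eq (by rw [cb_pull, h1]; rfl))
  obtain ⟨g, hg⟩ := exists_primitive_of_cycles (W := {p}ᶜ) (e := e)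
    (isPathConnected_compl_singleton_of_one_lt_rank (by
      rw [rank_prod', Module.rank_self, ← Nat.cast_one, ← Nat.cast_add, Nat.cast_lt]
      norm_num) p) (fun t ht ht0 => by
      -- The period of `e` over `t = ∂T` is the value of `c'` on `T`. Modulo boundaries and chains
      -- missing the point, `T` is a multiple of `z`, and `c'` vanishes on all three kinds of
      -- chains.
      obtain ⟨T, rfl⟩ := exists_bd_of_cycle t ht0
      obtain ⟨k, w, y, hy, hT⟩ := hx (cmap f 2 T) (by
        rw [← cmap_bd]
        exact cmap_mem f hm ht)
      rw [← ev_cb, ← he.eq, ev_pull, hT, map_add, map_add, map_smul, h4, ← ev_cb, h1, h2.ev_eq hy,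
        ev_zero, ev_zero]
      simp)
  obtain ⟨d, hd⟩ := exists_pull_eq (f := f) hε.injective (e - cb _ g)
  obtain ⟨b, hb, -⟩ := exists_primitive_of_eq (c := c') (a := d) (b := 0)
    hε.isOpen_range (isClosed_singleton (x := ε p)).isOpen_compl (AgreeOn.of_eq h1)
    (by
      rw [← Set.image_univ]
      refine agreeOn_image hε.isEmbedding ?_
      rw [← cb_pull]
      change AgreeOn _ (pull f _ c') (cb _ (pull f _ d))
      rw [hd, cb_sub, cb_cb, sub_zero]
      exact he)
    (by rw [cb_zero]; exact h2)
    (by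
      have : Set.range ε ∩ {ε p}ᶜ = ε '' {p}ᶜ := by
        rw [← Set.image_univ, ← Set.diff_eq, ← Set.image_singleton, ← Set.image_diff hε.injective,
          Set.compl_eq_univ_diff]
      rw [this]
      refine agreeOn_image hε.isEmbedding ?_
      change AgreeOn _ (pull f _ d) 0
      rw [hd]
      exact fun s hs => sub_eq_zero.2 (hg s hs))
  refine ⟨b, AgreeOn.eq (hb.mono fun y _ => ?_)⟩
  by_cases h : y = ε p
  · exact Or.inl ⟨p, h.symm⟩
  · exact Or.inr h

end Surface

end Sing

end


/-! ### Translation between elementary chains and singular homology -/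

noncomputable section

namespace Sing

open SingularHomology

/-! ### Comparison with the singular homology of Mathlib -/

section Complexes

variable (K L : ChainComplex (ModuleCat.{u} ℤ) ℕ)

/-- The cycle `x` represents the homology class `h`. -/
def IsRep {K : ChainComplex (ModuleCat.{u} ℤ) ℕ} {n : ℕ} (x : K.X n) (h : K.homology n) : Prop :=
  ∃ c : K.cycles n, (K.iCycles n).hom c = x ∧ (K.homologyπ n).hom c = h

variable {K L}

namespace IsRep

variable {n : ℕ}

theorem exists_rep (h : K.homology n) : ∃ x : K.X n, IsRep x h := by
  obtain ⟨c, rfl⟩ := (ModuleCat.epi_iff_surjective (K.homologyπ n)).1 inferInstance h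
  exact ⟨_, c, rfl, rfl⟩

theorem exists_class {x : K.X (n + 1)} (hx : (K.d (n + 1) n).hom x = 0) :
    ∃ h : K.homology (n + 1), IsRep x h := by
  letI := (LinearMap.ker (K.d (n + 1) n).hom).module
  let A : ModuleCat.{u} ℤ := @ModuleCat.of ℤ _ (LinearMap.ker (K.d (n + 1) n).hom) _
    (LinearMap.ker (K.d (n + 1) n).hom).module
  let f : A ⟶ K.X (n + 1) := ModuleCat.ofHom (LinearMap.ker (K.d (n + 1) n).hom).subtype
  have hf : f ≫ K.d (n + 1) n = 0 := by
    ext a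
    exact a.2
  let c := (K.liftCycles f n (by simp) hf).hom ⟨x, hx⟩
  refine ⟨(K.homologyπ _).hom c, c, ?_, rfl⟩
  have := K.liftCycles_i f n (by simp) hf
  exact congrArg (fun g : A ⟶ K.X (n + 1) => g.hom ⟨x, hx⟩) this

theorem d_eq_zero {x : K.X (n + 1)} {h : K.homology (n + 1)} (hx : IsRep x h) :
    (K.d (n + 1) n).hom x = 0 := by
  obtain ⟨c, rfl, -⟩ := hx
  exact congrArg (fun g : K.cycles (n + 1) ⟶ K.X n => g.hom c) (K.iCycles_d (n + 1) n)

theorem sub {x x' : K.X n} {h h' : K.homology n} (hx : IsRep x h) (hx' : IsRep x' h') :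
    IsRep (x - x') (h - h') := by
  obtain ⟨c, rfl, rfl⟩ := hx
  obtain ⟨c', rfl, rfl⟩ := hx'
  exact ⟨c - c', map_sub _ _ _, map_sub _ _ _⟩

theorem smul {x : K.X n} {h : K.homology n} (k : ℤ) (hx : IsRep x h) : IsRep (k • x) (k • h) := by
  obtain ⟨c, rfl, rfl⟩ := hx
  exact ⟨k • c, map_zsmul _ _ _, map_zsmul _ _ _⟩

theorem map (f : K ⟶ L) {x : K.X n} {h : K.homology n} (hx : IsRep x h) :
    IsRep ((f.f n).hom x) ((HomologicalComplex.homologyMap f n).hom h) := by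
  obtain ⟨c, rfl, rfl⟩ := hx
  refine ⟨(HomologicalComplex.cyclesMap f n).hom c, ?_, ?_⟩
  · exact congrArg (fun g : K.cycles n ⟶ L.X n => g.hom c) (HomologicalComplex.cyclesMap_i f n)
  · exact congrArg (fun g : K.cycles n ⟶ L.homology n => g.hom c)
      (HomologicalComplex.homologyπ_naturality f n).symm

theorem exists_d_eq {x : K.X n} (hx : IsRep x (0 : K.homology n)) :
    ∃ w, (K.d (n + 1) n).hom w = x := by
  obtain ⟨c, rfl, hc⟩ := hx
  have ex := ShortComplex.exact_of_g_is_cokernel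
    (ShortComplex.mk _ _ (K.toCycles_comp_homologyπ (n + 1) n))
    (K.homologyIsCokernel (n + 1) n (by simp))
  obtain ⟨w, hw⟩ := (ShortComplex.moduleCat_exact_iff _).1 ex c hc
  refine ⟨w, ?_⟩
  have := congrArg (fun g : K.X (n + 1) ⟶ K.X n => g.hom w) (K.toCycles_i (n + 1) n)
  rw [← hw]
  exact this.symm

theorem of_d (w : K.X (n + 1)) : IsRep ((K.d (n + 1) n).hom w) (0 : K.homology n) := by
  refine ⟨(K.toCycles (n + 1) n).hom w, ?_, ?_⟩
  · exact congrArg (fun g : K.X (n + 1) ⟶ K.X n => g.hom w) (K.toCycles_i (n + 1) n)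
  · exact congrArg (fun g : K.X (n + 1) ⟶ K.homology n => g.hom w)
      (K.toCycles_comp_homologyπ (n + 1) n)

end IsRep

end Complexes

section Bridge

variable {X Y : Type u} [TopologicalSpace X] [TopologicalSpace Y]

/-- Singular simplices as elements of the singular simplicial set. -/
def tb {n : ℕ} : Simp n X ≃ (sing X) _⦋n⦌ :=
  (TopCat.toSSetObjEquiv (TopCat.of X) (Opposite.op ⦋n⦌)).symm

/-- The map of simplices given on the vertices. -/
theorem map_eq_aff {m n : ℕ} (f : Fin (m + 1) → Fin (n + 1)) (p : Δ m) :
    stdSimplex.map f p = (ConvexLike.aff (vx ∘ f) : C(Δ m, Δ n)) p := by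
  ext i
  change _ = mix (vx ∘ f) p i
  rw [mix_apply, stdSimplex.map_coe, FunOnFinite.linearMap_apply_apply, Finset.sum_filter]
  refine Finset.sum_congr rfl fun j _ => ?_
  rw [Function.comp_apply, vx_apply]
  by_cases h : f j = i
  · rw [if_pos h, if_pos h.symm, mul_one]
  · rw [if_neg h, if_neg (Ne.symm h), mul_zero]

theorem map_tb {m n : ℕ} (f : ⦋m⦌ ⟶ ⦋n⦌) (s : Simp n X) :
    (sing X).map f.op (tb s) = tb (s.comp (ConvexLike.aff (vx ∘ f))) := by
  refine (TopCat.toSSetObjEquiv_symm_naturality (X := TopCat.of X) f s).trans ?_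
  refine congrArg tb (ContinuousMap.ext fun p => ?_)
  exact congrArg s (map_eq_aff f p)

theorem δ_tb {n : ℕ} (i : Fin (n + 2)) (s : Simp (n + 1) X) :
    (sing X).δ i (tb s) = tb (s.comp (face i)) := map_tb (SimplexCategory.δ i) s

theorem addHom_eq {α A : Type*} [AddCommGroup A] {f g : (α →₀ ℤ) →+ A}
    (h : ∀ a, f (sg a) = g (sg a)) (x : α →₀ ℤ) : f x = g x :=
  lhom_eq (f := f.toIntLinearMap) (g := g.toIntLinearMap) h x

/-- The element of the chain complex which is given by a simplex. -/
def gen {n : ℕ} (s : (sing X) _⦋n⦌) : (chains X).X n :=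
  ((sing X).ιChainComplex (R := coeff.{u}) s).hom (ULift.up 1)

/-- The comparison of chains. -/
def ofCh (n : ℕ) : Ch n X →+ (chains X).X n :=
  Finsupp.liftAddHom fun s => zmultiplesHom _ (gen (tb s))

theorem ofCh_sg {n : ℕ} (s : Simp n X) : ofCh n (sg s) = gen (tb s) := by
  simp [ofCh]

/-- The inverse comparison of chains. -/
def toChHom (n : ℕ) : (chains X).X n ⟶ ModuleCat.of ℤ (Ch n X) :=
  ((sing X).isColimitChainComplexXCofan coeff.{u} n).desc (Cofan.mk _ fun s =>
    ModuleCat.ofHom ((LinearMap.toSpanSingleton ℤ (Ch n X) (sg (tb.symm s))).comp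
      (ULift.moduleEquiv : ULift.{u} ℤ ≃ₗ[ℤ] ℤ).toLinearMap))

theorem ι_toChHom {n : ℕ} (s : (sing X) _⦋n⦌) :
    (sing X).ιChainComplex (R := coeff.{u}) s ≫ toChHom n =
      ModuleCat.ofHom ((LinearMap.toSpanSingleton ℤ (Ch n X) (sg (tb.symm s))).comp
      (ULift.moduleEquiv : ULift.{u} ℤ ≃ₗ[ℤ] ℤ).toLinearMap) :=
  ((sing X).isColimitChainComplexXCofan coeff.{u} n).fac _ ⟨s⟩

/-- The inverse comparison of chains. -/
def toCh (n : ℕ) : (chains X).X n →+ Ch n X := (toChHom n).hom.toAddMonoidHom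

theorem toCh_gen {n : ℕ} (s : (sing X) _⦋n⦌) : toCh n (gen s) = sg (tb.symm s) := by
  have := congrArg (fun g => g.hom (ULift.up (1 : ℤ))) (ι_toChHom s)
  refine Eq.trans this ?_
  simp

theorem toCh_ofCh {n : ℕ} (x : Ch n X) : toCh n (ofCh n x) = x := by
  refine addHom_eq (f := (toCh n).comp (ofCh n)) (g := AddMonoidHom.id _) (fun s => ?_) x
  rw [AddMonoidHom.comp_apply, ofCh_sg, toCh_gen, Equiv.symm_apply_apply]
  rfl

theorem coeff_hom_ext {A : ModuleCat.{u} ℤ} {f g : coeff.{u} ⟶ A}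
    (h : f.hom (ULift.up 1) = g.hom (ULift.up 1)) : f = g := by
  ext x
  obtain ⟨k⟩ := x
  have e : (ULift.up k : ULift.{u} ℤ) = k • ULift.up 1 := by
    ext
    simp
  have e' : ∀ f : coeff.{u} ⟶ A, f.hom (ULift.up k) = k • f.hom (ULift.up 1) := fun f =>
    (congrArg f.hom e).trans (map_zsmul f.hom k _)
  exact (e' f).trans ((congrArg (k • ·) h).trans (e' g).symm)

/-- `ofCh` as a morphism. -/
def ofChHom (n : ℕ) : ModuleCat.of ℤ (Ch n X) ⟶ (chains X).X n :=
  ModuleCat.ofHom { toFun := ofCh n, map_add' := map_add _, map_smul' := fun k x =>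
    (map_zsmul (ofCh n) k x).trans (int_smul_eq_zsmul ((chains X).X n).isModule k (ofCh n x)).symm }

theorem ofCh_toCh {n : ℕ} (x : (chains X).X n) : ofCh n (toCh n x) = x := by
  have h : toChHom n ≫ ofChHom n = 𝟙 ((chains X).X n) := by
    apply SSet.chainComplex_hom_ext
    intro s
    refine coeff_hom_ext ?_
    refine (congrArg (ofCh n) (toCh_gen s)).trans ((ofCh_sg _).trans ?_)
    rw [Equiv.apply_symm_apply]
    rfl
  exact congrArg (fun g : (chains X).X n ⟶ (chains X).X n => g.hom x) h

theorem d_ofCh {n : ℕ} (x : Ch (n + 1) X) :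
    ((chains X).d (n + 1) n).hom (ofCh (n + 1) x) = ofCh n (bd n x) := by
  refine addHom_eq (f := ((chains X).d (n + 1) n).hom.toAddMonoidHom.comp (ofCh (n + 1)))
    (g := (ofCh n).comp (bd n).toAddMonoidHom) (fun s => ?_) x
  refine (congrArg ((chains X).d (n + 1) n).hom (ofCh_sg s)).trans ?_
  refine Eq.trans ?_ (congrArg (ofCh n) (bd_sg n s)).symm
  have := congrArg (fun g => g.hom (ULift.up (1 : ℤ)))
    (SSet.ιChainComplex_d (X := sing X) (R := coeff.{u}) (tb s))
  refine Eq.trans this ?_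
  simp only [ModuleCat.hom_sum, LinearMap.sum_apply, map_sum]
  refine Finset.sum_congr rfl fun i _ => ?_
  rw [map_zsmul, ofCh_sg, ← δ_tb]
  rfl

theorem map_ofCh (f : C(X, Y)) {n : ℕ} (x : Ch n X) :
    ((SSet.chainComplexMap (TopCat.toSSet.map (TopCat.ofHom f)) coeff.{u}).f n).hom (ofCh n x) =
      ofCh n (cmap f n x) := by
  refine addHom_eq (f := ((SSet.chainComplexMap (TopCat.toSSet.map (TopCat.ofHom f))
    coeff.{u}).f n).hom.toAddMonoidHom.comp (ofCh n)) (g := (ofCh n).comp (cmap f n).toAddMonoidHom)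
    (fun s => ?_) x
  refine (congrArg ((SSet.chainComplexMap (TopCat.toSSet.map (TopCat.ofHom f))
    coeff.{u}).f n).hom (ofCh_sg s)).trans ?_
  refine Eq.trans ?_ ((congrArg (ofCh n) (cmap_sg f n s)).trans (ofCh_sg _)).symm
  exact congrArg (fun g : coeff.{u} ⟶ (chains Y).X n => g.hom (ULift.up (1 : ℤ)))
    (SSet.ι_chainComplexMap_f (X := sing X) (Y := sing Y) (f := TopCat.toSSet.map (TopCat.ofHom f))
      (R := coeff.{u}) (tb s))

/-- The cycle `z` represents the homology class `h`. -/
def Rep {n : ℕ} (z : Ch n X) (h : H n X) : Prop := IsRep (K := chains X) (ofCh n z) h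

namespace Rep

variable {n : ℕ}

theorem exists_rep (h : H n X) : ∃ z : Ch n X, Rep z h := by
  obtain ⟨x, hx⟩ := IsRep.exists_rep h
  exact ⟨toCh n x, by rwa [Rep, ofCh_toCh]⟩

theorem exists_class {z : Ch (n + 1) X} (hz : bd n z = 0) : ∃ h : H (n + 1) X, Rep z h :=
  IsRep.exists_class (by rw [d_ofCh, hz, map_zero])

theorem bd_eq_zero {z : Ch (n + 1) X} {h : H (n + 1) X} (hz : Rep z h) : bd n z = 0 := by
  have := IsRep.d_eq_zero hz
  rw [d_ofCh] at this
  rw [← toCh_ofCh (bd n z), this, map_zero]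

theorem push {z : Ch n X} {h : H n X} (f : C(X, Y)) (hz : Rep z h) :
    Rep (cmap f n z) (SingularHomology.push n f h) := by
  rw [Rep, ← map_ofCh]
  exact IsRep.map _ hz

theorem exists_bd_eq {z : Ch n X} (hz : Rep z 0) : ∃ w, z = bd n w := by
  obtain ⟨w, hw⟩ := IsRep.exists_d_eq hz
  refine ⟨toCh _ w, ?_⟩
  rw [← ofCh_toCh w, d_ofCh] at hw
  rw [← toCh_ofCh z, ← hw, toCh_ofCh]

end Rep

/-- The cochain on simplices of a cochain on the singular simplicial set. -/
def ofCochain {n : ℕ} (a : Cochain n X) : Co n X ℤ := fun s => a (tb s)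

theorem cb_ofCochain {n : ℕ} (a : Cochain n X) (s : Simp (n + 1) X) :
    cb n (ofCochain a) s = ∑ i : Fin (n + 2), (-1) ^ i.val * a ((sing X).δ i (tb s)) := by
  rw [cb_apply, bd_sg, map_sum]
  refine Finset.sum_congr rfl fun i _ => ?_
  rw [map_smul, ev_sg, δ_tb]
  rfl

theorem isCocycle_iff {n : ℕ} {a : Cochain n X} : IsCocycle a ↔ cb n (ofCochain a) = 0 := by
  constructor
  · intro h
    ext s
    rw [cb_ofCochain]
    exact h _
  · intro h s
    obtain ⟨s, rfl⟩ := tb.surjective s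
    rw [← cb_ofCochain, h]
    rfl

theorem pairing_eq {n : ℕ} (a : Cocycle n X) {z : Ch n X} {h : H n X} (hz : Rep z h) :
    pairing a h = ev (ofCochain a.1) z := by
  have e : (a.1.toHom.hom (ofCh n z)).down = ev (ofCochain a.1) z := by
    refine addHom_eq (f := (ULift.moduleEquiv : ULift.{u} ℤ ≃ₗ[ℤ] ℤ).toLinearMap.toAddMonoidHom.comp
      (a.1.toHom.hom.toAddMonoidHom.comp (ofCh n))) (g := (ev (ofCochain a.1)).toAddMonoidHom)
      (fun s => ?_) z
    refine (congrArg (fun v => (a.1.toHom.hom v).down) (ofCh_sg s)).trans ?_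
    refine Eq.trans ?_ (ev_sg _ s).symm
    have := congrArg (fun g => (g.hom (ULift.up (1 : ℤ))).down) (Cochain.ι_toHom a.1 (tb s))
    refine Eq.trans this ?_
    simp [ofCochain]
  obtain ⟨c, hc, rfl⟩ := hz
  rw [← e, ← hc]
  have h1 : (chains X).homologyπ n ≫ (chains X).homologyι n ≫ (chains X).descOpcycles a.1.toHom
      (n + 1) (by simp) a.2.d_comp_toHom = (chains X).iCycles n ≫ a.1.toHom := by
    simp
  exact congrArg (fun g : (chains X).cycles n ⟶ coeff.{u} => (g.hom c).down) h1

section Local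

variable (x : X)

theorem localChains_surjective (n : ℕ) (y : (localChains X x).X n) :
    ∃ z : Ch n X, (((cokernel.π _ : chains X ⟶ localChains X x).f n).hom (ofCh n z)) = y := by
  have : Epi ((cokernel.π _ : chains X ⟶ localChains X x).f n) := inferInstance
  obtain ⟨v, rfl⟩ := (ModuleCat.epi_iff_surjective _).1 this y
  exact ⟨toCh n v, by rw [ofCh_toCh]⟩

/-- Evaluation in degree `n` is exact, so the kernel of the projection to relative chains is the
image of the chains of the punctured space, that is, the chains supported there. -/
theorem localChains_eq_zero_iff (n : ℕ) (z : Ch n X) :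
    ((cokernel.π _ : chains X ⟶ localChains X x).f n).hom (ofCh n z) = 0 ↔ z ∈ Cs {{x}ᶜ} n := by
  set ι : C({y : X // y ≠ x}, X) := ⟨Subtype.val, continuous_subtype_val⟩ with hι
  have ex := (ShortComplex.exact_cokernel (SSet.chainComplexMap (TopCat.toSSet.map
    (TopCat.ofHom ι)) coeff.{u})).map (HomologicalComplex.eval (ModuleCat.{u} ℤ) _ n)
  have hr : Subtype.val '' (Set.univ : Set {y : X // y ≠ x}) = {x}ᶜ := by
    rw [Set.image_univ]
    exact Subtype.range_val_subtype
  constructor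
  · intro h
    obtain ⟨v, hv⟩ : ∃ v : (chains {y : X // y ≠ x}).X n, ((SSet.chainComplexMap (TopCat.toSSet.map
      (TopCat.ofHom ι)) coeff.{u}).f n).hom v = ofCh n z :=
      (ShortComplex.moduleCat_exact_iff _).1 ex (ofCh n z) h
    have h1 : ofCh n (cmap ι n (toCh n v)) = ofCh n z := by
      rw [← map_ofCh, ofCh_toCh]
      exact hv
    rw [← toCh_ofCh z, ← h1, toCh_ofCh, ← hr]
    exact cmap_mem ι (Set.mapsTo_image _ _) (mem_Cs_univ _)
  · intro h
    rw [← hr] at h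
    obtain ⟨w, -, rfl⟩ := exists_cmap_eq Topology.IsEmbedding.subtypeVal h
    have h1 := cokernel.condition (SSet.chainComplexMap (TopCat.toSSet.map
      (TopCat.ofHom ι)) coeff.{u})
    have h2 := congrArg (fun g : chains {y : X // y ≠ x} ⟶ localChains X x =>
      (g.f n).hom (ofCh n w)) h1
    refine Eq.trans ?_ h2
    refine congrArg _ ?_
    exact (map_ofCh ι w).symm

/-- A class of `H_{n+1}(X, X - x)` is a chain with boundary off `x`, modulo boundaries and chains
off `x`. This form of the condition can be checked by constructing chains. -/
theorem isFundamentalClass_iff {n : ℕ} {z : Ch (n + 1) X} {h : H (n + 1) X} (hz : Rep z h) :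
    IsFundamentalClass (n + 1) h ↔ ∀ x, GeneratesAt n z x := by
  constructor
  · intro hh x y hy
    set π := (cokernel.π _ : chains X ⟶ localChains X x) with hπ
    have comm : ∀ {m : ℕ} (v : Ch (m + 1) X), ((localChains X x).d (m + 1) m).hom
        ((π.f (m + 1)).hom (ofCh _ v)) = (π.f m).hom (ofCh m (bd m v)) := by
      intro m v
      rw [← d_ofCh]
      exact congrArg (fun g => g.hom (ofCh _ v)) (π.comm (m + 1) m)
    obtain ⟨l, hl⟩ := IsRep.exists_class (K := localChains X x)
      (x := (π.f (n + 1)).hom (ofCh _ y)) (by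
        rw [comm]
        exact (localChains_eq_zero_iff x n _).2 hy)
    obtain ⟨k, rfl⟩ := hh x l
    have h1 := hl.sub ((IsRep.map π hz).smul k)
    have h2 : IsRep ((π.f (n + 1)).hom (ofCh _ (y - k • z))) (0 : (localChains X x).homology _) := by
      convert h1 using 1
      · simp only [map_sub, map_zsmul]
      · exact (sub_self _).symm
    obtain ⟨w, hw⟩ := h2.exists_d_eq
    obtain ⟨w, rfl⟩ := localChains_surjective x _ w
    rw [comm] at hw
    refine ⟨k, w, y - k • z - bd _ w, ?_, by abel⟩
    rw [← localChains_eq_zero_iff, map_sub, map_sub, hw, sub_self]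
  · intro hh x l
    set π := (cokernel.π _ : chains X ⟶ localChains X x) with hπ
    have comm : ∀ {m : ℕ} (v : Ch (m + 1) X), ((localChains X x).d (m + 1) m).hom
        ((π.f (m + 1)).hom (ofCh _ v)) = (π.f m).hom (ofCh m (bd m v)) := by
      intro m v
      rw [← d_ofCh]
      exact congrArg (fun g => g.hom (ofCh _ v)) (π.comm (m + 1) m)
    obtain ⟨y, hy⟩ := IsRep.exists_rep l
    obtain ⟨y, rfl⟩ := localChains_surjective x _ y
    have h0 := hy.d_eq_zero
    rw [comm] at h0
    obtain ⟨k, w, f, hf, rfl⟩ := hh x y ((localChains_eq_zero_iff x n _).1 h0)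
    refine ⟨k, sub_eq_zero.1 ?_⟩
    have h1 := hy.sub ((IsRep.map π hz).smul k)
    have h2 : (π.f (n + 1)).hom (ofCh (n + 1) (k • z + bd (n + 1) w + f)) -
        k • (π.f (n + 1)).hom (ofCh (n + 1) z) =
        ((localChains X x).d (n + 2) (n + 1)).hom ((π.f (n + 2)).hom (ofCh _ w)) := by
      rw [comm, map_add, map_add, map_add, map_add, (localChains_eq_zero_iff x _ f).2 hf, map_zsmul,
        map_zsmul]
      abel
    have h3 := h1.sub (IsRep.of_d ((π.f (n + 2)).hom (ofCh _ w)))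
    rw [← h2, sub_self, sub_zero] at h3
    obtain ⟨c, hc, hc'⟩ := h3
    -- The difference of the two classes is represented by the zero chain, and cycles inject into
    -- chains.
    have hc0 : c = 0 := (ModuleCat.mono_iff_injective ((localChains X x).iCycles (n + 1))).1
      inferInstance (hc.trans (map_zero _).symm)
    refine hc'.symm.trans ?_
    rw [hc0]
    exact map_zero _

end Local

end Bridge

end Sing

end


/-! ### Charts of quotients, and three-cycles over a nonorientable surface -/

noncomputable section

namespace Sing

/-! ### Local homeomorphisms and charts -/

section LocalHomeo

variable {E Y Z : Type*} [NormedAddCommGroup E] [NormedSpace ℝ E] [TopologicalSpace Y]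
  [TopologicalSpace Z]

/-- A ball is homeomorphic to the whole of `E` by `univBall`, so charts defined on all of `E` can be
made arbitrarily small. -/
theorem HasCharts.exists_range_subset (h : HasCharts E Y) {y : Y} {U : Set Y} (hU : U ∈ nhds y) :
    ∃ ε : E → Y, Topology.IsOpenEmbedding ε ∧ y ∈ Set.range ε ∧ Set.range ε ⊆ U := by
  obtain ⟨ε, hε, p, rfl⟩ := h y
  obtain ⟨r, hr, hp⟩ := Metric.mem_nhds_iff.1 (hε.continuous.continuousAt.preimage_mem_nhds hU)
  have hb : Topology.IsOpenEmbedding (OpenPartialHomeomorph.univBall p r) :=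
    OpenPartialHomeomorph.to_isOpenEmbedding _ (OpenPartialHomeomorph.univBall_source p r)
  refine ⟨ε ∘ OpenPartialHomeomorph.univBall p r, hε.comp hb,
    ⟨0, by simp [OpenPartialHomeomorph.univBall_apply_zero]⟩, ?_⟩
  rintro _ ⟨v, rfl⟩
  refine hp ?_
  rw [← OpenPartialHomeomorph.univBall_target p hr]
  exact (OpenPartialHomeomorph.univBall p r).map_source
    (by rw [OpenPartialHomeomorph.univBall_source]; trivial)

theorem HasCharts.of_isOpenQuotientMap (h : HasCharts E Y) {q : Y → Z} (hq : IsOpenQuotientMap q)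
    (hi : ∀ y, ∃ U ∈ nhds y, Set.InjOn q U) : HasCharts E Z := by
  intro z
  obtain ⟨y, rfl⟩ := hq.surjective z
  obtain ⟨U, hU, hi⟩ := hi y
  obtain ⟨ε, hε, ⟨p, rfl⟩, hr⟩ := h.exists_range_subset hU
  refine ⟨q ∘ ε, .of_continuous_injective_isOpenMap (hq.continuous.comp hε.continuous) ?_
    (hq.isOpenMap.comp hε.isOpenMap), p, rfl⟩
  exact fun v w hvw => hε.injective (hi (hr ⟨v, rfl⟩) (hr ⟨w, rfl⟩) hvw)

theorem HasCharts.of_isOpenEmbedding (h : HasCharts E Z) {i : Y → Z}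
    (hi : Topology.IsOpenEmbedding i) : HasCharts E Y := by
  intro y
  obtain ⟨ε, hε, ⟨p, hp⟩, hr⟩ := h.exists_range_subset (hi.isOpen_range.mem_nhds ⟨y, rfl⟩)
  have hj : ∀ v, i (hi.isEmbedding.toHomeomorph.symm ⟨ε v, hr ⟨v, rfl⟩⟩) = ε v := fun v =>
    congrArg Subtype.val (hi.isEmbedding.toHomeomorph.apply_symm_apply ⟨ε v, hr ⟨v, rfl⟩⟩)
  refine ⟨fun v => hi.isEmbedding.toHomeomorph.symm ⟨ε v, hr ⟨v, rfl⟩⟩, ?_, p, ?_⟩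
  · refine Topology.IsOpenEmbedding.of_comp _ hi ?_
    have : (i ∘ fun v => hi.isEmbedding.toHomeomorph.symm ⟨ε v, hr ⟨v, rfl⟩⟩) = ε := funext hj
    rw [this]
    exact hε
  · exact hi.injective ((hj p).trans hp)

theorem hasCharts_of_chartedSpace [ChartedSpace E Y] : HasCharts E Y := by
  intro y
  set e := chartAt E y
  obtain ⟨r, hr, hp⟩ := Metric.isOpen_iff.1 e.open_target (e y) (mem_chart_target E y)
  set b := OpenPartialHomeomorph.univBall (e y) r with hb
  have hs : (b.trans e.symm).source = Set.univ := by
    rw [OpenPartialHomeomorph.trans_source, hb, OpenPartialHomeomorph.univBall_source,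
      Set.univ_inter, Set.eq_univ_iff_forall]
    intro v
    refine hp ?_
    rw [← OpenPartialHomeomorph.univBall_target (e y) hr]
    exact (OpenPartialHomeomorph.univBall (e y) r).map_source
      (by rw [OpenPartialHomeomorph.univBall_source]; trivial)
  refine ⟨b.trans e.symm, OpenPartialHomeomorph.to_isOpenEmbedding _ hs, 0, ?_⟩
  change e.symm (b 0) = y
  rw [hb, OpenPartialHomeomorph.univBall_apply_zero]
  exact e.left_inv (mem_chart_source E y)

theorem HasCharts.comp_homeomorph {E' : Type*} [TopologicalSpace E'] (h : HasCharts E Y)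
    (e : E' ≃ₜ E) : HasCharts E' Y := fun y => by
  obtain ⟨ε, hε, p, rfl⟩ := h y
  exact ⟨ε ∘ e, hε.comp e.isOpenEmbedding, e.symm p, by simp⟩

theorem hasCharts_surface [ChartedSpace (EuclideanSpace ℝ (Fin 2)) Y] : HasCharts (ℝ × ℝ) Y :=
  (hasCharts_of_chartedSpace (E := EuclideanSpace ℝ (Fin 2))).comp_homeomorph
    (ContinuousLinearEquiv.ofFinrankEq (𝕜 := ℝ) (E := ℝ × ℝ) (F := EuclideanSpace ℝ (Fin 2))
      (by simp)).toHomeomorph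

end LocalHomeo

/-! ### The quotient by a free involution -/

section Involution

variable {S : Type*} [TopologicalSpace S]

/-- The orbits of an involution. -/
def orbitSetoid {φ : S → S} (hφ : Function.Involutive φ) : Setoid S where
  r s t := t = s ∨ t = φ s
  iseqv := by
    refine ⟨fun s => Or.inl rfl, ?_, ?_⟩
    · rintro s t (rfl | rfl)
      exacts [Or.inl rfl, Or.inr (hφ s).symm]
    · rintro s t r (rfl | rfl) (rfl | rfl)
      exacts [Or.inl rfl, Or.inr rfl, Or.inr rfl, Or.inl (hφ s)]

theorem orbit_eq_iff {φ : S → S} (hφ : Function.Involutive φ) {s t : S} :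
    (Quotient.mk (orbitSetoid hφ) s = Quotient.mk (orbitSetoid hφ) t) ↔ t = s ∨ t = φ s :=
  Quotient.eq

theorem isOpenQuotientMap_orbit {φ : S → S} (hφ : Function.Involutive φ) (hc : Continuous φ) :
    IsOpenQuotientMap (Quotient.mk (orbitSetoid hφ)) := by
  refine ⟨Quotient.mk_surjective, continuous_quotient_mk', fun U hU => ?_⟩
  rw [← isQuotientMap_quotient_mk'.isOpen_preimage]
  convert hU.union (hU.preimage hc) using 1
  ext s
  constructor
  · rintro ⟨t, ht, h⟩
    rcases (orbit_eq_iff hφ).1 h with rfl | rfl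
    · exact Or.inl ht
    · exact Or.inr (by rwa [Set.mem_preimage, hφ])
  · rintro (h | h)
    · exact ⟨s, h, rfl⟩
    · exact ⟨φ s, h, (orbit_eq_iff hφ).2 (Or.inr (hφ s).symm)⟩

/-- For an open quotient map, being Hausdorff means that the relation is closed. Here the relation
is the union of the diagonal and the graph of `φ`. -/
theorem t2Space_orbit [T2Space S] {φ : S → S} (hφ : Function.Involutive φ) (hc : Continuous φ) :
    T2Space (Quotient (orbitSetoid hφ)) := by
  rw [t2Space_iff_of_isOpenQuotientMap (isOpenQuotientMap_orbit hφ hc)]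
  convert (isClosed_eq (continuous_snd (X := S) (Y := S)) continuous_fst).union
    (isClosed_eq continuous_snd (hc.comp continuous_fst)) using 1
  exact Set.ext fun p => orbit_eq_iff hφ

theorem exists_disjoint_nhds [T2Space S] {φ : S → S} (hc : Continuous φ) (hf : ∀ s, φ s ≠ s)
    (s : S) : ∃ U ∈ nhds s, ∀ t ∈ U, φ t ∉ U := by
  obtain ⟨A, B, hA, hB, h1, h2, h3⟩ := t2_separation (hf s)
  exact ⟨B ∩ φ ⁻¹' A, Filter.inter_mem (hB.mem_nhds h2) ((hA.preimage hc).mem_nhds h1),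
    fun t ht ht' => Set.disjoint_left.1 h3 ht.2 ht'.1⟩

theorem exists_injOn_orbit [T2Space S] {φ : S → S} (hφ : Function.Involutive φ)
    (hc : Continuous φ) (hf : ∀ s, φ s ≠ s) (s : S) :
    ∃ U ∈ nhds s, Set.InjOn (Quotient.mk (orbitSetoid hφ)) U := by
  obtain ⟨U, hU, h⟩ := exists_disjoint_nhds hc hf s
  refine ⟨U, hU, fun a ha b hb hab => ?_⟩
  rcases (orbit_eq_iff hφ).1 hab with rfl | rfl
  · rfl
  · exact absurd hb (h a ha)

end Involution

/-! ### Cycles in the product with a punctured plane -/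

section Punctured

variable {S B : Type*} [TopologicalSpace S] [TopologicalSpace B]

/-- A cocycle of `B` with values in `ℚ/ℤ` becomes a coboundary in the orientation covering. -/
theorem exists_primitive_pull [T2Space S] [CompactSpace S] [PreconnectedSpace S]
    (hS : HasCharts (ℝ × ℝ) S) (hB : ∀ (G : Type) [AddCommGroup G], VanOn G 2 (Set.univ : Set B))
    (q : C(S, B)) {z : Ch 2 S} (hz : bd 1 z = 0) {x : S} (hx : GeneratesAt 1 z x) {w : Ch 3 B}
    (hw : cmap q 2 z + cmap q 2 z = bd 2 w) {d : Co 2 B (AddCircle (1 : ℚ))} (hd : cb _ d = 0) :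
    ∃ b, pull q 2 d = cb 1 b := by
  -- The aim is to write `d = 2 d'` with `d'` closed. Divisibility of `ℚ/ℤ` gives a half `d₀` of `d`
  -- pointwise; its coboundary takes values in the 2-torsion `T`, and `H³(B; T) = 0` supplies the
  -- correction.
  set T := (nsmulAddMonoidHom 2 : AddCircle (1 : ℚ) →+ AddCircle (1 : ℚ)).ker with hT
  have hdiv : ∀ a : AddCircle (1 : ℚ), ∃ b, b + b = a := fun a =>
    ⟨DivisibleBy.div a (2 : ℤ), by
      rw [← two_zsmul]
      exact DivisibleBy.div_cancel a (by norm_num)⟩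
  choose half hhalf using hdiv
  set d₀ : Co 2 B (AddCircle (1 : ℚ)) := fun s => half (d s) with hd₀
  have h₀ : d₀ + d₀ = d := funext fun s => hhalf _
  have hT₀ : ∀ s, cb _ d₀ s ∈ T := by
    intro s
    have : cb _ d₀ s + cb _ d₀ s = 0 := by
      have := congrFun (cb_add 2 d₀ d₀) s
      rw [h₀, hd] at this
      exact this.symm
    rw [hT, AddMonoidHom.mem_ker]
    simpa [two_nsmul] using this
  have evT : ∀ {n : ℕ} (c : Co n B T) (y : Ch n B),
      ((ev c y : T) : AddCircle (1 : ℚ)) = ev (fun s => (c s : AddCircle (1 : ℚ))) y := by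
    intro n c y
    exact lhom_eq (f := T.subtype.toIntLinearMap ∘ₗ ev c) (g := ev fun s => (c s : AddCircle (1 : ℚ)))
      (fun s => by simp) y
  obtain ⟨e, he⟩ := hB T (fun s => ⟨cb _ d₀ s, hT₀ s⟩) (fun s _ => Subtype.ext (by
    rw [cb_apply, evT]
    exact congrFun (cb_cb _ d₀) s))
  set d' : Co 2 B (AddCircle (1 : ℚ)) := d₀ - fun s => (e s : AddCircle (1 : ℚ)) with hd'
  have hd'c : cb _ d' = 0 := by
    rw [hd', cb_sub, sub_eq_zero]
    funext s
    have := congrArg Subtype.val (he s (Set.subset_univ _))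
    rw [cb_apply, evT] at this
    exact this
  have h2 : d' + d' = d := by
    rw [← h₀]
    funext s
    have : (e s : AddCircle (1 : ℚ)) + e s = 0 := by
      have := AddMonoidHom.mem_ker.1 (e s).2
      simpa [two_nsmul] using this
    simp only [hd', Pi.add_apply, Pi.sub_apply]
    rw [sub_add_sub_comm, this, sub_zero]
  -- The value of `d = 2 d'` on `q_* z` is the value of the cocycle `d'` on `2 q_* z`, which is a
  -- boundary.
  refine exists_primitive_surface hS hz hx (by rw [cb_pull, hd]; rfl) ?_
  rw [ev_pull, ← h2, ev_add, ← map_add, hw, ← ev_cb, hd'c, ev_zero]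

variable {G : Type*} [AddCommGroup G]

/-- The map `id × q`. -/
abbrev idProd (q : C(S, B)) : C(ℂ × S, ℂ × B) := (ContinuousMap.id ℂ).prodMap q

/-- Contracting `P` shows that, up to a coboundary, the pullback of `c` to `P × S` comes from the
slice over a point of `P`, where the hypothesis on `q` applies. -/
theorem exists_primitive_convex (q : C(S, B))
    (hq : ∀ d : Co 2 B G, cb _ d = 0 → ∃ b, pull q 2 d = cb 1 b) {P : Set ℂ} (hP : Convex ℝ P)
    (hP' : P.Nonempty) {c : Co 2 (ℂ × B) G} (hc : AgreeOn (P ×ˢ Set.univ) (cb _ c) 0) :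
    ∃ b, AgreeOn (P ×ˢ Set.univ) (pull (idProd q) 2 c) (cb 1 b) := by
  obtain ⟨p, hp⟩ := hP'
  have hm : Set.MapsTo (idProd q) (P ×ˢ Set.univ) (P ×ˢ Set.univ) := fun x hx => ⟨hx.1, trivial⟩
  have hc' : AgreeOn (P ×ˢ Set.univ) (cb _ (pull (idProd q) 2 c)) 0 := by
    rw [cb_pull]
    exact hc.pull hm
  obtain ⟨b, hb⟩ := exists_primitive_of_homotopy (contraction p S) (A := P ×ˢ Set.univ)
    (contraction_mem (hP.starConvex hp)) hc'
  set i : C(B, ℂ × B) := (ContinuousMap.const B p).prodMk (ContinuousMap.id B) with hi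
  obtain ⟨f, hf⟩ := hq (pull i 2 c) (by
    rw [cb_pull]
    exact AgreeOn.eq (hc.pull fun _ _ => ⟨hp, trivial⟩))
  refine ⟨b + pull ContinuousMap.snd 1 f, fun s hs => ?_⟩
  have h1 := hb s hs
  have h2 := congrFun hf ((ContinuousMap.snd : C(ℂ × S, S)).comp s)
  rw [cb_add, cb_pull, Pi.add_apply, ← h1, pull_apply ContinuousMap.snd, ← h2]
  simp only [Pi.sub_apply, pull_apply]
  rw [ContinuousMap.id_comp]
  exact (sub_add_cancel _ _).symm

/-- Mayer–Vietoris for `ℂ*` covered by two slit planes, which are star-shaped and meet in two convex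
half-planes. Over each slit plane `H³(B) = 0` gives a primitive. The difference of the primitives is
a class in degree two over the half-planes, and it dies after pullback to `S`. -/
theorem exists_primitive_punctured (hB : VanOn G 2 (Set.univ : Set B)) (q : C(S, B))
    (hq : ∀ d : Co 2 B G, cb _ d = 0 → ∃ b, pull q 2 d = cb 1 b) {c : Co 3 (ℂ × B) G}
    (hc : AgreeOn ({0}ᶜ ×ˢ Set.univ) (cb _ c) 0) :
    ∃ b, AgreeOn ({0}ᶜ ×ˢ Set.univ) (pull (idProd q) 3 c) (cb 2 b) := by
  set P : Set ℂ := Complex.slitPlane with hPd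
  set P' : Set ℂ := Neg.neg ⁻¹' Complex.slitPlane with hPd'
  have hP : StarConvex ℝ 1 P := Complex.starConvex_one_slitPlane
  have hP' : StarConvex ℝ (-1) P' := by
    intro y hy a b ha hb hab
    have := hP hy ha hb hab
    change -(a • (-1 : ℂ) + b • y) ∈ P
    convert this using 1
    simp
    ring
  have hPo : IsOpen P := Complex.isOpen_slitPlane
  have hPo' : IsOpen P' := Complex.isOpen_slitPlane.preimage continuous_neg
  have hu : ({0}ᶜ : Set ℂ) = P ∪ P' := by
    ext w
    simp only [hPd, hPd', Set.mem_compl_iff, Set.mem_singleton_iff, Set.mem_union,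
      Set.mem_preimage, Complex.mem_slitPlane_iff, Complex.neg_re, Complex.neg_im, Complex.ext_iff,
      Complex.zero_re, Complex.zero_im, neg_ne_zero]
    constructor
    · intro h
      by_contra! h'
      exact h ⟨le_antisymm h'.1.1 (by linarith [h'.2.1]), h'.1.2⟩
    · rintro ((h | h) | (h | h)) ⟨h1, h2⟩
      exacts [by linarith, h h2, by linarith, h h2]
  have hi : P ∩ P' = {w | 0 < w.im} ∪ {w | w.im < 0} := by
    ext w
    simp only [hPd, hPd', Set.mem_inter_iff, Set.mem_union, Set.mem_setOf_eq,
      Set.mem_preimage, Complex.mem_slitPlane_iff, Complex.neg_re, Complex.neg_im, neg_ne_zero]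
    constructor
    · rintro ⟨h1 | h1, h2 | h2⟩
      · linarith
      all_goals
        rcases lt_or_gt_of_ne ‹w.im ≠ 0› with h | h
        exacts [Or.inr h, Or.inl h]
    · rintro (h | h)
      exacts [⟨Or.inr h.ne', Or.inr h.ne'⟩, ⟨Or.inr h.ne, Or.inr h.ne⟩]
  rw [hu, Set.union_prod] at hc ⊢
  obtain ⟨a, ha⟩ := vanOn_prod hP (show (1 : ℂ) ∈ P by simp [hPd]) hB c
    (hc.mono Set.subset_union_left)
  obtain ⟨a', ha'⟩ := vanOn_prod hP' (show (-1 : ℂ) ∈ P' by simp [hPd']) hB c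
    (hc.mono Set.subset_union_right)
  have hd : AgreeOn ((P ∩ P') ×ˢ Set.univ) (cb _ (a - a')) 0 :=
    (ha.mono (Set.prod_mono_left Set.inter_subset_left)).cocycle_of_sub
      (ha'.mono (Set.prod_mono_left Set.inter_subset_right))
  have hm : ∀ Q : Set ℂ, Set.MapsTo (idProd q) (Q ×ˢ Set.univ) (Q ×ˢ Set.univ) :=
    fun Q x hx => ⟨hx.1, trivial⟩
  have hPB : ∀ {Q : Set ℂ}, IsOpen Q → IsOpen (Q ×ˢ (Set.univ : Set S)) :=
    fun h => h.prod isOpen_univ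
  have hU : IsOpen (setOf fun w : ℂ => 0 < w.im) := isOpen_lt continuous_const Complex.continuous_im
  have hL : IsOpen (setOf fun w : ℂ => w.im < 0) := isOpen_lt Complex.continuous_im continuous_const
  rw [hi] at hd
  obtain ⟨f, hf⟩ := exists_primitive_convex q hq (convex_halfSpace_im_gt 0)
    ⟨Complex.I, by simp⟩ (hd.mono (Set.prod_mono_left Set.subset_union_left))
  obtain ⟨f', hf'⟩ := exists_primitive_convex q hq (convex_halfSpace_im_lt 0)
    ⟨-Complex.I, by simp⟩ (hd.mono (Set.prod_mono_left Set.subset_union_right))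
  obtain ⟨g, hg, -, -⟩ := exists_primitive_of_eq (hPB hU) (hPB hL)
    (c := pull (idProd q) 2 (a - a')) (by
      rw [cb_pull, ← Set.union_prod]
      exact hd.pull (hm _)) hf hf' (fun s hs => by
      have h1 : 0 < (s (vx 0)).1.im := (hs ⟨vx 0, rfl⟩).1.1
      have h2 : (s (vx 0)).1.im < 0 := (hs ⟨vx 0, rfl⟩).2.1
      exact absurd h1 (lt_asymm h2))
  obtain ⟨b, hb, -⟩ := exists_primitive_of_cohomologous (hPB hPo) (hPB hPo')
    (c := pull (idProd q) 3 c) (a := pull (idProd q) 2 a) (b := pull (idProd q) 2 a') (e := g)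
    (by
      rw [cb_pull, ← Set.union_prod]
      rw [← Set.union_prod] at hc
      exact hc.pull (hm _))
    (by rw [cb_pull]; exact ha.pull (hm _)) (by rw [cb_pull]; exact ha'.pull (hm _))
    (by
      rw [Set.prod_inter_prod, Set.univ_inter, hi, Set.union_prod]
      exact hg)
  exact ⟨b, hb⟩

/-- The image of a 3-cycle under the orientation covering is a boundary. -/
theorem exists_bd_punctured [T2Space S] [CompactSpace S] [PreconnectedSpace S]
    (hS : HasCharts (ℝ × ℝ) S) (hB : ∀ (G : Type) [AddCommGroup G], VanOn G 2 (Set.univ : Set B))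
    (q : C(S, B)) {z : Ch 2 S} (hz : bd 1 z = 0) {x : S} (hx : GeneratesAt 1 z x) {w : Ch 3 B}
    (hw : cmap q 2 z + cmap q 2 z = bd 2 w) {θ : Ch 3 (ℂ × S)}
    (hθ : θ ∈ Cs {{0}ᶜ ×ˢ Set.univ} 3) (hθ' : bd 2 θ = 0) :
    ∃ e ∈ Cs {{0}ᶜ ×ˢ Set.univ} 4, bd 3 e = cmap (idProd q) 3 θ := by
  by_contra h
  -- Characters with values in `ℚ/ℤ` separate the points of the quotient by the boundaries `N`. A
  -- character that kills `N` is a cocycle; its pullback is a coboundary and hence vanishes on the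
  -- cycle `θ`, a contradiction.
  set N := (Cs {({0}ᶜ ×ˢ Set.univ : Set (ℂ × B))} 4).map (bd 3) with hN
  have hne : N.mkQ (cmap (idProd q) 3 θ) ≠ 0 := by
    intro h0
    rw [Submodule.mkQ_apply, Submodule.Quotient.mk_eq_zero] at h0
    exact h h0
  obtain ⟨χ, hχ⟩ := CharacterModule.exists_character_apply_ne_zero_of_ne_zero hne
  set c : Co 3 (ℂ × B) (AddCircle (1 : ℚ)) := fun s => χ (N.mkQ (sg s)) with hc
  have hev : ∀ y, ev c y = χ (N.mkQ y) :=
    lhom_eq (f := ev c) (g := (χ : _ →+ _).toIntLinearMap ∘ₗ N.mkQ) (fun s => ev_sg _ _)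
  obtain ⟨b, hb⟩ := exists_primitive_punctured (hB _) q (fun d hd =>
    exists_primitive_pull hS hB q hz hx hw hd) (c := c) (fun s hs => by
      rw [cb_apply, hev]
      have : N.mkQ (bd 3 (sg s)) = 0 := by
        rw [Submodule.mkQ_apply, Submodule.Quotient.mk_eq_zero]
        exact ⟨sg s, sg_mem_Cs rfl hs, rfl⟩
      rw [this, map_zero]
      rfl)
  apply hχ
  rw [← hev, ← ev_pull, hb.ev_eq hθ, ev_cb, hθ', map_zero]

end Punctured

end Sing

end


/-! ### Excision, propagation of local generators, and cup products -/

noncomputable section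

namespace Sing

/-! ### Generators of the local homology -/

section Generators

variable {X Y O M : Type*} [TopologicalSpace X] [TopologicalSpace Y] [TopologicalSpace O]
  [TopologicalSpace M]

/-- The chains which are sums of boundaries and of chains in `W`. -/
def Rel (W : Set X) (n : ℕ) : Submodule ℤ (Ch (n + 1) X) :=
  LinearMap.range (bd (n + 1)) ⊔ Cs {W} (n + 1)

variable {n : ℕ} {V W : Set X}

theorem bd_mem_Rel (W : Set X) (w : Ch (n + 2) X) : bd (n + 1) w ∈ Rel W n :=
  Submodule.mem_sup_left ⟨w, rfl⟩

theorem mem_Rel_of_mem {x : Ch (n + 1) X} (h : x ∈ Cs {W} (n + 1)) : x ∈ Rel W n :=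
  Submodule.mem_sup_right h

theorem mem_Rel_iff {x : Ch (n + 1) X} :
    x ∈ Rel W n ↔ ∃ w, ∃ f ∈ Cs {W} (n + 1), x = bd (n + 1) w + f := by
  rw [Rel, Submodule.mem_sup]
  constructor
  · rintro ⟨_, ⟨w, rfl⟩, f, hf, rfl⟩
    exact ⟨w, f, hf, rfl⟩
  · rintro ⟨w, f, hf, rfl⟩
    exact ⟨_, ⟨w, rfl⟩, f, hf, rfl⟩

theorem Cs_singleton_mono (h : V ⊆ W) (n : ℕ) : Cs {V} n ≤ Cs {W} n :=
  Cs_mono (by rintro _ rfl; exact ⟨W, rfl, h⟩) n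

theorem Rel_mono (h : V ⊆ W) (n : ℕ) : Rel V n ≤ Rel W n :=
  sup_le_sup_left (Cs_singleton_mono h _) _

theorem cmap_mem_Rel (f : C(X, Y)) {W' : Set Y} (hf : Set.MapsTo f W W') {x : Ch (n + 1) X}
    (hx : x ∈ Rel W n) : cmap f (n + 1) x ∈ Rel W' n := by
  obtain ⟨w, y, hy, rfl⟩ := mem_Rel_iff.1 hx
  rw [map_add, cmap_bd]
  exact Submodule.add_mem _ (bd_mem_Rel _ _) (mem_Rel_of_mem (cmap_mem f hf hy))

theorem generatesAt_iff {z : Ch (n + 1) X} {x : X} :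
    GeneratesAt n z x ↔ ∀ y, bd n y ∈ Cs {{x}ᶜ} n → ∃ k : ℤ, y - k • z ∈ Rel {x}ᶜ n := by
  refine forall_congr' fun y => imp_congr_right fun _ => exists_congr fun k => ?_
  rw [mem_Rel_iff]
  constructor
  · rintro ⟨w, f, hf, rfl⟩
    exact ⟨w, f, hf, by abel⟩
  · rintro ⟨w, f, hf, h⟩
    exact ⟨w, f, hf, by rw [add_assoc, ← h]; abel⟩

/-- Excision on chains: split `toSmall x` into its parts in `A` and in `B`. Since `toSmall` does not
enlarge supports, the part `a` also stays in `P`; this is needed when `x` already avoids a point. -/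
theorem exists_excise {A B P : Set X} (hA : IsOpen A) (hB : IsOpen B) (hAB : A ∪ B = Set.univ)
    {x : Ch (n + 1) X} (hx : x ∈ Cs {P} (n + 1)) (hb : bd n x ∈ Cs {B} n) :
    ∃ a ∈ Cs {A ∩ P} (n + 1), x - a ∈ Rel B n ∧ bd n a ∈ Cs {B} n := by
  have h1 : toSmall A B n x ∈ Cs {A ∩ P, B ∩ P} (n + 1) := by
    have h2 := toSmall_mem (A := A) (B := B) (n := n) (x := x) hA hB
      (by rw [hAB]; exact mem_Cs_univ x)
    have h3 := (isLocal_toSmall A B n).mem hx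
    intro s hs
    obtain ⟨_, rfl, h5⟩ := h3 hs
    obtain ⟨_, rfl | rfl, h6⟩ := h2 hs
    · exact ⟨_, Or.inl rfl, Set.subset_inter h6 h5⟩
    · exact ⟨_, Or.inr rfl, Set.subset_inter h6 h5⟩
  obtain ⟨a, ha, b, hb', hab⟩ := exists_add_of_mem_Cs h1
  have hbB := Cs_singleton_mono (Set.inter_subset_left (s := B) (t := P)) _ hb'
  have h4 := (isLocal_smallHtpy A B n).mem hb
  rw [toSmall_apply] at hab
  refine ⟨a, ha, ?_, ?_⟩
  · have : x - a = bd (n + 1) (smallHtpy A B (n + 1) x) + (smallHtpy A B n (bd n x) + b) := by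
      calc x - a = x - (bd (n + 1) (smallHtpy A B (n + 1) x) + smallHtpy A B n (bd n x)) - a +
            (bd (n + 1) (smallHtpy A B (n + 1) x) + smallHtpy A B n (bd n x)) := by abel
        _ = _ := by
          rw [← sub_sub, hab]
          abel
    rw [this]
    exact Submodule.add_mem _ (bd_mem_Rel _ _) (mem_Rel_of_mem (Submodule.add_mem _ h4 hbB))
  · have : bd n a = bd n x - bd n (smallHtpy A B n (bd n x)) - bd n b := by
      have := congrArg (bd n) hab
      rw [map_sub, map_sub, bd_bd, map_add, sub_zero] at this
      rw [this]
      abel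
    rw [this]
    exact Submodule.sub_mem _ (Submodule.sub_mem _ hb ((isLocal_bd n).mem h4))
      ((isLocal_bd n).mem hbB)

theorem preimage_compl_singleton {f : X → Y} (hf : Function.Injective f) (x : X) :
    f ⁻¹' {f x}ᶜ = {x}ᶜ := by
  ext y
  simp [hf.eq_iff]

theorem range_union_compl_singleton (f : X → Y) (x : X) : Set.range f ∪ {f x}ᶜ = Set.univ := by
  rw [Set.eq_univ_iff_forall]
  intro y
  by_cases h : y = f x
  · exact Or.inl ⟨x, h.symm⟩
  · exact Or.inr h

/-- The injectivity half of excision. Make the bounding chain `w` small and keep its part in `O`;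
the boundary of `w` is small already, so `toSmall` does not alter it. -/
theorem mem_Rel_of_cmap [T1Space M] {i : O → M} (hi : Topology.IsOpenEmbedding i) {o : O}
    {x : Ch (n + 1) O} (hx : cmap ⟨i, hi.continuous⟩ (n + 1) x ∈ Rel {i o}ᶜ n) :
    x ∈ Rel {o}ᶜ n := by
  set f : C(O, M) := ⟨i, hi.continuous⟩ with hf
  have hB : IsOpen ({i o}ᶜ : Set M) := isOpen_compl_singleton
  obtain ⟨w, g, hg, h⟩ := mem_Rel_iff.1 hx
  obtain ⟨a, ha, b, hb, hab⟩ := exists_add_of_mem_Cs (toSmall_mem (n := n + 1) (x := w)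
    hi.isOpen_range hB (by rw [range_union_compl_singleton]; exact mem_Cs_univ w))
  rw [← Set.image_univ] at ha
  obtain ⟨v, -, rfl⟩ := exists_cmap_eq hi.isEmbedding ha
  have hr : cmap f (n + 1) x ∈ Cs {Set.range i} (n + 1) :=
    cmap_mem f (A := Set.univ) (fun y _ => Set.mem_range_self (f := i) y) (mem_Cs_univ x)
  have h1 : cmap f (n + 1) x - g ∈ Cs {Set.range i, {i o}ᶜ} (n + 1) :=
    Submodule.sub_mem _
      (Cs_mono (by rintro _ rfl; exact ⟨_, Or.inl rfl, subset_rfl⟩) _ hr)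
      (Cs_mono (by rintro _ rfl; exact ⟨_, Or.inr rfl, subset_rfl⟩) _ hg)
  have h2 : bd (n + 1) w = cmap f (n + 1) x - g := by rw [h]; abel
  have h3 := congrArg (bd (n + 1)) hab
  rw [bd_toSmall, h2, toSmall_of_small h1, map_add] at h3
  have h4 : cmap f (n + 1) (x - bd (n + 1) v) ∈ Cs {{i o}ᶜ} (n + 1) := by
    have : cmap f (n + 1) (x - bd (n + 1) v) = g + bd (n + 1) b := by
      rw [map_sub, cmap_bd]
      rw [sub_eq_iff_eq_add] at h3 ⊢
      rw [h3]
      abel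
    rw [this]
    exact Submodule.add_mem _ hg ((isLocal_bd _).mem hb)
  have h5 := mem_Cs_of_cmap (f := f) hi.injective h4
  rw [show f ⁻¹' {i o}ᶜ = {o}ᶜ from preimage_compl_singleton hi.injective o] at h5
  have h6 := Submodule.add_mem _ (bd_mem_Rel {o}ᶜ v) (mem_Rel_of_mem h5)
  rwa [add_sub_cancel] at h6

/-- Local generators are determined in a neighbourhood. -/
theorem GeneratesAt.transfer [T1Space M] [T1Space X] {i : O → M} (hi : Topology.IsOpenEmbedding i)
    {κ : O → X} (hκ : Topology.IsOpenEmbedding κ) {o : O} {zM : Ch (n + 1) M} {zX : Ch (n + 1) X}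
    {c : Ch (n + 1) O} (hM : zM - cmap ⟨i, hi.continuous⟩ _ c ∈ Rel {i o}ᶜ n)
    (hX : zX - cmap ⟨κ, hκ.continuous⟩ _ c ∈ Rel {κ o}ᶜ n) (h : GeneratesAt n zM (i o)) :
    GeneratesAt n zX (κ o) := by
  rw [generatesAt_iff] at h ⊢
  intro y hy
  obtain ⟨a, ha, h1, h2⟩ := exists_excise hκ.isOpen_range (isOpen_compl_singleton (x := κ o))
    (range_union_compl_singleton κ o) (mem_Cs_univ y) hy
  rw [Set.inter_univ, ← Set.image_univ] at ha
  obtain ⟨a, -, rfl⟩ := exists_cmap_eq hκ.isEmbedding ha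
  set f : C(O, M) := ⟨i, hi.continuous⟩ with hf
  set g : C(O, X) := ⟨κ, hκ.continuous⟩ with hg
  rw [← cmap_bd] at h2
  have h3 := mem_Cs_of_cmap (f := g) hκ.injective h2
  rw [show g ⁻¹' {κ o}ᶜ = {o}ᶜ from preimage_compl_singleton hκ.injective o] at h3
  have hm : Set.MapsTo f {o}ᶜ {i o}ᶜ := fun v hv h => hv (hi.injective h)
  have hm' : Set.MapsTo g {o}ᶜ {κ o}ᶜ := fun v hv h => hv (hκ.injective h)
  obtain ⟨k, hk⟩ := h (cmap f _ a) (by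
    rw [← cmap_bd]
    exact cmap_mem f hm h3)
  refine ⟨k, ?_⟩
  -- The chain `c` of `O` is a common local model of both cycles. The relation found in `M` descends
  -- to `O` by `mem_Rel_of_cmap` and is then mapped to `X`.
  have h4 : cmap f (n + 1) (a - k • c) ∈ Rel {i o}ᶜ n := by
    have := Submodule.add_mem _ hk (Submodule.smul_mem _ k hM)
    convert this using 1
    rw [map_sub, map_smul, smul_sub]
    abel
  have h5 := cmap_mem_Rel g hm' (mem_Rel_of_cmap hi h4)
  have h6 := Submodule.add_mem _ (Submodule.add_mem _ h1 h5)
    (Submodule.neg_mem _ (Submodule.smul_mem _ k hX))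
  convert h6 using 1
  rw [map_sub, map_smul, smul_sub]
  abel

end Generators

section Move

variable {E : Type*} [NormedAddCommGroup E] [NormedSpace ℝ E] {n : ℕ}

theorem image_univ_punctured (p : E) :
    Subtype.val '' (Set.univ : Set {v : E // v ≠ p}) = {p}ᶜ := by
  rw [Set.image_univ]
  exact Subtype.range_val_subtype

theorem pushHtpy_notMem (p : E) {r : ℝ} (hr : 0 ≤ r) (t : unitInterval) (v : {v : E // v ≠ p})
    (hv : v.1 ∉ Metric.closedBall p r) : (pushHtpy p r hr (t, v)).1 ∉ Metric.closedBall p r := by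
  rw [mem_closedBall_iff_norm] at hv ⊢
  rw [norm_pushHtpy]
  have := mul_nonneg t.2.1 hr
  linarith

theorem pushOut_notMem (p : E) {r : ℝ} (hr : 0 ≤ r) (v : {v : E // v ≠ p}) :
    (pushOut p r hr v).1 ∉ Metric.closedBall p r := by
  rw [mem_closedBall_iff_norm, norm_pushOut]
  have : 0 < ‖v.1 - p‖ := norm_pos_iff.2 (sub_ne_zero.2 v.2)
  linarith

theorem eq_of_bd_prism {X Y : Type*} [TopologicalSpace X] [TopologicalSpace Y] {f g : C(X, Y)}
    (H : f.Homotopy g) (x : Ch (n + 1) X) : cmap f (n + 1) x =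
      bd (n + 1) (prism H (n + 1) x) + (cmap g (n + 1) x + prism H n (bd n x)) := by
  rw [bd_prism]
  abel

theorem cmap_id {X : Type*} [TopologicalSpace X] (n : ℕ) (x : Ch n X) :
    cmap (ContinuousMap.id X) n x = x :=
  lhom_eq (f := cmap (ContinuousMap.id X) n) (g := LinearMap.id) (fun s => by
    rw [cmap_sg, ContinuousMap.id_comp]; rfl) x

/-- Pushing away from `p` moves the chain out of the ball, and the boundary, which is outside
already, stays outside during the homotopy. So the chain is trivial relative to the complement of
the ball. -/
theorem mem_Rel_of_punctured (p : E) {r : ℝ} (hr : 0 ≤ r) {g : Ch (n + 1) E}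
    (hg : g ∈ Cs {{p}ᶜ} (n + 1)) (hb : bd n g ∈ Cs {(Metric.closedBall p r)ᶜ} n) :
    g ∈ Rel (Metric.closedBall p r)ᶜ n := by
  rw [← image_univ_punctured] at hg
  obtain ⟨g, -, rfl⟩ := exists_cmap_eq Topology.IsEmbedding.subtypeVal hg
  set ι : C({v : E // v ≠ p}, E) := ⟨Subtype.val, continuous_subtype_val⟩ with hι
  rw [← cmap_bd] at hb
  have hb' := mem_Cs_of_cmap (f := ι) Subtype.val_injective hb
  have e := eq_of_bd_prism (pushHtpy p r hr) g
  rw [cmap_id] at e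
  rw [e]
  refine cmap_mem_Rel ι (W := ι ⁻¹' (Metric.closedBall p r)ᶜ) (Set.mapsTo_preimage _ _)
    (Submodule.add_mem _ (bd_mem_Rel _ _) (mem_Rel_of_mem (Submodule.add_mem _ ?_ ?_)))
  · exact cmap_mem _ (A := Set.univ) (fun v _ => pushOut_notMem p hr v) (mem_Cs_univ g)
  · exact prism_mem _ (fun t v hv => pushHtpy_notMem p hr t v hv) hb'

/-- Subtract the prism over the boundary, which lies in the punctured space. The boundary is a
cycle, so only its pushed copy remains. -/
theorem exists_push_boundary (p : E) {r : ℝ} (hr : 0 ≤ r) {a : Ch (n + 2) E}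
    (ha : bd (n + 1) a ∈ Cs {{p}ᶜ} (n + 1)) :
    ∃ a', a - a' ∈ Cs {{p}ᶜ} (n + 2) ∧ bd (n + 1) a' ∈ Cs {(Metric.closedBall p r)ᶜ} (n + 1) := by
  rw [← image_univ_punctured] at ha
  obtain ⟨b, -, hb⟩ := exists_cmap_eq Topology.IsEmbedding.subtypeVal ha
  set ι : C({v : E // v ≠ p}, E) := ⟨Subtype.val, continuous_subtype_val⟩ with hι
  have hb0 : bd n b = 0 := cmap_injective (f := ι) Subtype.val_injective n (by
    rw [cmap_bd, hb, bd_bd, map_zero])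
  have e := eq_of_bd_prism (pushHtpy p r hr) b
  rw [cmap_id, hb0, map_zero, add_zero] at e
  refine ⟨a - cmap ι _ (prism (pushHtpy p r hr) (n + 1) b), ?_, ?_⟩
  · rw [sub_sub_cancel, ← image_univ_punctured]
    exact cmap_mem _ (Set.mapsTo_image _ _) (mem_Cs_univ _)
  · have : bd (n + 1) (a - cmap ι _ (prism (pushHtpy p r hr) (n + 1) b)) =
        cmap ι _ (cmap (pushOut p r hr) _ b) := by
      rw [map_sub, ← hb, ← cmap_bd]
      rw [← map_sub]
      congr 1
      rw [sub_eq_iff_eq_add']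
      exact e
    rw [this]
    exact cmap_mem ι (Set.mapsTo_preimage _ _) (cmap_mem _ (A := Set.univ)
      (B := ι ⁻¹' (Metric.closedBall p r)ᶜ) (fun v _ => pushOut_notMem p hr v) (mem_Cs_univ b))

/-- A cycle which generates the local homology at a point of a chart generates the local homology
at every point of the chart. -/
theorem GeneratesAt.move {X : Type*} [TopologicalSpace X] [T2Space X] [ProperSpace E] {ε : E → X}
    (hε : Topology.IsOpenEmbedding ε) {z : Ch (n + 2) X} (hz : bd (n + 1) z = 0) (p p' : E)
    (h : GeneratesAt (n + 1) z (ε p)) : GeneratesAt (n + 1) z (ε p') := by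
  rw [generatesAt_iff] at h ⊢
  intro y hy
  set f : C(E, X) := ⟨ε, hε.continuous⟩ with hf
  set r := ‖p' - p‖ with hr
  have hr0 : 0 ≤ r := norm_nonneg _
  set K := Metric.closedBall p r with hK
  have hp' : p' ∈ K := mem_closedBall_iff_norm.2 le_rfl
  -- The ball `K` is centred at `p` and reaches `p'`. Pushing away from `p'` has to clear all of
  -- `K`, hence the radius `2 * r`.
  have hKK : K ⊆ Metric.closedBall p' (2 * r) := by
    refine Metric.closedBall_subset_closedBall' ?_
    rw [dist_comm, dist_eq_norm]
    linarith
  have hKc : IsOpen (ε '' K)ᶜ :=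
    ((isCompact_closedBall _ _).image hε.continuous).isClosed.isOpen_compl
  obtain ⟨a, ha, h1, h2⟩ := exists_excise hε.isOpen_range (isOpen_compl_singleton (x := ε p'))
    (range_union_compl_singleton ε p') (mem_Cs_univ y) hy
  rw [Set.inter_univ, ← Set.image_univ] at ha
  obtain ⟨a, -, rfl⟩ := exists_cmap_eq hε.isEmbedding ha
  rw [← cmap_bd] at h2
  have h3 := mem_Cs_of_cmap (f := f) hε.injective h2
  rw [show f ⁻¹' {ε p'}ᶜ = {p'}ᶜ from preimage_compl_singleton hε.injective p'] at h3
  obtain ⟨a', ha', hb⟩ := exists_push_boundary p' (r := 2 * r) (by positivity) h3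
  have hm : ∀ W : Set E, Set.MapsTo f Wᶜ (ε '' W)ᶜ := fun W v hv h =>
    hv ((hε.injective.mem_set_image).1 h)
  have hb' : bd (n + 1) (cmap f _ a') ∈ Cs {(ε '' K)ᶜ} (n + 1) := by
    rw [← cmap_bd]
    exact cmap_mem f (hm K) (Cs_singleton_mono (Set.compl_subset_compl.2 hKK) _ hb)
  have hsub : ∀ {q}, q ∈ K → (ε '' K)ᶜ ⊆ {ε q}ᶜ := fun hq =>
    Set.compl_subset_compl.2 (Set.singleton_subset_iff.2 ⟨_, hq, rfl⟩)
  -- The boundary of `a'` now misses all of `K`, so `a'` is also a relative cycle at `p`, where the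
  -- coefficient `k` can be read off.
  obtain ⟨k, hk⟩ := h (cmap f _ a')
    (Cs_singleton_mono (hsub (Metric.mem_closedBall_self hr0)) _ hb')
  obtain ⟨w, g, hg, hwg⟩ := mem_Rel_iff.1 hk
  -- The error term `g` misses only `ε p`, but its boundary misses all of `K`. By excision and
  -- radial pushing it is trivial relative to the complement of `K`, in particular relative to the
  -- complement of `ε p'`.
  have hgb : bd (n + 1) g ∈ Cs {(ε '' K)ᶜ} (n + 1) := by
    have := congrArg (bd (n + 1)) hwg
    rw [map_sub, map_smul, hz, smul_zero, sub_zero, map_add, bd_bd, zero_add] at this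
    rwa [← this]
  obtain ⟨c, hc, hc1, hc2⟩ := exists_excise hε.isOpen_range hKc (by
    rw [Set.eq_univ_iff_forall]
    intro y
    by_cases h : y ∈ ε '' K
    · exact Or.inl (Set.image_subset_range _ _ h)
    · exact Or.inr h) hg hgb
  have hc' : c ∈ Cs {ε '' {p}ᶜ} (n + 2) := by
    refine Cs_singleton_mono ?_ _ hc
    rintro _ ⟨⟨v, rfl⟩, hv⟩
    exact ⟨v, fun h => hv (congrArg ε h), rfl⟩
  obtain ⟨c, hcp, rfl⟩ := exists_cmap_eq hε.isEmbedding hc'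
  rw [← cmap_bd] at hc2
  have hc3 := mem_Cs_of_cmap (f := f) hε.injective hc2
  rw [show f ⁻¹' (ε '' K)ᶜ = Kᶜ by
    rw [Set.preimage_compl]
    exact congrArg _ (Set.preimage_image_eq K hε.injective)] at hc3
  have hc4 := cmap_mem_Rel f (hm K) (mem_Rel_of_punctured p hr0 hcp hc3)
  refine ⟨k, ?_⟩
  have h5 : g ∈ Rel {ε p'}ᶜ (n + 1) := Rel_mono (hsub hp') _ (by
    have := Submodule.add_mem _ hc1 hc4
    rwa [sub_add_cancel] at this)
  have h6 : cmap f _ (a - a') ∈ Rel {ε p'}ᶜ (n + 1) := mem_Rel_of_mem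
    (cmap_mem f (A := {p'}ᶜ) (B := {ε p'}ᶜ) (fun v hv h => hv (hε.injective h)) ha')
  have h7 := Submodule.add_mem _ (Submodule.add_mem _ h1 h6)
    (Submodule.add_mem _ (bd_mem_Rel {ε p'}ᶜ w) h5)
  rw [← hwg] at h7
  convert h7 using 1
  rw [map_sub]
  abel

end Move

/-! ### Cup products of degree four -/

section Cup

variable {X Y : Type*} [TopologicalSpace X] [TopologicalSpace Y]

/-- The face of a simplex with the given vertices. -/
def sub {n : ℕ} (s : Simp n X) {k : ℕ} (f : Fin (k + 1) → Fin (n + 1)) : Simp k X :=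
  s.comp (ConvexLike.aff (vx ∘ f))

theorem sub_sub {n k l : ℕ} (s : Simp n X) (f : Fin (k + 1) → Fin (n + 1))
    (g : Fin (l + 1) → Fin (k + 1)) : sub (sub s f) g = sub s (f ∘ g) := by
  rw [sub, sub, sub, ContinuousMap.comp_assoc]
  congr 1
  ext p : 1
  rw [ContinuousMap.comp_apply, aff_simplex (vx ∘ g) p, ConvexLike.aff_mix]
  congr 2
  funext i
  exact ConvexLike.aff_vx _ _

theorem range_sub {n k : ℕ} (s : Simp n X) (f : Fin (k + 1) → Fin (n + 1)) :
    Set.range (sub s f) ⊆ Set.range s := by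
  rintro _ ⟨p, rfl⟩
  exact ⟨_, rfl⟩

/-- The cup product in degrees `(2, 2)`. -/
def cup (a b : Co 2 X ℤ) : Co 4 X ℤ := fun s => a (sub s ![0, 1, 2]) * b (sub s ![2, 3, 4])

/-- The cup product in degrees `(1, 2)`. -/
def cup₁₂ (a : Co 1 X ℤ) (b : Co 2 X ℤ) : Co 3 X ℤ :=
  fun s => a (sub s ![0, 1]) * b (sub s ![1, 2, 3])

/-- The cup product in degrees `(2, 1)`. -/
def cup₂₁ (a : Co 2 X ℤ) (b : Co 1 X ℤ) : Co 3 X ℤ :=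
  fun s => a (sub s ![0, 1, 2]) * b (sub s ![2, 3])

theorem cb_sub_apply (n : ℕ) (c : Co n X ℤ) (s : Simp (n + 1) X) :
    cb n c s = ∑ i : Fin (n + 2), (-1) ^ (i : ℕ) * c (sub s i.succAbove) := by
  rw [cb_apply, bd_sg, map_sum]
  refine Finset.sum_congr rfl fun i _ => ?_
  rw [map_smul, ev_sg]
  rfl

/-- The Leibniz rule, in which the term with the coboundary of `b` is dropped since `b` is closed.
-/
theorem cb_cup₁₂ (a : Co 1 X ℤ) (b : Co 2 X ℤ) (hb : cb 2 b = 0) :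
    cb 3 (cup₁₂ a b) = cup (cb 1 a) b := by
  ext s
  have h := congrFun hb (sub s ![1, 2, 3, 4])
  rw [cb_sub_apply, Fin.sum_univ_four] at h
  rw [cb_sub_apply, Fin.sum_univ_five, cup, cb_sub_apply, Fin.sum_univ_three]
  simp only [cup₁₂, sub_sub] at h ⊢
  rw [show ((![1, 2, 3, 4] : Fin 4 → Fin 5) ∘ (0 : Fin 4).succAbove) = ![2, 3, 4] by decide,
    show ((![1, 2, 3, 4] : Fin 4 → Fin 5) ∘ (1 : Fin 4).succAbove) = ![1, 3, 4] by decide,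
    show ((![1, 2, 3, 4] : Fin 4 → Fin 5) ∘ (2 : Fin 4).succAbove) = ![1, 2, 4] by decide,
    show ((![1, 2, 3, 4] : Fin 4 → Fin 5) ∘ (3 : Fin 4).succAbove) = ![1, 2, 3] by decide] at h
  rw [show ((0 : Fin 5).succAbove ∘ ![0, 1] : Fin 2 → Fin 5) = ![1, 2] by decide,
    show ((1 : Fin 5).succAbove ∘ ![0, 1] : Fin 2 → Fin 5) = ![0, 2] by decide,
    show ((2 : Fin 5).succAbove ∘ ![0, 1] : Fin 2 → Fin 5) = ![0, 1] by decide,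
    show ((3 : Fin 5).succAbove ∘ ![0, 1] : Fin 2 → Fin 5) = ![0, 1] by decide,
    show ((4 : Fin 5).succAbove ∘ ![0, 1] : Fin 2 → Fin 5) = ![0, 1] by decide,
    show ((0 : Fin 5).succAbove ∘ ![1, 2, 3] : Fin 3 → Fin 5) = ![2, 3, 4] by decide,
    show ((1 : Fin 5).succAbove ∘ ![1, 2, 3] : Fin 3 → Fin 5) = ![2, 3, 4] by decide,
    show ((2 : Fin 5).succAbove ∘ ![1, 2, 3] : Fin 3 → Fin 5) = ![1, 3, 4] by decide,
    show ((3 : Fin 5).succAbove ∘ ![1, 2, 3] : Fin 3 → Fin 5) = ![1, 2, 4] by decide,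
    show ((4 : Fin 5).succAbove ∘ ![1, 2, 3] : Fin 3 → Fin 5) = ![1, 2, 3] by decide,
    show ((![0, 1, 2] : Fin 3 → Fin 5) ∘ (0 : Fin 3).succAbove) = ![1, 2] by decide,
    show ((![0, 1, 2] : Fin 3 → Fin 5) ∘ (1 : Fin 3).succAbove) = ![0, 2] by decide,
    show ((![0, 1, 2] : Fin 3 → Fin 5) ∘ (2 : Fin 3).succAbove) = ![0, 1] by decide]
  norm_num at h ⊢
  linear_combination -a (sub s ![0, 1]) * h

theorem cb_cup₂₁ (a : Co 2 X ℤ) (ha : cb 2 a = 0) (b : Co 1 X ℤ) :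
    cb 3 (cup₂₁ a b) = cup a (cb 1 b) := by
  ext s
  have h := congrFun ha (sub s ![0, 1, 2, 3])
  rw [cb_sub_apply, Fin.sum_univ_four] at h
  rw [cb_sub_apply, Fin.sum_univ_five, cup, cb_sub_apply, Fin.sum_univ_three]
  simp only [cup₂₁, sub_sub] at h ⊢
  rw [show ((![0, 1, 2, 3] : Fin 4 → Fin 5) ∘ (0 : Fin 4).succAbove) = ![1, 2, 3] by decide,
    show ((![0, 1, 2, 3] : Fin 4 → Fin 5) ∘ (1 : Fin 4).succAbove) = ![0, 2, 3] by decide,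
    show ((![0, 1, 2, 3] : Fin 4 → Fin 5) ∘ (2 : Fin 4).succAbove) = ![0, 1, 3] by decide,
    show ((![0, 1, 2, 3] : Fin 4 → Fin 5) ∘ (3 : Fin 4).succAbove) = ![0, 1, 2] by decide] at h
  rw [show ((0 : Fin 5).succAbove ∘ ![2, 3] : Fin 2 → Fin 5) = ![3, 4] by decide,
    show ((1 : Fin 5).succAbove ∘ ![2, 3] : Fin 2 → Fin 5) = ![3, 4] by decide,
    show ((2 : Fin 5).succAbove ∘ ![2, 3] : Fin 2 → Fin 5) = ![3, 4] by decide,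
    show ((3 : Fin 5).succAbove ∘ ![2, 3] : Fin 2 → Fin 5) = ![2, 4] by decide,
    show ((4 : Fin 5).succAbove ∘ ![2, 3] : Fin 2 → Fin 5) = ![2, 3] by decide,
    show ((0 : Fin 5).succAbove ∘ ![0, 1, 2] : Fin 3 → Fin 5) = ![1, 2, 3] by decide,
    show ((1 : Fin 5).succAbove ∘ ![0, 1, 2] : Fin 3 → Fin 5) = ![0, 2, 3] by decide,
    show ((2 : Fin 5).succAbove ∘ ![0, 1, 2] : Fin 3 → Fin 5) = ![0, 1, 3] by decide,
    show ((3 : Fin 5).succAbove ∘ ![0, 1, 2] : Fin 3 → Fin 5) = ![0, 1, 2] by decide,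
    show ((4 : Fin 5).succAbove ∘ ![0, 1, 2] : Fin 3 → Fin 5) = ![0, 1, 2] by decide,
    show ((![2, 3, 4] : Fin 3 → Fin 5) ∘ (0 : Fin 3).succAbove) = ![3, 4] by decide,
    show ((![2, 3, 4] : Fin 3 → Fin 5) ∘ (1 : Fin 3).succAbove) = ![2, 4] by decide,
    show ((![2, 3, 4] : Fin 3 → Fin 5) ∘ (2 : Fin 3).succAbove) = ![2, 3] by decide]
  norm_num at h ⊢
  linear_combination b (sub s ![3, 4]) * h

theorem AgreeOn.cup {W : Set X} {a a' b b' : Co 2 X ℤ} (ha : AgreeOn W a a')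
    (hb : AgreeOn W b b') : AgreeOn W (cup a b) (Sing.cup a' b') := fun s hs =>
  congrArg₂ _ (ha _ ((range_sub _ _).trans hs)) (hb _ ((range_sub _ _).trans hs))

theorem pull_cup (f : C(X, Y)) (a b : Co 2 Y ℤ) :
    pull f 4 (cup a b) = cup (pull f 2 a) (pull f 2 b) := rfl

/-- The cup square of a cocycle on a cycle does not change if a coboundary is added. -/
theorem ev_cup_sub {a : Co 2 X ℤ} (ha : cb 2 a = 0) (b : Co 1 X ℤ) {z : Ch 4 X} (hz : bd 3 z = 0) :
    ev (cup (a - cb 1 b) (a - cb 1 b)) z = ev (cup a a) z := by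
  -- With `a'' = a - cb 1 b`, the difference is `(a - a'') ∪ a + a'' ∪ (a - a'')`, and both terms
  -- are coboundaries by the Leibniz rules. No graded commutativity is needed.
  have h : cup a a - cup (a - cb 1 b) (a - cb 1 b) =
      cb 3 (cup₁₂ b a) + cb 3 (cup₂₁ (a - cb 1 b) b) := by
    rw [cb_cup₁₂ _ _ ha, cb_cup₂₁ _ (by rw [cb_sub, ha, cb_cb, sub_zero])]
    ext s
    simp only [cup, Pi.sub_apply, Pi.add_apply]
    ring
  have := congrArg (fun c => ev c z) h
  simp only [ev_sub, ev_add, ev_cb, hz, map_zero, add_zero] at this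
  exact (sub_eq_zero.1 this).symm

end Cup

section CupBridge

open SingularHomology

variable {X : Type u} [TopologicalSpace X]

theorem ofCochain_cup (a b : Cochain 2 X) :
    ofCochain (cupCochain a b) = cup (ofCochain a) (ofCochain b) := by
  ext s
  change a _ * b _ = a _ * b _
  rw [map_tb, map_tb]
  congr 3

theorem cb_cup_eq_zero {a b : Co 2 X ℤ} (ha : cb 2 a = 0) (hb : cb 2 b = 0) :
    cb 4 (cup a b) = 0 := by
  have e : ∀ c : Co 2 X ℤ, ofCochain (fun s => c (tb.symm s)) = c := fun c =>
    funext fun s => congrArg c (tb.symm_apply_apply s)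
  have := isCocycle_iff.1 (IsCocycle.cup (a := fun s => a (tb.symm s))
    (b := fun s => b (tb.symm s)) (isCocycle_iff.2 (by rw [e, ha])) (isCocycle_iff.2 (by rw [e, hb])))
  rwa [ofCochain_cup, e, e] at this

end CupBridge

end Sing

end


/-! ### The construction as a quotient of the complement of the surface -/

noncomputable section

namespace Sing

/-! ### Gluing along a partial involution -/

section Gluing

variable {Y Q : Type*} {e : Q → Y} {ρ : Q → Q}

/-- The identification of `e q` with `e (ρ q)`, for an involution `ρ`. -/
def glueSetoid (he : Function.Injective e) (hρ : Function.Involutive ρ) : Setoid Y where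
  r u v := v = u ∨ ∃ q, u = e q ∧ v = e (ρ q)
  iseqv :=
    { refl := fun _ => Or.inl rfl
      symm := by
        rintro u v (rfl | ⟨q, rfl, rfl⟩)
        · exact Or.inl rfl
        · exact Or.inr ⟨ρ q, rfl, by rw [hρ q]⟩
      trans := by
        rintro u v w (rfl | ⟨q, rfl, rfl⟩) (rfl | ⟨q', h, rfl⟩)
        · exact Or.inl rfl
        · exact Or.inr ⟨q', h, rfl⟩
        · exact Or.inr ⟨q, rfl, rfl⟩
        · rw [← he h, hρ q]
          exact Or.inl rfl }

variable (he : Function.Injective e) (hρ : Function.Involutive ρ)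

theorem glue_eq_iff {u v : Y} : (Quotient.mk (glueSetoid he hρ) u = Quotient.mk _ v) ↔
    v = u ∨ ∃ q, u = e q ∧ v = e (ρ q) :=
  Quotient.eq

variable [TopologicalSpace Y] [TopologicalSpace Q]

/-- The saturation of an open set `U` is `U ∪ e (ρ⁻¹ (e⁻¹ U))`, which is open because `e` is an open
embedding. -/
theorem isOpenQuotientMap_glue (ho : Topology.IsOpenEmbedding e) (hc : Continuous ρ) :
    IsOpenQuotientMap (Quotient.mk (glueSetoid he hρ)) := by
  refine ⟨Quotient.mk_surjective, continuous_quotient_mk', fun U hU => ?_⟩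
  have : Quotient.mk (glueSetoid he hρ) ⁻¹' (Quotient.mk (glueSetoid he hρ) '' U) =
      U ∪ e '' (ρ ⁻¹' (e ⁻¹' U)) := by
    ext v
    constructor
    · rintro ⟨u, hu, h⟩
      obtain rfl | ⟨q, rfl, rfl⟩ := (glue_eq_iff he hρ).1 h
      · exact Or.inl hu
      · refine Or.inr ⟨ρ q, ?_, rfl⟩
        rw [Set.mem_preimage, hρ q]
        exact hu
    · rintro (h | ⟨q, hq, rfl⟩)
      · exact ⟨v, h, rfl⟩
      · exact ⟨_, hq, (glue_eq_iff he hρ).2 (Or.inr ⟨ρ q, rfl, by rw [hρ q]⟩)⟩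
  exact isOpen_coinduced.2 (this ▸ hU.union
    (ho.isOpenMap _ ((hU.preimage ho.continuous).preimage hc)))

theorem t2Space_glue [T2Space Y] (ho : Topology.IsOpenEmbedding e) (hc : Continuous ρ)
    (hR : IsClosed (Set.range fun q => (e q, e (ρ q)))) :
    T2Space (Quotient (glueSetoid he hρ)) := by
  rw [t2Space_iff_of_isOpenQuotientMap (isOpenQuotientMap_glue he hρ ho hc)]
  convert isClosed_diagonal.union hR using 1
  ext ⟨u, v⟩
  simp only [Set.mem_union, Set.mem_diagonal_iff, Set.mem_range, Prod.mk.injEq]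
  refine (glue_eq_iff he hρ).trans ?_
  refine or_congr eq_comm (exists_congr fun q => and_congr eq_comm eq_comm)

/-- As `ρ` is free, the closed graph of the gluing misses `(u, u)`, hence a product neighbourhood of
it. -/
theorem exists_injOn_glue [T2Space Y] (hf : ∀ q, ρ q ≠ q)
    (hR : IsClosed (Set.range fun q => (e q, e (ρ q)))) (u : Y) :
    ∃ U ∈ nhds u, Set.InjOn (Quotient.mk (glueSetoid he hρ)) U := by
  have h : (Set.range fun q => (e q, e (ρ q)))ᶜ ∈ nhds (u, u) := by
    refine hR.isOpen_compl.mem_nhds ?_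
    rintro ⟨q, hq⟩
    have := Prod.ext_iff.1 hq
    exact hf q (he (this.2.trans this.1.symm))
  rw [nhds_prod_eq] at h
  obtain ⟨U, hU, V, hV, h⟩ := Filter.mem_prod_iff.1 h
  refine ⟨U ∩ V, Filter.inter_mem hU hV, fun v hv w hw hvw => ?_⟩
  obtain rfl | ⟨q, rfl, rfl⟩ := (glue_eq_iff he hρ).1 hvw
  · rfl
  · exact absurd ⟨q, rfl⟩ (h (Set.mk_mem_prod hv.1 hw.2))

end Gluing

end Sing

namespace ZTwo.FramedSurface

variable {S M : Type u} [TopologicalSpace S] [TopologicalSpace M]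
  [ChartedSpace (EuclideanSpace ℝ (Fin 2)) S] [ChartedSpace (EuclideanSpace ℝ (Fin 4)) M]

/-- The punctured plane times a surface. -/
abbrev Punctured (S : Type u) : Type u := {p : ℂ × S // p.1 ≠ 0}

/-- The inversion in the unit circle times an involution. -/
def reflect (φ : S → S) (p : Punctured S) : Punctured S :=
  ⟨((starRingEnd ℂ p.1.1)⁻¹, φ p.1.2), inv_ne_zero ((map_ne_zero _).2 p.2)⟩

theorem norm_reflect (φ : S → S) (p : Punctured S) : ‖(reflect φ p).1.1‖ = ‖p.1.1‖⁻¹ := by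
  simp [reflect]

/-- Inversion fixes the unit circle, so on the boundary of the tubular neighbourhood the reflection
is the gluing map `Φ`. -/
theorem reflect_of_norm_eq_one (φ : S → S) {p : Punctured S} (h : ‖p.1.1‖ = 1) :
    (reflect φ p).1 = (p.1.1, φ p.1.2) := by
  refine Prod.ext ?_ rfl
  change (starRingEnd ℂ p.1.1)⁻¹ = _
  rw [Complex.inv_def, Complex.conj_conj, Complex.normSq_conj, Complex.normSq_eq_norm_sq, h]
  simp

theorem involutive_reflect {φ : S → S} (hφ : Function.Involutive φ) :
    Function.Involutive (reflect φ) := fun p =>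
  Subtype.ext (Prod.ext (by simp [reflect]) (hφ _))

theorem continuous_reflect {φ : S → S} (hφ : Continuous φ) : Continuous (reflect φ) := by
  refine Continuous.subtype_mk (Continuous.prodMk (Continuous.inv₀ ?_ ?_) ?_) _
  · exact Complex.continuous_conj.comp (continuous_fst.comp continuous_subtype_val)
  · exact fun p => (map_ne_zero _).2 p.2
  · exact hφ.comp (continuous_snd.comp continuous_subtype_val)

theorem isOpenEmbedding (η : FramedSurface S M) : Topology.IsOpenEmbedding η.toFun :=
  .of_continuous_injective_isOpenMap η.continuous_toFun η.injective
    η.isLocalDiffeomorph.isOpenMap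

/-- The framing of the punctured tubular neighbourhood. -/
def tube (η : FramedSurface S M) (p : Punctured S) : η.Complement :=
  ⟨η.toFun p.1, by
    rintro ⟨t, ht⟩
    exact p.2 (congrArg Prod.fst (η.injective ht)).symm⟩

theorem tube_injective (η : FramedSurface S M) : Function.Injective η.tube := fun _ _ h =>
  Subtype.ext (η.injective (congrArg Subtype.val h))

variable [CompactSpace S] [T2Space M]

theorem isClosed_range_emb (η : FramedSurface S M) : IsClosed (Set.range η.emb) :=
  (isCompact_range η.emb.continuous).isClosed

theorem isOpenEmbedding_val (η : FramedSurface S M) :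
    Topology.IsOpenEmbedding (Subtype.val : η.Complement → M) :=
  η.isClosed_range_emb.isOpen_compl.isOpenEmbedding_subtypeVal

theorem isOpenEmbedding_tube (η : FramedSurface S M) : Topology.IsOpenEmbedding η.tube := by
  refine .of_comp _ η.isOpenEmbedding_val ?_
  exact η.isOpenEmbedding.comp
    (isOpen_ne_fun continuous_fst continuous_const).isOpenEmbedding_subtypeVal

theorem isClosed_range_closedBall (η : FramedSurface S M) (r : ℝ) :
    IsClosed (η.toFun '' (Metric.closedBall 0 r ×ˢ Set.univ)) :=
  (((isCompact_closedBall _ _).prod isCompact_univ).image η.continuous_toFun).isClosed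

theorem isCompact_shell (r R : ℝ) (hr : 0 < r) :
    IsCompact (setOf fun p : Punctured S => r ≤ ‖p.1.1‖ ∧ ‖p.1.1‖ ≤ R) := by
  rw [Subtype.isCompact_iff]
  convert ((isCompact_closedBall (0 : ℂ) R).diff (Metric.isOpen_ball (x := 0) (ε := r))).prod
    (isCompact_univ (X := S)) using 1
  ext p
  constructor
  · rintro ⟨q, ⟨h1, h2⟩, rfl⟩
    exact ⟨⟨mem_closedBall_zero_iff.2 h2, fun h => not_lt.2 h1 (mem_ball_zero_iff.1 h)⟩, trivial⟩
  · rintro ⟨⟨h1, h2⟩, -⟩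
    have h3 : r ≤ ‖p.1‖ := not_lt.1 fun h => h2 (mem_ball_zero_iff.2 h)
    exact ⟨⟨p, fun h => by rw [h, norm_zero] at h3; linarith⟩,
      ⟨h3, mem_closedBall_zero_iff.1 h1⟩, rfl⟩

theorem exists_notMem_closedBall (η : FramedSurface S M) (u : η.Complement) :
    ∃ r : ℝ, 0 < r ∧ u.1 ∉ η.toFun '' (Metric.closedBall 0 r ×ˢ Set.univ) := by
  by_cases h : u.1 ∈ η.toFun '' (Metric.closedBall 0 1 ×ˢ Set.univ)
  · obtain ⟨p, -, hp⟩ := h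
    have hp0 : p.1 ≠ 0 := fun h => u.2 ⟨p.2, by rw [← hp, ← Prod.mk.eta (p := p), h]; rfl⟩
    refine ⟨‖p.1‖ / 2, by positivity, ?_⟩
    rintro ⟨p', ⟨h1, -⟩, h2⟩
    rw [η.injective (h2.trans hp.symm), mem_closedBall_zero_iff] at h1
    have := norm_pos_iff.2 hp0
    linarith
  · exact ⟨1, one_pos, h⟩

/-- Both points of a limit pair keep away from `Σ`: nearby pairs have `‖p‖ ≥ r` and `‖p‖⁻¹ ≥ R`.
This confines `p` to a compact shell, whose image is closed. -/
theorem isClosed_range_reflect (η : FramedSurface S M) {φ : S → S} (hφ : Continuous φ) :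
    IsClosed (Set.range fun p => (η.tube p, η.tube (reflect φ p))) := by
  refine isClosed_of_closure_subset ?_
  rintro ⟨u, v⟩ huv
  obtain ⟨r, hr, hu⟩ := η.exists_notMem_closedBall u
  obtain ⟨R, hR, hv⟩ := η.exists_notMem_closedBall v
  set N : Set (η.Complement × η.Complement) :=
    (Subtype.val ⁻¹' (η.toFun '' (Metric.closedBall 0 r ×ˢ Set.univ))ᶜ) ×ˢ
      (Subtype.val ⁻¹' (η.toFun '' (Metric.closedBall 0 R ×ˢ Set.univ))ᶜ) with hN
  have hNo : IsOpen N :=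
    ((η.isClosed_range_closedBall r).isOpen_compl.preimage continuous_subtype_val).prod
      ((η.isClosed_range_closedBall R).isOpen_compl.preimage continuous_subtype_val)
  have hc : Continuous fun p => (η.tube p, η.tube (reflect φ p)) :=
    η.isOpenEmbedding_tube.continuous.prodMk
      (η.isOpenEmbedding_tube.continuous.comp (continuous_reflect hφ))
  have hK := ((isCompact_shell (S := S) r R⁻¹ hr).image hc).isClosed
  have h := hNo.inter_closure ⟨(⟨hu, hv⟩ : (u, v) ∈ N), huv⟩
  refine Set.image_subset_range _ _ (hK.closure_subset_iff.2 ?_ h)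
  rintro _ ⟨⟨h1, h2⟩, p, rfl⟩
  refine ⟨p, ⟨?_, ?_⟩, rfl⟩
  · by_contra h
    exact h1 ⟨p.1, ⟨mem_closedBall_zero_iff.2 (le_of_not_ge h), trivial⟩, rfl⟩
  · by_contra h
    refine h2 ⟨(reflect φ p).1, ⟨mem_closedBall_zero_iff.2 ?_, trivial⟩, rfl⟩
    rw [norm_reflect]
    exact inv_le_of_inv_le₀ hR (le_of_not_ge h)

theorem reflect_ne {φ : S → S} (hf : ∀ s, φ s ≠ s) (p : Punctured S) : reflect φ p ≠ p :=
  fun h => hf _ (congrArg (fun q : Punctured S => q.1.2) h)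

/-! ### The `ℤ₂`-construction as a quotient of the complement -/

/-- The quotient of the complement of the surface by the reflection of the punctured tube. -/
abbrev Folded (η : FramedSurface S M) {φ : S → S} (hφ : Function.Involutive φ) : Type u :=
  Quotient (Sing.glueSetoid η.tube_injective (involutive_reflect hφ))

/-- The inclusion of the exterior in the complement. -/
def ofExterior (η : FramedSurface S M) (x : η.Exterior) : η.Complement :=
  ⟨x.1, by
    rintro ⟨t, ht⟩
    exact x.2 ⟨(0, t), ⟨Metric.mem_ball_self one_pos, trivial⟩, ht⟩⟩

theorem continuous_ofExterior (η : FramedSurface S M) : Continuous η.ofExterior :=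
  continuous_subtype_val.subtype_mk _

theorem ofExterior_boundaryPoint (η : FramedSurface S M) (z : Circle) (s : S) :
    η.ofExterior (η.boundaryPoint z s) = η.tube ⟨(z, s), z.coe_ne_zero⟩ := rfl

variable {φ : S → S} (hφ : Function.Involutive φ)

theorem fold_boundaryPoint (η : FramedSurface S M) (z : Circle) (s : S) :
    Quotient.mk (Sing.glueSetoid η.tube_injective (involutive_reflect hφ))
      (η.ofExterior (η.boundaryPoint z s)) = Quotient.mk _
      (η.ofExterior (η.boundaryPoint z (φ s))) := by
  refine (Sing.glue_eq_iff _ _).2 (Or.inr ⟨⟨(z, s), z.coe_ne_zero⟩, rfl, ?_⟩)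
  rw [ofExterior_boundaryPoint]
  congr 1
  exact Subtype.ext (reflect_of_norm_eq_one φ
    (p := ⟨(z, s), z.coe_ne_zero⟩) z.norm_coe).symm

/-- The projection of the double to the folded complement. -/
def foldDouble (η : FramedSurface S M) : η.Double φ → η.Folded hφ :=
  Quot.lift (fun p => Quotient.mk _ (η.ofExterior p.1)) (by
    rintro _ _ ⟨z, s⟩
    exact η.fold_boundaryPoint hφ z s)

/-- The comparison of the `ℤ₂`-construction with the folded complement. -/
def toFolded (η : FramedSurface S M) : η.Construction φ hφ → η.Folded hφ :=
  Quot.lift (η.foldDouble hφ) (by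
    rintro ⟨p⟩ _ rfl
    rfl)

theorem continuous_toFolded (η : FramedSurface S M) : Continuous (η.toFolded hφ) := by
  refine continuous_quot_lift _ (continuous_quot_lift _ ?_)
  exact continuous_quotient_mk'.comp (η.continuous_ofExterior.comp continuous_fst)

/-- The projection of the exterior to the `ℤ₂`-construction. -/
def proj (η : FramedSurface S M) (x : η.Exterior × Bool) : η.Construction φ hφ :=
  Quot.mk _ (Quot.mk _ x)

theorem proj_surjective (η : FramedSurface S M) : Function.Surjective (η.proj hφ) := by
  rintro ⟨⟨x⟩⟩
  exact ⟨x, rfl⟩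

theorem continuous_proj (η : FramedSurface S M) : Continuous (η.proj hφ) :=
  continuous_quot_mk.comp continuous_quot_mk

theorem proj_eq (η : FramedSurface S M) (x : η.Exterior) (b c : Bool) :
    η.proj hφ (x, b) = η.proj hφ (x, c) := by
  have h : ∀ b, η.proj hφ (x, b) = η.proj hφ (x, !b) := fun b => Quot.sound rfl
  cases b <;> cases c <;> first | rfl | exact h _

/-- Two points of the exterior related by the reflection have radii `≥ 1` that are inverse to each
other. Both radii are one, where the reflection is the gluing along the boundary. -/
theorem toFolded_injective (η : FramedSurface S M) : Function.Injective (η.toFolded hφ) := by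
  intro x y h
  obtain ⟨⟨x, b⟩, rfl⟩ := η.proj_surjective hφ x
  obtain ⟨⟨y, c⟩, rfl⟩ := η.proj_surjective hφ y
  obtain h | ⟨p, h1, h2⟩ := (Sing.glue_eq_iff _ _).1 h
  · have : y = x := Subtype.ext (congrArg (fun u : η.Complement => u.1) h)
    rw [this]
    exact η.proj_eq hφ x b c
  · have h3 : 1 ≤ ‖p.1.1‖ := by
      by_contra h
      exact x.2 ⟨p.1, ⟨mem_ball_zero_iff.2 (not_le.1 h), trivial⟩, (congrArg Subtype.val h1).symm⟩
    have h4 : 1 ≤ ‖(reflect φ p).1.1‖ := by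
      by_contra h
      exact y.2 ⟨_, ⟨mem_ball_zero_iff.2 (not_le.1 h), trivial⟩, (congrArg Subtype.val h2).symm⟩
    have h5 : ‖p.1.1‖ = 1 := by
      rw [norm_reflect] at h4
      exact le_antisymm ((one_le_inv₀ (by linarith)).1 h4) h3
    set z : Circle := ⟨p.1.1, mem_sphere_zero_iff_norm.2 h5⟩
    have hx : x = η.boundaryPoint z p.1.2 := Subtype.ext (congrArg (fun u : η.Complement => u.1) h1)
    have hy : y = η.boundaryPoint z (φ p.1.2) := Subtype.ext ((congrArg (fun u : η.Complement => u.1) h2).trans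
      (congrArg η.toFun (reflect_of_norm_eq_one φ h5)))
    rw [hx, hy, η.proj_eq hφ _ b false, η.proj_eq hφ _ c true]
    exact congrArg (Quot.mk _) (Quot.sound (Glue.glue z p.1.2))

/-- A point inside the unit tube is identified with its reflection, which lies in the exterior. -/
theorem toFolded_surjective (η : FramedSurface S M) : Function.Surjective (η.toFolded hφ) := by
  rintro ⟨u⟩
  by_cases hu : u.1 ∈ η.toFun '' (Metric.ball 0 1 ×ˢ Set.univ)
  · obtain ⟨p, ⟨h1, -⟩, hp⟩ := hu
    have hp0 : p.1 ≠ 0 := fun h => u.2 ⟨p.2, by rw [← hp, ← Prod.mk.eta (p := p), h]; rfl⟩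
    have hu : u = η.tube ⟨p, hp0⟩ := Subtype.ext hp.symm
    refine ⟨η.proj hφ (⟨η.toFun (reflect φ ⟨p, hp0⟩).1, ?_⟩, false), ?_⟩
    · rintro ⟨q, ⟨h2, -⟩, h3⟩
      rw [η.injective h3, mem_ball_zero_iff, norm_reflect] at h2
      have h4 := mem_ball_zero_iff.1 h1
      exact lt_asymm h2 ((one_lt_inv₀ (norm_pos_iff.2 hp0)).2 h4)
    · refine ((Sing.glue_eq_iff _ _).2 (Or.inr ⟨⟨p, hp0⟩, hu, ?_⟩)).symm
      rfl
  · exact ⟨η.proj hφ (⟨u.1, hu⟩, false), rfl⟩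

variable [CompactSpace M] (hc : Continuous φ)

instance (η : FramedSurface S M) : CompactSpace η.Exterior :=
  isCompact_iff_compactSpace.1 ((η.isOpenEmbedding.isOpenMap _
    (Metric.isOpen_ball.prod isOpen_univ)).isClosed_compl.isCompact)

instance (η : FramedSurface S M) : CompactSpace (η.Construction φ hφ) :=
  (η.proj_surjective hφ).compactSpace (η.continuous_proj hφ)

theorem t2Space_folded (η : FramedSurface S M) (hc : Continuous φ) : T2Space (η.Folded hφ) :=
  Sing.t2Space_glue _ _ η.isOpenEmbedding_tube (continuous_reflect hc)
    (η.isClosed_range_reflect hc)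

/-- The `ℤ₂`-construction is the folded complement. -/
def homeoFolded (η : FramedSurface S M) (hc : Continuous φ) : η.Construction φ hφ ≃ₜ η.Folded hφ :=
  haveI := η.t2Space_folded hφ hc
  Continuous.homeoOfEquivCompactToT2
    (f := Equiv.ofBijective _ ⟨η.toFolded_injective hφ, η.toFolded_surjective hφ⟩)
    (η.continuous_toFolded hφ)

/-- The projection of the complement to the `ℤ₂`-construction. -/
def fold (η : FramedSurface S M) (hc : Continuous φ) (u : η.Complement) : η.Construction φ hφ :=
  (η.homeoFolded hφ hc).symm (Quotient.mk _ u)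

theorem t2Space_construction (η : FramedSurface S M) (hc : Continuous φ) :
    T2Space (η.Construction φ hφ) :=
  haveI := η.t2Space_folded hφ hc
  (η.homeoFolded hφ hc).symm.t2Space

theorem isOpenQuotientMap_fold (η : FramedSurface S M) (hc : Continuous φ) :
    IsOpenQuotientMap (η.fold hφ hc) :=
  (η.homeoFolded hφ hc).symm.isOpenQuotientMap.comp (Sing.isOpenQuotientMap_glue _ _
    η.isOpenEmbedding_tube (continuous_reflect hc))

theorem fold_eq_iff (η : FramedSurface S M) (hc : Continuous φ) {u v : η.Complement} :
    η.fold hφ hc u = η.fold hφ hc v ↔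
      v = u ∨ ∃ p, u = η.tube p ∧ v = η.tube (reflect φ p) :=
  (η.homeoFolded hφ hc).symm.injective.eq_iff.trans (Sing.glue_eq_iff _ _)

theorem fold_reflect (η : FramedSurface S M) (hc : Continuous φ) (p : Punctured S) :
    η.fold hφ hc (η.tube (reflect φ p)) = η.fold hφ hc (η.tube p) :=
  ((η.fold_eq_iff hφ hc).2 (Or.inr ⟨p, rfl, rfl⟩)).symm

theorem hasCharts_construction (η : FramedSurface S M) (hc : Continuous φ) (hf : ∀ s, φ s ≠ s) :
    Sing.HasCharts (EuclideanSpace ℝ (Fin 4)) (η.Construction φ hφ) := by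
  refine ((Sing.hasCharts_of_chartedSpace (Y := M)).of_isOpenEmbedding
    η.isOpenEmbedding_val).of_isOpenQuotientMap (η.isOpenQuotientMap_fold hφ hc) fun u => ?_
  obtain ⟨U, hU, h⟩ := Sing.exists_injOn_glue η.tube_injective (involutive_reflect hφ)
    (reflect_ne hf) (η.isClosed_range_reflect hc) u
  exact ⟨U, hU, fun v hv w hw hvw => h hv hw ((η.homeoFolded hφ hc).symm.injective hvw)⟩

end ZTwo.FramedSurface

end


/-! ### Filling the boundary cycle inside the image of the tube -/

noncomputable section

namespace ZTwo.FramedSurface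

/-! ### Radial projection of the punctured tube -/

section Radial

variable (B : Type u) [TopologicalSpace B]

theorem radial_smul_ne_zero (t : unitInterval) {w : ℂ} (hw : w ≠ 0) :
    ((1 - t : ℝ) + t * ‖w‖⁻¹) • w ≠ 0 := by
  refine smul_ne_zero (ne_of_gt ?_) hw
  have h1 := inv_pos.2 (norm_pos_iff.2 hw)
  have h2 := t.2.1
  have h3 := t.2.2
  rcases h2.eq_or_lt with h | h
  · rw [← h]
    norm_num
  · have := mul_pos h h1
    linarith

theorem continuous_inv_norm : Continuous fun p : Punctured B => ‖p.1.1‖⁻¹ :=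
  Continuous.inv₀ (by fun_prop) fun p => norm_ne_zero_iff.2 p.2

/-- The radial projection of the punctured plane. -/
def radial : C(Punctured B, Punctured B) where
  toFun p := ⟨(‖p.1.1‖⁻¹ • p.1.1, p.1.2),
    smul_ne_zero (inv_ne_zero (norm_ne_zero_iff.2 p.2)) p.2⟩
  continuous_toFun := by
    refine Continuous.subtype_mk (Continuous.prodMk ((continuous_inv_norm B).smul ?_) ?_) _
    · fun_prop
    · fun_prop

/-- The radial deformation of the punctured plane. -/
def radialHtpy : (ContinuousMap.id (Punctured B)).Homotopy (radial B) where
  toFun x := ⟨(((1 - x.1 : ℝ) + x.1 * ‖x.2.1.1‖⁻¹) • x.2.1.1, x.2.1.2),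
    radial_smul_ne_zero x.1 x.2.2⟩
  continuous_toFun := by
    have h := (continuous_inv_norm B).comp (continuous_snd (X := unitInterval))
    refine Continuous.subtype_mk (Continuous.prodMk (Continuous.smul (Continuous.add ?_
      (Continuous.mul ?_ h)) ?_) ?_) _
    · fun_prop
    · fun_prop
    · fun_prop
    · fun_prop
  map_zero_left p := by simp
  map_one_left p := by simp [radial]

/-- The argument, as a point of the unit circle. -/
def argCircle : C(Punctured B, Circle) where
  toFun p := ⟨(radial B p).1.1, mem_sphere_zero_iff_norm.2 (by
    simp [radial, norm_smul, inv_mul_cancel₀ (norm_ne_zero_iff.2 p.2)])⟩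
  continuous_toFun := by
    refine Continuous.subtype_mk ?_ _
    exact continuous_fst.comp (continuous_subtype_val.comp (radial B).continuous)

end Radial

section

variable {S M : Type u} [TopologicalSpace S] [TopologicalSpace M]
  [ChartedSpace (EuclideanSpace ℝ (Fin 2)) S] [ChartedSpace (EuclideanSpace ℝ (Fin 4)) M]
  [CompactSpace S] [T2Space M] [CompactSpace M] {φ : S → S} (hφ : Function.Involutive φ)

/-- The image of the punctured tube in the `ℤ₂`-construction. -/
def foldTube (η : FramedSurface S M) (hc : Continuous φ) :
    C(Punctured S, η.Construction φ hφ) :=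
  ⟨_, (η.isOpenQuotientMap_fold hφ hc).continuous.comp η.isOpenEmbedding_tube.continuous⟩

/-- On the unit circle bundle the reflection is `(z, s) ↦ (z, φ s)`, so the map to the construction
descends to the product of the circle with the orbit space. -/
theorem foldTube_circle (η : FramedSurface S M) (hc : Continuous φ) (z : Circle) (s : S) :
    η.foldTube hφ hc ⟨(z, φ s), z.coe_ne_zero⟩ = η.foldTube hφ hc ⟨(z, s), z.coe_ne_zero⟩ := by
  refine Eq.trans ?_ (η.fold_reflect hφ hc ⟨(z, s), z.coe_ne_zero⟩)
  refine congrArg (η.foldTube hφ hc) (Subtype.ext ?_)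
  exact (reflect_of_norm_eq_one φ (p := ⟨(z, s), z.coe_ne_zero⟩) z.norm_coe).symm

/-- The orbit space of a free involution. -/
abbrev Orbits : Type u := Quotient (Sing.orbitSetoid hφ)

/-- The projection to the orbit space. -/
def toOrbits (hc : Continuous φ) : C(S, Orbits hφ) :=
  ⟨_, (Sing.isOpenQuotientMap_orbit hφ hc).continuous⟩

theorem isQuotientMap_circleOrbits (hc : Continuous φ) : Topology.IsQuotientMap
    ((ContinuousMap.id Circle).prodMap (toOrbits hφ hc)) :=
  ((IsOpenQuotientMap.id (X := Circle)).prodMap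
    (Sing.isOpenQuotientMap_orbit hφ hc)).isQuotientMap

/-- The image of the circle bundle of the tube in the `ℤ₂`-construction. -/
def foldCircle (η : FramedSurface S M) (hc : Continuous φ) :
    C(Circle × S, η.Construction φ hφ) :=
  ⟨fun p => η.foldTube hφ hc ⟨(p.1, p.2), p.1.coe_ne_zero⟩,
    (η.foldTube hφ hc).continuous.comp (by fun_prop)⟩

theorem factorsThrough_foldCircle (η : FramedSurface S M) (hc : Continuous φ) :
    Function.FactorsThrough (η.foldCircle hφ hc)
      ((ContinuousMap.id Circle).prodMap (toOrbits hφ hc)) := by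
  rintro ⟨z, s⟩ ⟨z', s'⟩ h
  obtain ⟨rfl, h⟩ := Prod.ext_iff.1 h
  obtain rfl | rfl := (Sing.orbit_eq_iff hφ).1 h
  · rfl
  · exact (η.foldTube_circle hφ hc z _).symm

/-- The circle bundle of the tube, divided by the involution, in the `ℤ₂`-construction. -/
def ofCircleOrbits (η : FramedSurface S M) (hc : Continuous φ) :
    C(Circle × Orbits hφ, η.Construction φ hφ) :=
  (isQuotientMap_circleOrbits hφ hc).lift (η.foldCircle hφ hc)
    (η.factorsThrough_foldCircle hφ hc)

theorem ofCircleOrbits_apply (η : FramedSurface S M) (hc : Continuous φ) (z : Circle) (s : S) :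
    η.ofCircleOrbits hφ hc (z, toOrbits hφ hc s) =
      η.foldTube hφ hc ⟨(z, s), z.coe_ne_zero⟩ :=
  DFunLike.congr_fun ((isQuotientMap_circleOrbits hφ hc).lift_comp (η.foldCircle hφ hc)
    (η.factorsThrough_foldCircle hφ hc)) (z, s)

theorem range_ofCircleOrbits (η : FramedSurface S M) (hc : Continuous φ) :
    Set.range (η.ofCircleOrbits hφ hc) ⊆ Set.range (η.foldTube hφ hc) := by
  rintro _ ⟨⟨z, ⟨s⟩⟩, rfl⟩
  exact ⟨_, (η.ofCircleOrbits_apply hφ hc z s).symm⟩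

end

end ZTwo.FramedSurface

namespace ZTwo

open SingularHomology Sing FramedSurface

variable {S M : Type u} [TopologicalSpace S] [TopologicalSpace M] [T2Space S]
  [ChartedSpace (EuclideanSpace ℝ (Fin 2)) S] [ChartedSpace (EuclideanSpace ℝ (Fin 4)) M]
  [CompactSpace S] [T2Space M] [CompactSpace M] [ConnectedSpace S]
  {σ : H 2 S} {φ : C(S, S)}

theorem IsReversingFreeInvolution.vanOn_orbits (hφ : IsReversingFreeInvolution σ φ)
    (G : Type*) [AddCommGroup G] : VanOn G 2 (Set.univ : Set (Orbits hφ.involutive)) := by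
  haveI := t2Space_orbit hφ.involutive φ.continuous
  exact vanOn_surface ((hasCharts_surface (Y := S)).of_isOpenQuotientMap
    (isOpenQuotientMap_orbit hφ.involutive φ.continuous)
    (exists_injOn_orbit hφ.involutive φ.continuous hφ.free)) 0

/-- Reversal of orientation makes `φ_* z + z` a boundary, and the projection to the orbits does not
see `φ`. Twice the fundamental cycle therefore bounds in the quotient surface. -/
theorem IsReversingFreeInvolution.exists_bd (hφ : IsReversingFreeInvolution σ φ) {z : Ch 2 S}
    (hz : Sing.Rep z σ) : ∃ w, cmap (toOrbits hφ.involutive φ.continuous) 2 z +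
      cmap (toOrbits hφ.involutive φ.continuous) 2 z = bd 2 w := by
  have h1 := hz.push φ
  rw [hφ.reversing] at h1
  have h2 : Sing.Rep (cmap φ 2 z - (-1 : ℤ) • z) (0 : H 2 S) := by
    have := IsRep.sub h1 (IsRep.smul (-1) hz)
    rw [← map_zsmul, ← map_sub] at this
    simpa [Sing.Rep] using this
  obtain ⟨w, hw⟩ := h2.exists_bd_eq
  refine ⟨cmap (toOrbits hφ.involutive φ.continuous) 3 w, ?_⟩
  rw [← cmap_bd, ← hw, map_sub, cmap_cmap, map_zsmul, neg_one_zsmul, sub_neg_eq_add]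
  congr 3
  refine ContinuousMap.ext fun s => ?_
  exact (orbit_eq_iff hφ.involutive).2 (Or.inr rfl)

/-- Up to radial homotopy `foldTube` factors through the circle times the orbit space. There the
cycle bounds by `exists_bd_punctured`, and everything stays in the image of the tube. -/
theorem exists_bd_foldTube (η : FramedSurface S M) (hσ : IsFundamentalClass 2 σ)
    (hφ : IsReversingFreeInvolution σ φ) {θ : Ch 3 (Punctured S)} (hθ : bd 2 θ = 0) :
    ∃ e ∈ Cs {Set.range (η.foldTube hφ.involutive φ.continuous)} 4,
      bd 3 e = cmap (η.foldTube hφ.involutive φ.continuous) 3 θ := by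
  obtain ⟨z, hz⟩ := Rep.exists_rep σ
  obtain ⟨s⟩ := (inferInstance : Nonempty S)
  set J := η.foldTube hφ.involutive φ.continuous with hJ
  set q := toOrbits hφ.involutive φ.continuous with hq
  obtain ⟨w, hw⟩ := hφ.exists_bd hz
  set ι : C(Punctured S, ℂ × S) := ⟨Subtype.val, continuous_subtype_val⟩ with hι
  set ι' : C(Punctured (Orbits hφ.involutive), ℂ × Orbits hφ.involutive) :=
    ⟨Subtype.val, continuous_subtype_val⟩ with hι'
  have hmem : cmap ι 3 θ ∈ Cs {({0}ᶜ : Set ℂ) ×ˢ (Set.univ : Set S)} 3 :=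
    cmap_mem ι (A := Set.univ) (B := ({0}ᶜ : Set ℂ) ×ˢ (Set.univ : Set S)) (fun p _ => ⟨p.2, Set.mem_univ _⟩) (mem_Cs_univ θ)
  obtain ⟨e, he, hbe⟩ := exists_bd_punctured hasCharts_surface
    (fun G _ => hφ.vanOn_orbits G) q hz.bd_eq_zero ((isFundamentalClass_iff hz).1 hσ s) hw hmem
    (by rw [← cmap_bd, hθ, map_zero])
  have hsub : ({0}ᶜ : Set ℂ) ×ˢ (Set.univ : Set (Orbits hφ.involutive)) = Subtype.val ''
      (Set.univ : Set (Punctured (Orbits hφ.involutive))) := by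
    ext p
    simp
  rw [hsub] at he
  obtain ⟨e, -, rfl⟩ := exists_cmap_eq Topology.IsEmbedding.subtypeVal he
  set q' : C(Punctured S, Punctured (Orbits hφ.involutive)) :=
    ⟨fun p => ⟨(p.1.1, q p.1.2), p.2⟩, by fun_prop⟩ with hq'
  have hbe' : bd 3 e = cmap q' 3 θ := by
    refine cmap_injective (f := ι') Subtype.val_injective 3 ?_
    rw [cmap_bd, hbe, cmap_cmap, cmap_cmap]
    rfl
  set b : C(Punctured (Orbits hφ.involutive), η.Construction φ hφ.involutive) :=
    (η.ofCircleOrbits hφ.involutive φ.continuous).comp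
      ((argCircle _).prodMk ⟨fun p => p.1.2, by fun_prop⟩) with hb
  have hcomp : b.comp q' = J.comp (radial S) := by
    ext p
    exact η.ofCircleOrbits_apply hφ.involutive φ.continuous (argCircle S p) p.1.2
  -- The radial prism has boundary `J θ - J (radial θ)`, and `J (radial θ) = b (q' θ)` is bounded by
  -- the image of `e`.
  refine ⟨cmap J 4 (prism (radialHtpy S) 3 θ) + cmap b 4 e, Submodule.add_mem _ ?_ ?_, ?_⟩
  · exact cmap_mem J (A := Set.univ) (fun p _ => Set.mem_range_self (f := J) p) (mem_Cs_univ _)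
  · exact cmap_mem b (A := Set.univ)
      (fun p _ => η.range_ofCircleOrbits hφ.involutive φ.continuous (Set.mem_range_self _)) (mem_Cs_univ _)
  · rw [map_add, ← cmap_bd, ← cmap_bd, hbe', bd_prism, hθ, map_zero, sub_zero, cmap_cmap, hcomp,
      cmap_id, map_sub, cmap_cmap, sub_add_cancel]

/-- A cocycle which vanishes on the surface is cohomologous to a cocycle which vanishes on the
tubular neighbourhood. -/
theorem exists_vanishing_on_tube (η : FramedSurface S M) (hσ : IsFundamentalClass 2 σ)
    {z : Ch 2 S} (hz : Sing.Rep z σ) {a : Co 2 M ℤ} (ha : cb 2 a = 0)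
    (h : ev a (cmap η.emb 2 z) = 0) :
    ∃ b : Co 1 M ℤ, AgreeOn (Set.range η.toFun) (a - cb 1 b) 0 := by
  obtain ⟨s⟩ := (inferInstance : Nonempty S)
  set f : C(ℂ × S, M) := ⟨η.toFun, η.continuous_toFun⟩ with hf
  obtain ⟨b₀, hb₀⟩ := exists_primitive_surface hasCharts_surface hz.bd_eq_zero
    ((isFundamentalClass_iff hz).1 hσ s) (c := pull η.emb 2 a)
    (by rw [cb_pull, ha]; rfl) (by rw [ev_pull, h])
  obtain ⟨b₁, hb₁⟩ := exists_primitive_of_homotopy (contraction (0 : ℂ) S) (A := Set.univ)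
    (B := Set.univ) (fun _ _ _ => trivial) (c := pull f 2 a)
    (by rw [cb_pull, ha]; exact AgreeOn.refl _ _)
  -- `b₁` retracts the tube to `Σ` and `b₀` is a primitive on `Σ`. Extended to `M`, their sum makes
  -- `a - cb 1 b` zero on the tube as a cochain, not only in cohomology.
  obtain ⟨b, hb⟩ := exists_pull_eq (f := f) η.injective (b₁ + pull ContinuousMap.snd 1 b₀)
  refine ⟨b, ?_⟩
  rw [← Set.image_univ]
  refine agreeOn_image (W := Set.univ) η.isOpenEmbedding.isEmbedding ?_
  change AgreeOn _ (pull f 2 a - pull f 2 (cb 1 b)) 0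
  rw [← cb_pull, hb, cb_add, cb_pull, ← hb₀, ← hb₁.eq]
  exact AgreeOn.of_eq (sub_eq_zero.2 (sub_add_cancel (pull f 2 a) _).symm)

end ZTwo

end


/-! ### A fundamental cycle and a class of odd square on the construction -/

noncomputable section

namespace ZTwo

/-! ### The intersection form of the `ℤ₂`-construction -/

open SingularHomology Sing

namespace FramedSurface

variable {S M : Type u} [TopologicalSpace S] [TopologicalSpace M]
  [ChartedSpace (EuclideanSpace ℝ (Fin 2)) S] [ChartedSpace (EuclideanSpace ℝ (Fin 4)) M]

/-- The complement of the closed tubular neighbourhood. -/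
def outside (η : FramedSurface S M) : Set M :=
  (η.toFun '' (Metric.closedBall 0 1 ×ˢ Set.univ))ᶜ

/-- The inclusion of the complement of the closed tubular neighbourhood. -/
def ofOutside (η : FramedSurface S M) (u : η.outside) : η.Complement :=
  ⟨u.1, by
    rintro ⟨t, ht⟩
    exact u.2 ⟨(0, t), ⟨Metric.mem_closedBall_self zero_le_one, trivial⟩, ht⟩⟩

variable [CompactSpace S] [T2Space M]

theorem isOpen_outside (η : FramedSurface S M) : IsOpen η.outside :=
  (η.isClosed_range_closedBall 1).isOpen_compl

theorem outside_union_range (η : FramedSurface S M) :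
    η.outside ∪ Set.range η.toFun = Set.univ := by
  rw [Set.eq_univ_iff_forall]
  intro u
  by_cases h : u ∈ η.outside
  · exact Or.inl h
  · obtain ⟨p, -, hp⟩ := not_not.1 h
    exact Or.inr ⟨p, hp⟩

theorem isOpenEmbedding_ofOutside (η : FramedSurface S M) :
    Topology.IsOpenEmbedding η.ofOutside :=
  .of_comp _ η.isOpenEmbedding_val η.isOpen_outside.isOpenEmbedding_subtypeVal

variable [CompactSpace M] {φ : S → S} (hφ : Function.Involutive φ)

/-- The reflection of a point of radius greater than one has radius less than one, so no two points
outside the closed tube are identified. -/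
theorem isOpenEmbedding_foldOutside (η : FramedSurface S M) (hc : Continuous φ) :
    Topology.IsOpenEmbedding (η.fold hφ hc ∘ η.ofOutside) := by
  refine .of_continuous_injective_isOpenMap
    ((η.isOpenQuotientMap_fold hφ hc).continuous.comp η.isOpenEmbedding_ofOutside.continuous) ?_
    ((η.isOpenQuotientMap_fold hφ hc).isOpenMap.comp η.isOpenEmbedding_ofOutside.isOpenMap)
  intro u v h
  have hn : ∀ (w : η.outside) (p : Punctured S), η.ofOutside w = η.tube p → 1 < ‖p.1.1‖ := by
    intro w p hp
    by_contra h
    exact w.2 ⟨p.1, ⟨mem_closedBall_zero_iff.2 (not_lt.1 h), trivial⟩,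
      (congrArg (fun u : η.Complement => u.1) hp).symm⟩
  obtain h | ⟨p, h1, h2⟩ := (η.fold_eq_iff hφ hc).1 h
  · exact (η.isOpenEmbedding_ofOutside.injective h).symm
  · have h3 := hn u p h1
    have h4 := hn v _ h2
    rw [norm_reflect] at h4
    exact absurd h4 (not_lt.2 (inv_le_one_of_one_le₀ h3.le))

theorem range_foldOutside_union (η : FramedSurface S M) (hc : Continuous φ) :
    Set.range (η.fold hφ hc ∘ η.ofOutside) ∪ Set.range (η.foldTube hφ hc) = Set.univ := by
  rw [Set.eq_univ_iff_forall]
  intro x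
  obtain ⟨u, rfl⟩ := (η.isOpenQuotientMap_fold hφ hc).surjective x
  by_cases h : u.1 ∈ η.outside
  · exact Or.inl ⟨⟨u.1, h⟩, rfl⟩
  · obtain ⟨p, -, hp⟩ := not_not.1 h
    have hp0 : p.1 ≠ 0 := fun h => u.2 ⟨p.2, by rw [← hp, ← Prod.mk.eta (p := p), h]; rfl⟩
    exact Or.inr ⟨⟨p, hp0⟩, congrArg (η.fold hφ hc) (Subtype.ext hp)⟩

theorem mem_range_of_fold_mem (η : FramedSurface S M) (hc : Continuous φ) {u : η.Complement}
    (h : η.fold hφ hc u ∈ Set.range (η.foldTube hφ hc)) : u ∈ Set.range η.tube := by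
  obtain ⟨p, hp⟩ := h
  obtain rfl | ⟨q, -, h2⟩ := (η.fold_eq_iff hφ hc).1 hp
  · exact ⟨p, rfl⟩
  · exact ⟨_, h2.symm⟩

theorem isOpen_range_foldTube (η : FramedSurface S M) (hc : Continuous φ) :
    IsOpen (Set.range (η.foldTube hφ hc)) :=
  ((η.isOpenQuotientMap_fold hφ hc).isOpenMap.comp η.isOpenEmbedding_tube.isOpenMap).isOpen_range

omit [CompactSpace S] [T2Space M] in
-- Otherwise `ℂ × S` would be compact. A point off the whole open tube is needed to compare the
-- orientations of `M` and of the construction.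
theorem exists_notMem_range (η : FramedSurface S M) [Nonempty S] :
    ∃ u, u ∉ Set.range η.toFun := by
  by_contra! h
  have := (η.isOpenEmbedding.toHomeomorphOfSurjective h).symm.surjective.compactSpace
    (η.isOpenEmbedding.toHomeomorphOfSurjective h).symm.continuous
  have := Prod.fst_surjective.compactSpace (continuous_fst (X := ℂ) (Y := S))
  exact noncompact_univ ℂ isCompact_univ

end FramedSurface

open FramedSurface

variable {S M : Type u} [TopologicalSpace S] [TopologicalSpace M] [T2Space S]
  [ChartedSpace (EuclideanSpace ℝ (Fin 2)) S] [ChartedSpace (EuclideanSpace ℝ (Fin 4)) M]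
  [CompactSpace S] [T2Space M] [CompactSpace M] [ConnectedSpace S]
  {σ : H 2 S} {φ : C(S, S)}

/-- The decomposition of a cycle of `M` along the boundary of the tubular neighbourhood. -/
theorem exists_cut (η : FramedSurface S M) {m : Ch 4 M} (hm : bd 3 m = 0) :
    ∃ (c : Ch 4 η.outside) (d w : _) (θ : Ch 3 (Punctured S)),
      m = cmap ⟨Subtype.val, continuous_subtype_val⟩ 4 c + d + bd 4 w ∧
      d ∈ Cs {Set.range η.toFun} 4 ∧ bd 2 θ = 0 ∧
      cmap ⟨η.ofOutside, η.isOpenEmbedding_ofOutside.continuous⟩ 3 (bd 3 c) =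
        cmap ⟨η.tube, η.isOpenEmbedding_tube.continuous⟩ 3 θ := by
  set i : C(η.outside, M) := ⟨Subtype.val, continuous_subtype_val⟩ with hi
  have hV := η.isOpenEmbedding.isOpen_range
  obtain ⟨y, hy, d, hd, hyd⟩ := exists_add_of_mem_Cs (toSmall_mem (n := 3) (x := m)
    η.isOpen_outside hV (by rw [η.outside_union_range]; exact mem_Cs_univ m))
  rw [show η.outside = Subtype.val '' (Set.univ : Set η.outside) by simp] at hy
  obtain ⟨c, -, rfl⟩ := exists_cmap_eq Topology.IsEmbedding.subtypeVal hy
  have h1 : bd 3 (cmap i 4 c) = - bd 3 d := by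
    rw [eq_neg_iff_add_eq_zero, ← map_add, ← hyd, bd_toSmall, hm, map_zero]
  rw [toSmall_apply, hm, map_zero, sub_zero, sub_eq_iff_eq_add] at hyd
  set j : C(Punctured S, M) := ⟨fun p => (η.tube p).1,
    continuous_subtype_val.comp η.isOpenEmbedding_tube.continuous⟩ with hj
  have hje : Topology.IsEmbedding j :=
    Topology.IsEmbedding.subtypeVal.comp η.isOpenEmbedding_tube.isEmbedding
  have h2 : bd 3 (cmap i 4 c) ∈ Cs {j '' Set.univ} 3 := by
    -- As `m` is a cycle, the boundary of the outer part is minus the boundary of the inner part. It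
    -- lies in both sets, hence in the punctured tube.
    have h3 : bd 3 (cmap i 4 c) ∈ Cs {η.outside ∩ Set.range η.toFun} 3 := by
      rw [Cs_inter]
      refine ⟨(isLocal_bd 3).mem (cmap_mem i (A := Set.univ) (fun u _ => u.2) (mem_Cs_univ c)), ?_⟩
      rw [h1]
      exact Submodule.neg_mem _ ((isLocal_bd 3).mem hd)
    refine Cs_singleton_mono ?_ _ h3
    rintro _ ⟨h4, p, rfl⟩
    refine ⟨⟨p, fun h => h4 ⟨p, ⟨?_, trivial⟩, rfl⟩⟩, trivial, rfl⟩
    rw [h]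
    exact Metric.mem_closedBall_self zero_le_one
  obtain ⟨θ, -, hθ⟩ := exists_cmap_eq hje h2
  refine ⟨c, d, _, θ, hyd, hd, ?_, ?_⟩
  · refine cmap_injective (f := j) hje.injective 2 ?_
    have h5 : cmap j 3 θ = bd 3 (cmap i 4 c) := hθ
    rw [cmap_bd, h5, bd_bd, map_zero]
  · refine cmap_injective (f := (⟨Subtype.val, continuous_subtype_val⟩ : C(η.Complement, M)))
      Subtype.val_injective 3 ?_
    rw [cmap_cmap, cmap_cmap]
    refine Eq.trans ?_ hθ.symm
    rw [← cmap_bd]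
    rfl

theorem hasOddIntersectionForm_of_cocycle [PreconnectedSpace M] {μ : H 4 M} (hμ : IsFundamentalClass 4 μ)
    (hσ : IsFundamentalClass 2 σ) (η : FramedSurface S M) (hφ : IsReversingFreeInvolution σ φ)
    [PreconnectedSpace (η.Construction φ hφ.involutive)]
    (a : Cocycle 2 M) (h0 : pairing a (push 2 η.emb σ) = 0) (ha : Odd (intersectionForm μ a a)) :
    HasOddIntersectionForm (η.Construction φ hφ.involutive) := by
  obtain ⟨m, hm⟩ := Rep.exists_rep μ
  obtain ⟨z, hz⟩ := Rep.exists_rep σ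
  haveI := η.t2Space_construction hφ.involutive φ.continuous
  have hca := isCocycle_iff.1 a.2
  rw [pairing_eq a (hz.push η.emb)] at h0
  rw [intersectionForm, pairing_eq _ hm, ofCochain_cup] at ha
  obtain ⟨b, hb⟩ := exists_vanishing_on_tube η hσ hz hca h0
  rw [← ev_cup_sub hca b hm.bd_eq_zero] at ha
  set a' := ofCochain a.1 - cb 1 b with ha'
  have hca' : cb 2 a' = 0 := by rw [cb_sub, hca, cb_cb, sub_zero]
  obtain ⟨c, d, w, θ, hmc, hd, hθ, hcθ⟩ := exists_cut η hm.bd_eq_zero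
  set i : C(η.outside, M) := ⟨Subtype.val, continuous_subtype_val⟩ with hi
  have hκ := η.isOpenEmbedding_foldOutside hφ.involutive φ.continuous
  set κ : C(η.outside, η.Construction φ hφ.involutive) := ⟨_, hκ.continuous⟩ with hκd
  -- The square of `a'` vanishes on `d`, which lies in the tube, and on the boundary of `w`, so its
  -- value on `m` is its value on `c`.
  have hodd : Odd (ev (cup (pull i 2 a') (pull i 2 a')) c) := by
    rw [hmc, map_add, map_add, ← ev_cb, cb_cup_eq_zero hca' hca', ev_zero, add_zero,
      (hb.cup hb).ev_eq hd] at ha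
    rw [← pull_cup, ev_pull]
    convert ha using 1
    rw [show cup (0 : Co 2 M ℤ) 0 = 0 by ext s; simp [cup], ev_zero, add_zero]
  obtain ⟨e, he, hbe⟩ := exists_bd_foldTube η hσ hφ hθ
  set F : C(η.Complement, η.Construction φ hφ.involutive) :=
    ⟨_, (η.isOpenQuotientMap_fold hφ.involutive φ.continuous).continuous⟩ with hF
  -- The boundary of the image of `c` is the image of `θ`, which `e` fills in.
  have hzX : bd 3 (cmap κ 4 c - e) = 0 := by
    rw [map_sub, hbe, ← cmap_bd, sub_eq_zero]
    have := congrArg (cmap F 3) hcθ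
    rwa [cmap_cmap, cmap_cmap] at this
  -- the orientation
  have hgen : ∀ x, GeneratesAt 3 (cmap κ 4 c - e) x := by
    obtain ⟨u, hu⟩ := η.exists_notMem_range
    have huo : u ∈ η.outside := by
      rintro ⟨p, -, hp⟩
      exact hu ⟨p, hp⟩
    refine (η.hasCharts_construction hφ.involutive φ.continuous hφ.free).induction
      (Q := fun x => GeneratesAt 3 (cmap κ 4 c - e) x)
      (fun ε hε p p' h => GeneratesAt.move hε hzX p p' h) (x := κ ⟨u, huo⟩) ?_
    -- At a point off the tube neither `d` nor `e` contributes, so both cycles are locally given by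
    -- `c`.
    refine GeneratesAt.transfer (zM := m) (c := c) η.isOpen_outside.isOpenEmbedding_subtypeVal hκ
      (o := ⟨u, huo⟩) ?_ ?_ ((isFundamentalClass_iff hm).1 hμ _)
    · rw [hmc, add_assoc, add_sub_cancel_left]
      refine Submodule.add_mem _ (mem_Rel_of_mem (Cs_singleton_mono ?_ _ hd)) (bd_mem_Rel _ _)
      rintro _ hv rfl
      exact hu hv
    · rw [sub_sub_cancel_left]
      refine Submodule.neg_mem _ (mem_Rel_of_mem (Cs_singleton_mono ?_ _ he))
      rintro _ hv rfl
      obtain ⟨p, hp⟩ := η.mem_range_of_fold_mem hφ.involutive φ.continuous hv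
      exact hu ⟨p.1, congrArg (fun u : η.Complement => u.1) hp⟩
  -- the cocycle
  obtain ⟨a₁, ha₁⟩ := exists_pull_eq (f := κ) hκ.injective (pull i 2 a')
  set R := Set.range (η.foldTube hφ.involutive φ.continuous) with hR
  have hglue : AgreeOn (Set.range κ ∩ R) a₁ 0 := by
    have h : Set.range κ ∩ R = κ '' (i ⁻¹' Set.range η.toFun) := by
      ext x
      constructor
      · rintro ⟨⟨v, rfl⟩, hv⟩
        obtain ⟨p, hp⟩ := η.mem_range_of_fold_mem hφ.involutive φ.continuous hv
        exact ⟨v, ⟨p.1, congrArg (fun u : η.Complement => u.1) hp⟩, rfl⟩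
      · rintro ⟨v, ⟨p, hp⟩, rfl⟩
        refine ⟨⟨v, rfl⟩, ?_⟩
        have hp0 : p.1 ≠ 0 := fun h => (η.ofOutside v).2
          ⟨p.2, by
            change η.toFun (0, p.2) = v.1
            rw [← h]
            exact hp⟩
        exact ⟨⟨p, hp0⟩, congrArg (η.fold hφ.involutive φ.continuous) (Subtype.ext hp)⟩
    rw [h]
    refine agreeOn_image hκ.isEmbedding ?_
    rw [show pull _ 2 a₁ = pull i 2 a' from ha₁]
    exact hb.pull (f := i) (Set.mapsTo_preimage _ _)
  -- Extension by zero over the image `R` of the tube. It is consistent because `a'` is zero on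
  -- every simplex in the tube.
  obtain ⟨a₂, h1, h2⟩ := exists_glue hglue
  have hc1 : AgreeOn (Set.range κ) (cb 2 a₂) 0 := by
    rw [← Set.image_univ]
    refine agreeOn_image (W := Set.univ) hκ.isEmbedding ?_
    rw [← cb_pull]
    have h3 : AgreeOn Set.univ (pull κ 2 a₂) (pull i 2 a') := by
      rw [← ha₁]
      exact h1.pull fun v _ => Set.mem_range_self v
    refine h3.cb.trans ?_
    rw [cb_pull, hca']
    exact AgreeOn.refl _ _
  have hc2 : AgreeOn R (cb 2 a₂) 0 := h2.cb.trans (AgreeOn.of_eq (by ext s; simp [cb_apply, ev_zero]))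
  obtain ⟨a₃, h4, h5, h6⟩ := exists_extension (hκ.isOpen_range)
    (η.isOpen_range_foldTube hφ.involutive φ.continuous) hc1 hc2
  rw [show Set.range (η.fold hφ.involutive φ.continuous ∘ η.ofOutside) ∪ _ = Set.univ from
    η.range_foldOutside_union hφ.involutive φ.continuous] at h4
  have ha3 : cb 2 a₃ = 0 := h4.eq
  have hofc : ofCochain (fun s => a₃ (tb.symm s)) = a₃ :=
    funext fun s => congrArg a₃ (tb.symm_apply_apply s)
  obtain ⟨h, hh⟩ := Rep.exists_class hzX
  refine ⟨h, (isFundamentalClass_iff hh).2 hgen,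
    ⟨fun s => a₃ (tb.symm s), isCocycle_iff.2 (by rw [hofc, ha3])⟩, ?_⟩
  rw [intersectionForm, pairing_eq _ hh, ofCochain_cup, hofc, map_sub]
  -- The filling `e` lies in `R`, where `a₃` vanishes, so the square is evaluated on `c` alone.
  have h7 : AgreeOn R a₃ 0 := h6.trans h2
  rw [(h7.cup h7).ev_eq he, show cup (0 : Co 2 (η.Construction φ hφ.involutive) ℤ) 0 = 0 by
    ext s; simp [cup], ev_zero, sub_zero, ← ev_pull, pull_cup]
  have h8 : pull κ 2 a₃ = pull i 2 a' := by
    rw [← ha₁]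
    exact ((h5.trans h1).pull (V := Set.univ) fun v _ => Set.mem_range_self v).eq
  rwa [h8]

end ZTwo

end


/-! ### Holonomies as a replacement for van Kampen's theorem -/

noncomputable section

namespace Sing

/-! ### Holonomies -/

section Holonomy

variable {X Z G : Type*} [TopologicalSpace X] [TopologicalSpace Z] [Group G]

/-- A function on paths with values in a group which is multiplicative for the squares that lie in
one of the given sets. -/
structure IsHolonomy (W : Set (Set Z)) (c : C(unitInterval, Z) → G) : Prop where
  const : ∀ z, c (ContinuousMap.const _ z) = 1
  square : ∀ Q : C(unitInterval × unitInterval, Z), (∃ A ∈ W, ∀ p, Q p ∈ A) →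
    ∀ b r l t : C(unitInterval, Z), (∀ x, b x = Q (x, 0)) → (∀ y, r y = Q (1, y)) →
      (∀ y, l y = Q (0, y)) → (∀ x, t x = Q (x, 1)) → c b * c r = c l * c t

variable {W : Set (Set Z)} {c : C(unitInterval, Z) → G}

namespace IsHolonomy

theorem const' (h : IsHolonomy W c) {γ : C(unitInterval, Z)} {z : Z} (hγ : ∀ x, γ x = z) :
    c γ = 1 := by
  rw [show γ = ContinuousMap.const _ z from ContinuousMap.ext hγ, h.const]

theorem gauge (h : IsHolonomy W c) (f : Z → G) :
    IsHolonomy W fun γ => f (γ 0) * c γ * (f (γ 1))⁻¹ where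
  const z := by simp [h.const]
  square Q hQ b r l t hb hr hl ht := by
    have := h.square Q hQ b r l t hb hr hl ht
    rw [show r 0 = b 1 by rw [hr, hb], show t 0 = l 1 by rw [ht, hl],
      show b 0 = l 0 by rw [hl, hb], show r 1 = t 1 by rw [hr, ht]]
    calc _ = f (l 0) * (c b * c r) * (f (t 1))⁻¹ := by group
      _ = _ := by
        rw [this]
        group

theorem comp (h : IsHolonomy W c) (f : C(X, Z)) {A : Set Z} (hA : A ∈ W) (hf : ∀ x, f x ∈ A) :
    IsHolonomy {Set.univ} fun γ : C(unitInterval, X) => c (f.comp γ) where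
  const x := h.const' (z := f x) fun _ => rfl
  square Q _ b r l t hb hr hl ht := h.square (f.comp Q) ⟨A, hA, fun _ => hf _⟩ _ _ _ _
    (fun x => congrArg f (hb x)) (fun x => congrArg f (hr x)) (fun x => congrArg f (hl x))
    (fun x => congrArg f (ht x))

/-- The path that runs through a part of a path. -/
def subpath (γ : C(ℝ, Z)) (a b : ℝ) : C(unitInterval, Z) :=
  ⟨fun x => γ ((1 - x) * a + x * b), by fun_prop⟩

theorem subpath_mul (h : IsHolonomy W c) {A : Set Z} (hA : A ∈ W) (γ : C(ℝ, Z)) (a b d : ℝ)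
    (hγ : ∀ x, γ x ∈ A) :
    c (subpath γ a b) * c (subpath γ b d) = c (subpath γ a d) := by
  -- A square whose left side is collapsed to `γ a`: the bottom runs from `a` to `b`, the right side
  -- from `b` to `d`, and the top from `a` to `d`.
  have := h.square ⟨fun p => γ ((1 - p.1) * a + p.1 * ((1 - p.2) * b + p.2 * d)), by fun_prop⟩
    ⟨A, hA, fun _ => hγ _⟩ (subpath γ a b) (subpath γ b d) (ContinuousMap.const _ (γ a))
    (subpath γ a d) (fun x => by simp [subpath]) (fun x => by simp [subpath])
    (fun x => by simp) (fun x => by simp [subpath])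
  rwa [h.const, one_mul] at this

/-- A Lebesgue number for the unit square. `Q` is constant along the clamping to this square, so the
indices `i, j` need no upper bound. -/
theorem exists_grid {A B : Set Z} (hA : IsOpen A) (hB : IsOpen B) (hAB : A ∪ B = Set.univ)
    (Q : C(ℝ × ℝ, Z)) (hQ : ∀ x y, Q (x, y) =
      Q (Set.projIcc 0 1 zero_le_one x, Set.projIcc 0 1 zero_le_one y)) :
    ∃ N : ℕ, 0 < N ∧ ∀ i j : ℕ, ∃ D ∈ ({A, B} : Set (Set Z)), ∀ x y : unitInterval,
      Q ((i + x) / N, (j + y) / N) ∈ D := by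
  have hc : IsCompact ((Set.Icc 0 1 : Set ℝ) ×ˢ (Set.Icc 0 1 : Set ℝ)) :=
    isCompact_Icc.prod isCompact_Icc
  obtain ⟨δ, hδ, h⟩ := lebesgue_number_lemma_of_metric (c := fun i : Bool => Q ⁻¹' (cond i A B)) hc
    (by rintro (_ | _); exacts [hB.preimage Q.continuous, hA.preimage Q.continuous]) (by
    intro p _
    rw [Set.mem_iUnion]
    have : Q p ∈ A ∪ B := hAB ▸ trivial
    exact this.elim (fun h => ⟨true, h⟩) fun h => ⟨false, h⟩)
  obtain ⟨N, hN⟩ := exists_nat_gt δ⁻¹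
  have hN0 : (0 : ℝ) < N := (inv_pos.2 hδ).trans hN
  refine ⟨N, by exact_mod_cast hN0, fun i j => ?_⟩
  obtain ⟨k, hk⟩ := h ((Set.projIcc 0 1 zero_le_one (i / N : ℝ) : ℝ),
    (Set.projIcc 0 1 zero_le_one (j / N : ℝ) : ℝ)) ⟨Subtype.prop _, Subtype.prop _⟩
  have hd : ∀ (i : ℕ) (x : unitInterval), dist (Set.projIcc (0 : ℝ) 1 zero_le_one ((i + x) / N) : ℝ)
      (Set.projIcc 0 1 zero_le_one (i / N : ℝ)) < δ := by
    intro i x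
    have h1 : dist (Set.projIcc (0 : ℝ) 1 zero_le_one ((i + x) / N) : ℝ)
      (Set.projIcc 0 1 zero_le_one (i / N : ℝ)) ≤ dist ((i + x) / N : ℝ) (i / N : ℝ) := by
      have := (LipschitzWith.projIcc (zero_le_one (α := ℝ))).dist_le_mul
        ((i + x) / N : ℝ) (i / N : ℝ)
      rwa [NNReal.coe_one, one_mul] at this
    refine h1.trans_lt ?_
    rw [Real.dist_eq, ← sub_div, add_sub_cancel_left, abs_of_nonneg (div_nonneg x.2.1 hN0.le)]
    calc (x : ℝ) / N ≤ 1 / N := by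
          have := x.2.2
          gcongr
      _ < δ := by
          rw [one_div]
          exact inv_lt_of_inv_lt₀ hδ hN
  refine ⟨cond k A B, by cases k <;> simp, fun x y => ?_⟩
  rw [hQ]
  exact hk (max_lt (hd i x) (hd j y))

/-- By the square relation, the product along one row of the grid equals the product along the next,
since the lateral edges are constant. The top row is constant, so the bottom row has trivial
holonomy. Only squares inside a member of `W` are used, as in van Kampen's theorem. -/
theorem eq_one_of_grid (h : IsHolonomy W c) {N : ℕ} (hN : 0 < N) (Q : C(ℝ × ℝ, Z)) {A : Set Z}
    (hA : A ∈ W) {z : Z}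
    (hQ : ∀ i j : ℕ, ∃ D ∈ W, ∀ x y : unitInterval, Q ((i + x) / N, (j + y) / N) ∈ D)
    (hb : ∀ x, Q (x, 0) ∈ A) (ht : ∀ x, Q (x, 1) = z) (hl : ∀ y, Q (0, y) = z)
    (hr : ∀ y, Q (1, y) = z) : c (subpath ⟨fun x => Q (x, 0), by fun_prop⟩ 0 1) = 1 := by
  have hN' : (N : ℝ) ≠ 0 := by exact_mod_cast hN.ne'
  set row : ℕ → C(ℝ, Z) := fun j => ⟨fun x => Q (x, j / N), by fun_prop⟩ with hrow
  set hor : ℕ → ℕ → G := fun i j => c (subpath (row j) (i / N) ((i + 1) / N)) with hhor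
  set ver : ℕ → ℕ → G := fun i j =>
    c (subpath ⟨fun y => Q (i / N, y), by fun_prop⟩ (j / N) ((j + 1) / N)) with hver
  have hsq : ∀ i j, hor i j * ver (i + 1) j = ver i j * hor i (j + 1) := by
    intro i j
    obtain ⟨D, hD, hQD⟩ := hQ i j
    refine h.square ⟨fun p => Q ((i + p.1) / N, (j + p.2) / N), by fun_prop⟩
      ⟨D, hD, fun p => hQD _ _⟩ _ _ _ _ ?_ ?_ ?_ ?_ <;> intro x <;>
      simp only [subpath, hrow, ContinuousMap.coe_mk, Set.Icc.coe_zero, Set.Icc.coe_one,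
        Nat.cast_add, Nat.cast_one, add_zero] <;> congr 2 <;> ring
  set P : ℕ → ℕ → G := fun n j => Nat.rec 1 (fun i g => g * hor i j) n with hP
  have hP1 : ∀ n j, P (n + 1) j = P n j * hor n j := fun _ _ => rfl
  have hmove : ∀ n j, P n j * ver n j = ver 0 j * P n (j + 1) := by
    intro n j
    induction n with
    | zero => exact (one_mul _).trans (mul_one _).symm
    | succ n ih => rw [hP1, hP1, mul_assoc, hsq, ← mul_assoc, ih, mul_assoc]
  have hv0 : ∀ j, ver 0 j = 1 := fun j => h.const' (z := z) fun y => by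
    simp [subpath, hl]
  have hvN : ∀ j, ver N j = 1 := fun j => h.const' (z := z) fun y => by
    simp [subpath, div_self hN', hr]
  have hconst : ∀ j, P N j = P N 0 := by
    intro j
    induction j with
    | zero => rfl
    | succ j ih =>
      have := hmove N j
      rw [hv0, hvN, one_mul, mul_one] at this
      rw [← this, ih]
  have htop : ∀ n, P n N = 1 := by
    intro n
    induction n with
    | zero => rfl
    | succ n ih =>
      rw [hP1, ih, one_mul]
      exact h.const' (z := z) fun x => by simp [subpath, hrow, div_self hN', ht]
  have hbot : ∀ n : ℕ, P n 0 = c (subpath (row 0) 0 (n / N)) := by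
    intro n
    induction n with
    | zero => exact (h.const' (z := Q (0, 0)) fun x => by simp [subpath, hrow]).symm
    | succ n ih =>
      rw [hP1, ih, Nat.cast_succ]
      exact h.subpath_mul hA _ _ _ _ fun x => by simpa [hrow] using hb x
  have := hbot N
  rw [← hconst N, htop, div_self hN'] at this
  rw [this]
  congr 2
  ext x
  simp [hrow]

/-- The holonomy of a loop in `A` which is null-homotopic in `A ∪ B` is trivial. -/
theorem eq_one_of_nullhomotopic {A B : Set Z} (hA : IsOpen A) (hB : IsOpen B)
    (hAB : A ∪ B = Set.univ) (h : IsHolonomy {A, B} c) {z : Z} {p : Path z z}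
    (hp : p.Homotopic (Path.refl z)) (hpA : ∀ x, p x ∈ A) : c p.toContinuousMap = 1 := by
  obtain ⟨F⟩ := hp
  set Q : C(ℝ × ℝ, Z) := ⟨fun q => F (Set.projIcc 0 1 zero_le_one q.2,
    Set.projIcc 0 1 zero_le_one q.1), F.continuous.comp (by fun_prop)⟩ with hQ
  obtain ⟨N, hN, hg⟩ := exists_grid hA hB hAB Q (fun x y => by simp [hQ])
  have hb : ∀ x, Q (x, 0) = p (Set.projIcc 0 1 zero_le_one x) := fun x => by
    change F (Set.projIcc 0 1 zero_le_one 0, _) = _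
    rw [Set.projIcc_left]
    exact F.apply_zero _
  have := h.eq_one_of_grid hN Q (Or.inl rfl) (z := z) hg (fun x => by rw [hb]; exact hpA _)
    (fun x => by
      change F (Set.projIcc 0 1 zero_le_one 1, _) = _
      rw [Set.projIcc_right]
      exact F.apply_one _)
    (fun y => by
      change F (_, Set.projIcc 0 1 zero_le_one 0) = _
      rw [Set.projIcc_left]
      exact F.source _)
    (fun y => by
      change F (_, Set.projIcc 0 1 zero_le_one 1) = _
      rw [Set.projIcc_right]
      exact F.target _)
  rw [← this]
  congr 1
  ext x
  simp [subpath, hb]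

/-- A holonomy which is trivial in `A` and in `B` is trivial in `A ∪ B`. -/
theorem eq_one_of_cover {A B : Set Z} (hA : IsOpen A) (hB : IsOpen B) (hAB : A ∪ B = Set.univ)
    (h : IsHolonomy {Set.univ} c) (h1 : ∀ γ : C(unitInterval, Z), (∀ x, γ x ∈ A) → c γ = 1)
    (h2 : ∀ γ : C(unitInterval, Z), (∀ x, γ x ∈ B) → c γ = 1) (γ : C(unitInterval, Z)) :
    c γ = 1 := by
  set γ' : C(ℝ, Z) := ⟨fun x => γ (Set.projIcc 0 1 zero_le_one x), by fun_prop⟩ with hγ'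
  obtain ⟨N, hN, hg⟩ := exists_grid hA hB hAB ⟨fun q => γ' q.1, by fun_prop⟩
    (fun x y => by simp [hγ'])
  have hN' : (N : ℝ) ≠ 0 := by exact_mod_cast hN.ne'
  have hs : ∀ n : ℕ, c (subpath γ' 0 (n / N)) = 1 := by
    intro n
    induction n with
    | zero => exact h.const' (z := γ' 0) fun x => by simp [subpath]
    | succ n ih =>
      rw [← h.subpath_mul (Set.mem_singleton _) γ' 0 (n / N) _ fun _ => trivial, ih, one_mul]
      obtain ⟨D, hD, hgD⟩ := hg n 0
      have h3 : ∀ x, subpath γ' (n / N) ((n + 1 : ℕ) / N) x ∈ D := fun x => by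
        have h4 : γ' ((n + x) / N) ∈ D := hgD x 0
        have h5 : (1 - (x : ℝ)) * (n / N) + x * ((n + 1 : ℕ) / N) = (n + x) / N := by
          push_cast
          ring
        rwa [← h5] at h4
      rcases hD with rfl | rfl
      · exact h1 _ h3
      · exact h2 _ h3
  have := hs N
  rw [div_self hN'] at this
  rw [← this]
  congr 1
  ext x
  simp [subpath, hγ']

theorem trans (h : IsHolonomy W c) {A : Set Z} (hA : A ∈ W) {x y z : Z} (p : Path x y)
    (q : Path y z) (hp : ∀ t, p t ∈ A) (hq : ∀ t, q t ∈ A) :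
    c p.toContinuousMap * c q.toContinuousMap = c (p.trans q).toContinuousMap := by
  have hm : ∀ t, (p.trans q).extend t ∈ A := by
    intro t
    change (p.trans q) (Set.projIcc 0 1 zero_le_one t) ∈ A
    rw [Path.trans_apply]
    split_ifs
    exacts [hp _, hq _]
  have := h.subpath_mul hA ⟨(p.trans q).extend, (p.trans q).continuous_extend⟩ 0 (1 / 2) 1 hm
  have e1 : subpath ⟨(p.trans q).extend, (p.trans q).continuous_extend⟩ 0 (1 / 2) =
      p.toContinuousMap := by
    ext t
    have h0 := t.2.1
    have h1 := t.2.2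
    simp only [subpath, ContinuousMap.coe_mk]
    rw [Path.extend_apply _ ⟨by linarith, by linarith⟩, Path.trans_apply, dif_pos (by
      change (1 - (t : ℝ)) * 0 + t * (1 / 2) ≤ 1 / 2
      linarith)]
    exact congrArg p (Subtype.ext (by change 2 * ((1 - (t : ℝ)) * 0 + t * (1 / 2)) = t; ring))
  have e2 : subpath ⟨(p.trans q).extend, (p.trans q).continuous_extend⟩ (1 / 2) 1 =
      q.toContinuousMap := by
    ext t
    have h0 := t.2.1
    have h1 := t.2.2
    simp only [subpath, ContinuousMap.coe_mk]
    rw [Path.extend_apply _ ⟨by linarith, by linarith⟩, Path.trans_apply]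
    split_ifs with h2
    · obtain rfl : t = 0 := Subtype.ext (by
        change (1 - (t : ℝ)) * (1 / 2) + t * 1 ≤ 1 / 2 at h2
        change (t : ℝ) = 0
        linarith)
      refine Eq.trans ?_ (p.target.trans q.source.symm)
      exact congrArg p (Subtype.ext (by norm_num))
    · refine congrArg q (Subtype.ext ?_)
      change 2 * ((1 - (t : ℝ)) * (1 / 2) + t * 1) - 1 = t
      ring
  have e3 : subpath ⟨(p.trans q).extend, (p.trans q).continuous_extend⟩ 0 1 =
      (p.trans q).toContinuousMap := by
    ext t
    simp [subpath]
  rwa [e1, e2, e3] at this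

theorem congr_homotopic (h : IsHolonomy {Set.univ} c) {x y : Z} {p q : Path x y}
    (hpq : p.Homotopic q) : c p.toContinuousMap = c q.toContinuousMap := by
  obtain ⟨F⟩ := hpq
  have := h.square ⟨fun r => F (r.2, r.1), by fun_prop⟩ ⟨_, rfl, fun _ => trivial⟩
    p.toContinuousMap (ContinuousMap.const _ y) (ContinuousMap.const _ x) q.toContinuousMap
    (fun t => (F.apply_zero t).symm) (fun t => (F.target t).symm) (fun t => (F.source t).symm)
    (fun t => (F.apply_one t).symm)
  rwa [h.const, h.const, one_mul, mul_one] at this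

/-- A holonomy of a simply connected space is a coboundary. -/
theorem exists_potential [SimplyConnectedSpace Z] (h : IsHolonomy {Set.univ} c) :
    ∃ f : Z → G, ∀ γ, f (γ 0) * c γ = f (γ 1) := by
  obtain ⟨x⟩ := (inferInstance : Nonempty Z)
  refine ⟨fun z => c (PathConnectedSpace.somePath x z).toContinuousMap, fun γ => ?_⟩
  have := h.trans rfl (PathConnectedSpace.somePath x (γ 0)) (⟨γ, rfl, rfl⟩ : Path (γ 0) (γ 1))
    (fun _ => trivial) (fun _ => trivial)
  exact this.trans (h.congr_homotopic (SimplyConnectedSpace.paths_homotopic _ _))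

end IsHolonomy

/-- The loop of a path, by means of a choice of paths from the base point. -/
def closeUp {x : Z} (δ : ∀ y, Path.Homotopic.Quotient x y) {y z : Z}
    (p : Path.Homotopic.Quotient y z) : (FundamentalGroup Z x)ᵐᵒᵖ :=
  .op (FundamentalGroup.fromPath (((δ y).trans p).trans (δ z).symm))

/-- The inner connecting paths cancel. Values are taken in the opposite group so that multiplication
follows the order of concatenation of paths. -/
theorem closeUp_mul {x : Z} (δ : ∀ y, Path.Homotopic.Quotient x y) {y z w : Z}
    (p : Path.Homotopic.Quotient y z) (q : Path.Homotopic.Quotient z w) :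
    closeUp δ p * closeUp δ q = closeUp δ (p.trans q) := by
  refine congrArg MulOpposite.op ?_
  change (((δ y).trans p).trans (δ z).symm).trans (((δ z).trans q).trans (δ w).symm) =
    ((δ y).trans (p.trans q)).trans (δ w).symm
  have h : (δ z).symm.trans (((δ z).trans q).trans (δ w).symm) = q.trans (δ w).symm := by
    rw [Path.Homotopic.Quotient.trans_assoc, ← Path.Homotopic.Quotient.trans_assoc,
      Path.Homotopic.Quotient.symm_trans, Path.Homotopic.Quotient.refl_trans]
  rw [Path.Homotopic.Quotient.trans_assoc, h]
  simp only [Path.Homotopic.Quotient.trans_assoc]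

theorem closeUp_refl {x : Z} (δ : ∀ y, Path.Homotopic.Quotient x y) (y : Z) :
    closeUp δ (Path.Homotopic.Quotient.refl y) = 1 := by
  rw [← MulOpposite.op_one, FundamentalGroup.one_def]
  simp [closeUp]

/-- The holonomy with values in the fundamental group. -/
theorem exists_holonomy [PathConnectedSpace Z] (x : Z) :
    ∃ c : C(unitInterval, Z) → (FundamentalGroup Z x)ᵐᵒᵖ, IsHolonomy {Set.univ} c ∧
      ∀ p : Path x x, c p.toContinuousMap = 1 ↔
        FundamentalGroup.fromPath (Path.Homotopic.Quotient.mk p) = 1 := by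
  set δ : ∀ y, Path.Homotopic.Quotient x y :=
    fun y => .mk (PathConnectedSpace.somePath x y) with hδ
  haveI : ContractibleSpace unitInterval :=
    (convex_Icc (0 : ℝ) 1).contractibleSpace ⟨0, by simp⟩
  refine ⟨fun γ => closeUp δ (.mk (⟨γ, rfl, rfl⟩ : Path (γ 0) (γ 1))),
    ⟨fun z => closeUp_refl δ z, ?_⟩, ?_⟩
  · intro Q _ b r l t hb hr hl ht
    obtain rfl : b = Q.comp ((ContinuousMap.id _).prodMk (.const _ 0)) := ContinuousMap.ext hb
    obtain rfl : r = Q.comp ((ContinuousMap.const _ 1).prodMk (.id _)) := ContinuousMap.ext hr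
    obtain rfl : l = Q.comp ((ContinuousMap.const _ 0).prodMk (.id _)) := ContinuousMap.ext hl
    obtain rfl : t = Q.comp ((ContinuousMap.id _).prodMk (.const _ 1)) := ContinuousMap.ext ht
    set b' : Path ((0, 0) : unitInterval × unitInterval) (1, 0) :=
      ⟨(ContinuousMap.id _).prodMk (.const _ 0), rfl, rfl⟩
    set r' : Path ((1, 0) : unitInterval × unitInterval) (1, 1) :=
      ⟨(ContinuousMap.const _ 1).prodMk (.id _), rfl, rfl⟩
    set l' : Path ((0, 0) : unitInterval × unitInterval) (0, 1) :=
      ⟨(ContinuousMap.const _ 0).prodMk (.id _), rfl, rfl⟩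
    set t' : Path ((0, 1) : unitInterval × unitInterval) (1, 1) :=
      ⟨(ContinuousMap.id _).prodMk (.const _ 1), rfl, rfl⟩
    -- The two ways around the boundary of the square are homotopic because the square is
    -- contractible. The relation is then pushed forward by `Q`.
    have e : Path.Homotopic.Quotient.mk (b'.trans r') = .mk (l'.trans t') := Subsingleton.elim _ _
    have e' := congrArg (fun p => Path.Homotopic.Quotient.map p Q) e
    have e1 : ∀ {p q s : unitInterval × unitInterval} (v : Path p q) (w : Path q s),
        Path.Homotopic.Quotient.map (.mk (v.trans w)) Q =
          (Path.Homotopic.Quotient.mk (v.map Q.continuous)).trans (.mk (w.map Q.continuous)) := by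
      intro p q s v w
      rw [← Path.Homotopic.Quotient.mk_trans, ← Path.map_trans]
      rfl
    simp only [e1] at e'
    have e2 := congrArg (closeUp δ) e'
    rw [← closeUp_mul, ← closeUp_mul] at e2
    exact e2
  · intro p
    have : ∀ {y z : Z} (hy : y = x) (hz : z = x) (q : Path y z) (hq : ∀ t, q t = p t),
        closeUp δ (Path.Homotopic.Quotient.mk q) = closeUp δ (Path.Homotopic.Quotient.mk p) := by
      rintro y z rfl rfl q hq
      rw [show q = p from Path.ext (funext hq)]
    change closeUp δ _ = 1 ↔ _
    rw [this p.source p.target _ fun _ => rfl]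
    rw [← MulOpposite.op_one]
    refine MulOpposite.op_inj.trans ?_
    rw [FundamentalGroup.one_def]
    constructor
    · intro h
      -- The chosen path `δ x` from `x` to itself need not be constant, so the value on `p` is a
      -- conjugate of `p`; here the conjugation is undone.
      have h' := congrArg (fun r : Path.Homotopic.Quotient x x =>
        ((δ x).symm.trans r).trans (δ x)) h
      change ((δ x).symm.trans (((δ x).trans (.mk p)).trans (δ x).symm)).trans (δ x) =
        ((δ x).symm.trans (.refl x)).trans (δ x) at h'
      rw [Path.Homotopic.Quotient.trans_assoc, Path.Homotopic.Quotient.trans_assoc,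
        Path.Homotopic.Quotient.symm_trans, Path.Homotopic.Quotient.trans_refl,
        Path.Homotopic.Quotient.trans_refl, ← Path.Homotopic.Quotient.trans_assoc,
        Path.Homotopic.Quotient.symm_trans, Path.Homotopic.Quotient.refl_trans] at h'
      exact h'
    · intro h
      change ((δ x).trans (Path.Homotopic.Quotient.mk p)).trans (δ x).symm = .refl x
      rw [show Path.Homotopic.Quotient.mk p = .refl x from h]
      simp

end Holonomy

end Sing

end


/-! ### Simple connectivity of the complement when the meridian is trivial -/

noncomputable section

namespace Sing

theorem HasCharts.pathConnectedSpace {E Y : Type*} [NormedAddCommGroup E] [NormedSpace ℝ E]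
    [TopologicalSpace Y] [ConnectedSpace Y] (h : HasCharts E Y) : PathConnectedSpace Y := by
  obtain ⟨y⟩ := (inferInstance : Nonempty Y)
  have hy : ∀ z, Joined y z := h.induction (Q := fun z => Joined y z)
    (fun ε hε p p' hp => hp.trans ((JoinedIn.joined (F := Set.univ)
      (JoinedIn.of_segment_subset (Set.subset_univ _))).map hε.continuous)) (Joined.refl y)
  exact ⟨⟨y⟩, fun z w => (hy z).symm.trans (hy w)⟩

section Holonomy

variable {K X Y Z G : Type*} [TopologicalSpace K] [TopologicalSpace X] [TopologicalSpace Y]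
  [TopologicalSpace Z] [Group G]

theorem exists_comp_eq {ε : C(X, Z)} (hε : Topology.IsEmbedding ε) (t : C(K, Z))
    (ht : ∀ p, t p ∈ Set.range ε) : ∃ s : C(K, X), ε.comp s = t := by
  refine ⟨⟨fun p => hε.toHomeomorph.symm ⟨t p, ht p⟩, hε.toHomeomorph.symm.continuous.comp
    (t.continuous.subtype_mk ht)⟩, ContinuousMap.ext fun p => ?_⟩
  exact congrArg Subtype.val (hε.toHomeomorph.apply_symm_apply ⟨t p, ht p⟩)

/-- Compatible holonomies of two subspaces. -/
theorem IsHolonomy.exists_union {ε : C(X, Z)} (hε : Topology.IsEmbedding ε) {δ : C(Y, Z)}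
    (hδ : Topology.IsEmbedding δ) (hZ : Set.range ε ∪ Set.range δ = Set.univ)
    {c : C(unitInterval, X) → G} (hc : IsHolonomy {Set.univ} c) {c' : C(unitInterval, Y) → G}
    (hc' : IsHolonomy {Set.univ} c') (h : ∀ γ γ', ε.comp γ = δ.comp γ' → c γ = c' γ') :
    ∃ d : C(unitInterval, Z) → G, IsHolonomy {Set.range ε, Set.range δ} d ∧
      ∀ γ, d (ε.comp γ) = c γ := by
  have hi : Function.Injective fun γ : C(unitInterval, X) => ε.comp γ := fun γ γ' h' =>
    ContinuousMap.ext fun t => hε.injective (DFunLike.congr_fun h' t)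
  have hi' : Function.Injective fun γ : C(unitInterval, Y) => δ.comp γ := fun γ γ' h' =>
    ContinuousMap.ext fun t => hδ.injective (DFunLike.congr_fun h' t)
  -- Paths contained in neither subspace get the value `1`. No condition tests them, since each
  -- admissible square lies in one of the two ranges.
  set d : C(unitInterval, Z) → G := Function.extend (fun γ : C(unitInterval, X) => ε.comp γ) c
    (Function.extend (fun γ : C(unitInterval, Y) => δ.comp γ) c' 1) with hd
  have h1 : ∀ γ, d (ε.comp γ) = c γ := fun γ => hi.extend_apply c _ γ
  have h2 : ∀ γ, d (δ.comp γ) = c' γ := by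
    intro γ
    by_cases hγ : ∃ γ', ε.comp γ' = δ.comp γ
    · obtain ⟨γ', hγ'⟩ := hγ
      rw [← hγ', h1, h γ' γ hγ']
    · rw [hd, Function.extend_apply' _ _ _ hγ]
      exact hi'.extend_apply c' _ γ
  refine ⟨d, ⟨fun z => ?_, ?_⟩, h1⟩
  · have : z ∈ Set.range ε ∪ Set.range δ := hZ ▸ trivial
    obtain ⟨x, rfl⟩ | ⟨y, rfl⟩ := this
    · rw [← hc.const x, ← h1]
      rfl
    · rw [← hc'.const y, ← h2]
      rfl
  · rintro Q ⟨_, rfl | rfl, hA⟩ b r l t hb hr hl ht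
    · obtain ⟨Q, rfl⟩ := exists_comp_eq hε Q hA
      obtain rfl : b = ε.comp (Q.comp ((ContinuousMap.id _).prodMk (.const _ 0))) :=
        ContinuousMap.ext hb
      obtain rfl : r = ε.comp (Q.comp ((ContinuousMap.const _ 1).prodMk (.id _))) :=
        ContinuousMap.ext hr
      obtain rfl : l = ε.comp (Q.comp ((ContinuousMap.const _ 0).prodMk (.id _))) :=
        ContinuousMap.ext hl
      obtain rfl : t = ε.comp (Q.comp ((ContinuousMap.id _).prodMk (.const _ 1))) :=
        ContinuousMap.ext ht
      simp only [h1]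
      exact hc.square Q ⟨_, rfl, fun _ => trivial⟩ _ _ _ _ (fun _ => rfl) (fun _ => rfl)
        (fun _ => rfl) (fun _ => rfl)
    · obtain ⟨Q, rfl⟩ := exists_comp_eq hδ Q hA
      obtain rfl : b = δ.comp (Q.comp ((ContinuousMap.id _).prodMk (.const _ 0))) :=
        ContinuousMap.ext hb
      obtain rfl : r = δ.comp (Q.comp ((ContinuousMap.const _ 1).prodMk (.id _))) :=
        ContinuousMap.ext hr
      obtain rfl : l = δ.comp (Q.comp ((ContinuousMap.const _ 0).prodMk (.id _))) :=
        ContinuousMap.ext hl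
      obtain rfl : t = δ.comp (Q.comp ((ContinuousMap.id _).prodMk (.const _ 1))) :=
        ContinuousMap.ext ht
      simp only [h2]
      exact hc'.square Q ⟨_, rfl, fun _ => trivial⟩ _ _ _ _ (fun _ => rfl) (fun _ => rfl)
        (fun _ => rfl) (fun _ => rfl)

end Holonomy

end Sing

namespace ZTwo.FramedSurface

open Sing

variable {S M : Type u} [TopologicalSpace S] [TopologicalSpace M]
  [ChartedSpace (EuclideanSpace ℝ (Fin 2)) S] [ChartedSpace (EuclideanSpace ℝ (Fin 4)) M]

/-! ### The complement of the surface -/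

/-- The universal covering of the punctured plane, times a surface. -/
def expProd (S : Type u) [TopologicalSpace S] : C(ℂ × S, Punctured S) where
  toFun p := ⟨(Complex.exp p.1, p.2), Complex.exp_ne_zero _⟩
  continuous_toFun := Continuous.subtype_mk (by fun_prop) _

theorem expProd_log (p : Punctured S) : expProd S (Complex.log p.1.1, p.1.2) = p :=
  Subtype.ext (Prod.ext (Complex.exp_log p.2) rfl)

theorem expProd_surjective : Function.Surjective (expProd S) := fun p =>
  ⟨_, expProd_log p⟩

/-- Path lifting for the covering `Complex.exp`; the component in `S` is left as it is. -/
theorem exists_expProd_eq (γ : C(unitInterval, Punctured S)) :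
    ∃ δ : C(unitInterval, ℂ × S), (expProd S).comp δ = γ := by
  set w : C(unitInterval, {z : ℂ // z ≠ 0}) := ⟨fun t => ⟨(γ t).1.1, (γ t).2⟩, by fun_prop⟩ with hw
  obtain ⟨ζ, hζ, -⟩ := Complex.isCoveringMap_exp.exists_path_lifts w (Complex.log (w 0).1)
    (Subtype.ext (Complex.exp_log (w 0).2).symm)
  refine ⟨ζ.prodMk ⟨fun t => (γ t).1.2, by fun_prop⟩, ContinuousMap.ext fun t => ?_⟩
  refine Subtype.ext (Prod.ext ?_ rfl)
  exact congrArg Subtype.val (congrFun hζ t)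

theorem pathConnectedSpace_surface [ConnectedSpace S] : PathConnectedSpace S :=
  (hasCharts_of_chartedSpace (E := EuclideanSpace ℝ (Fin 2))).pathConnectedSpace

theorem pathConnectedSpace_punctured [ConnectedSpace S] : PathConnectedSpace (Punctured S) :=
  haveI := pathConnectedSpace_surface (S := S)
  expProd_surjective.pathConnectedSpace (expProd S).continuous

variable [CompactSpace S] [T2Space M]

theorem nonempty_complement [Nonempty S] (η : FramedSurface S M) : Nonempty η.Complement :=
  ⟨η.tube ⟨(1, Classical.arbitrary S), one_ne_zero⟩⟩

/-- A continuous function to `Bool` on the complement is constant on the connected punctured tube.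
It therefore extends continuously over `Σ` to the connected space `M`. -/
theorem preconnectedSpace_complement [ConnectedSpace S] [PreconnectedSpace M]
    (η : FramedSurface S M) : PreconnectedSpace η.Complement := by
  classical
  refine preconnectedSpace_of_forall_constant fun f hf => ?_
  haveI := pathConnectedSpace_punctured (S := S)
  obtain ⟨p₀⟩ := (inferInstance : Nonempty (Punctured S))
  have hb : ∀ p, f (η.tube p) = f (η.tube p₀) := fun p =>
    PreconnectedSpace.constant inferInstance (hf.comp η.isOpenEmbedding_tube.continuous)
  set F : M → Bool := fun u => if h : u ∈ Set.range η.emb then f (η.tube p₀) else f ⟨u, h⟩ with hF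
  have hFc : ∀ u : η.Complement, F u.1 = f u := fun u => dif_neg u.2
  have hFv : ∀ p, F (η.toFun p) = f (η.tube p₀) := by
    intro p
    by_cases h : p.1 = 0
    · exact dif_pos ⟨p.2, congrArg η.toFun (Prod.ext h.symm rfl)⟩
    · rw [← hb ⟨p, h⟩]
      exact hFc (η.tube ⟨p, h⟩)
  have hFcont : Continuous F := by
    rw [continuous_iff_continuousAt]
    intro u
    by_cases h : u ∈ Set.range η.emb
    · obtain ⟨s, rfl⟩ := h
      refine η.isOpenEmbedding.continuousAt_iff.1 ?_
      rw [show F ∘ η.toFun = fun _ => f (η.tube p₀) from funext hFv]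
      exact continuousAt_const
    · refine (η.isOpenEmbedding_val.continuousAt_iff (x := ⟨u, h⟩)).1 ?_
      rw [show F ∘ Subtype.val = f from funext hFc]
      exact hf.continuousAt
  intro u v
  rw [← hFc, ← hFc]
  exact PreconnectedSpace.constant inferInstance hFcont

theorem hasCharts_complement (η : FramedSurface S M) :
    HasCharts (EuclideanSpace ℝ (Fin 4)) η.Complement :=
  hasCharts_of_chartedSpace.of_isOpenEmbedding η.isOpenEmbedding_val

theorem pathConnectedSpace_complement [ConnectedSpace S] [PreconnectedSpace M]
    (η : FramedSurface S M) : PathConnectedSpace η.Complement :=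
  haveI := η.preconnectedSpace_complement
  haveI := η.nonempty_complement
  haveI : ConnectedSpace η.Complement := ⟨inferInstance⟩
  η.hasCharts_complement.pathConnectedSpace

/-- The universal covering of the punctured tube. -/
def expTube (η : FramedSurface S M) : C(ℂ × S, η.Complement) :=
  ⟨fun p => η.tube (expProd S p), η.isOpenEmbedding_tube.continuous.comp (expProd S).continuous⟩

theorem expTube_add (η : FramedSurface S M) (ζ : ℂ) (s : S) :
    η.expTube (ζ + 2 * Real.pi * Complex.I, s) = η.expTube (ζ, s) :=
  congrArg η.tube (Subtype.ext (Prod.ext (Complex.exp_periodic ζ) rfl))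

/-- The image of a segment in a fibre of the universal covering of the punctured tube. -/
def segment (η : FramedSurface S M) (s : S) (a b : ℂ) : C(unitInterval, η.Complement) :=
  η.expTube.comp ⟨fun t => ((1 - (t : ℝ)) • a + (t : ℝ) • b, s), by fun_prop⟩

theorem segment_add (η : FramedSurface S M) (s : S) (a b : ℂ) :
    η.segment s (a + 2 * Real.pi * Complex.I) (b + 2 * Real.pi * Complex.I) = η.segment s a b := by
  ext t : 1
  refine Eq.trans ?_ (η.expTube_add _ s)
  refine congrArg η.expTube (Prod.ext ?_ rfl)
  simp only [ContinuousMap.coe_mk, Complex.real_smul]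
  push_cast
  ring

theorem segment_meridian (η : FramedSurface S M) (s : S) :
    η.segment s 0 (2 * Real.pi * Complex.I) = (η.meridian s).toContinuousMap := by
  ext t : 1
  refine Subtype.ext (congrArg η.toFun (Prod.ext ?_ rfl))
  change Complex.exp _ = ((Circle.exp (2 * Real.pi * (t : ℝ)) : Circle) : ℂ)
  rw [Circle.coe_exp]
  congr 1
  simp only [ContinuousMap.coe_mk, Complex.real_smul]
  push_cast
  ring

section Holonomy

variable {G : Type*} [Group G] {η : FramedSurface S M} {c : C(unitInterval, η.Complement) → G}

theorem holonomy_segment_mul (hc : IsHolonomy {Set.univ} c) (s : S) (a b d : ℂ) :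
    c (η.segment s a b) * c (η.segment s b d) = c (η.segment s a d) := by
  have := hc.square (η.expTube.comp ⟨fun p => ((1 - (p.1 : ℝ)) • a + (p.1 : ℝ) •
    ((1 - (p.2 : ℝ)) • b + (p.2 : ℝ) • d), s), by fun_prop⟩) ⟨_, rfl, fun _ => trivial⟩
    (η.segment s a b) (η.segment s b d) (ContinuousMap.const _ (η.expTube (a, s)))
    (η.segment s a d) (fun x => by simp [segment]) (fun x => by simp [segment])
    (fun x => by simp) (fun x => by simp [segment])
  rwa [hc.const, one_mul] at this

/-- A path from `s` to `s'` sweeps out a square whose bottom and top are the two meridians and whose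
other two sides are the same path, so the holonomies are conjugate. -/
theorem holonomy_meridian [ConnectedSpace S] (hc : IsHolonomy {Set.univ} c) {s : S}
    (h : c (η.meridian s).toContinuousMap = 1) (s' : S) :
    c (η.meridian s').toContinuousMap = 1 := by
  haveI := pathConnectedSpace_surface (S := S)
  set p := PathConnectedSpace.somePath s s'
  have := hc.square (η.expTube.comp ⟨fun q => ((1 - (q.1 : ℝ)) • (0 : ℂ) + (q.1 : ℝ) •
    (2 * Real.pi * Complex.I), p q.2), by fun_prop⟩) ⟨_, rfl, fun _ => trivial⟩
    (η.segment s 0 (2 * Real.pi * Complex.I)) (η.expTube.comp ⟨fun y => (0, p y), by fun_prop⟩)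
    (η.expTube.comp ⟨fun y => (0, p y), by fun_prop⟩) (η.segment s' 0 (2 * Real.pi * Complex.I))
    (fun x => by simp [segment]) (fun y => by
      have := η.expTube_add 0 (p y)
      simpa using this.symm) (fun y => by simp) (fun x => by simp [segment])
  rw [segment_meridian, segment_meridian, h, one_mul] at this
  exact mul_left_cancel (this.symm.trans (mul_one _).symm)

/-- Adding `2πi` to the end point inserts a meridian, which has trivial holonomy; two logarithms of
one number differ by a multiple of `2πi`. -/
theorem holonomy_segment_eq (hc : IsHolonomy {Set.univ} c)
    (h : ∀ s, c (η.meridian s).toContinuousMap = 1) (s : S) {a b : ℂ}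
    (hab : Complex.exp a = Complex.exp b) : c (η.segment s 0 a) = c (η.segment s 0 b) := by
  have hp : Function.Periodic (fun ζ => c (η.segment s 0 ζ)) (2 * Real.pi * Complex.I) := by
    intro ζ
    have := holonomy_segment_mul hc s 0 (0 + 2 * Real.pi * Complex.I)
      (ζ + 2 * Real.pi * Complex.I)
    rw [segment_add, zero_add, segment_meridian, h, one_mul] at this
    exact this.symm
  obtain ⟨n, rfl⟩ := Complex.exp_eq_exp_iff_exists_int.1 hab
  exact hp.int_mul n b

/-- The gauge function is the holonomy along the fibre from `(1, s)` to `(z, s)`, well defined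
because meridians are trivial. A path is then compared with its projection to `{1} × S` by a square
in the universal covering of the fibres. -/
theorem exists_gauge (hc : IsHolonomy {Set.univ} c)
    (h : ∀ s, c (η.meridian s).toContinuousMap = 1) : ∃ f : η.Complement → G,
      ∀ γ : C(unitInterval, Punctured S),
        f (η.tube (γ 0)) * c ((⟨η.tube, η.isOpenEmbedding_tube.continuous⟩ : C(_, _)).comp γ) *
          (f (η.tube (γ 1)))⁻¹ = c (η.expTube.comp ⟨fun t => (0, (γ t).1.2), by fun_prop⟩) := by
  refine ⟨Function.extend η.tube (fun p => c (η.segment p.1.2 0 (Complex.log p.1.1))) 1,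
    fun γ => ?_⟩
  obtain ⟨δ, rfl⟩ := exists_expProd_eq γ
  have hf : ∀ p, Function.extend η.tube (fun p => c (η.segment p.1.2 0 (Complex.log p.1.1))) 1
      (η.tube (expProd S p)) = c (η.segment p.2 0 p.1) := by
    intro p
    rw [η.tube_injective.extend_apply]
    exact holonomy_segment_eq hc h p.2 (Complex.exp_log (Complex.exp_ne_zero _))
  rw [ContinuousMap.comp_apply, ContinuousMap.comp_apply, hf, hf]
  have := hc.square (η.expTube.comp ⟨fun q => ((q.2 : ℝ) • (δ q.1).1, (δ q.1).2), by fun_prop⟩)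
    ⟨_, rfl, fun _ => trivial⟩ (η.expTube.comp ⟨fun t => (0, (δ t).2), by fun_prop⟩)
    (η.segment (δ 1).2 0 (δ 1).1) (η.segment (δ 0).2 0 (δ 0).1) (η.expTube.comp δ)
    (fun x => by simp) (fun x => by simp [segment]) (fun x => by simp [segment])
    (fun x => by simp)
  rw [mul_inv_eq_iff_eq_mul]
  exact this.symm

end Holonomy

/-- If the meridian is trivial, then the complement is simply connected. -/
theorem simplyConnectedSpace_complement [ConnectedSpace S] [SimplyConnectedSpace M]
    (η : FramedSurface S M) {s : S} (hs : η.meridianClass s = 1) :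
    SimplyConnectedSpace η.Complement := by
  haveI := η.pathConnectedSpace_complement
  rw [simply_connected_iff_loops_nullhomotopic]
  refine ⟨inferInstance, fun x p => ?_⟩
  obtain ⟨c, hc, hcx⟩ := exists_holonomy x
  have hm : c (η.meridian s).toContinuousMap = 1 := by
    have : (η.meridian s).Homotopic (Path.refl _) := Path.Homotopic.Quotient.exact hs
    rw [hc.congr_homotopic this]
    exact hc.const _
  obtain ⟨f, hf⟩ := exists_gauge hc (holonomy_meridian hc hm)
  set ε : C(η.Complement, M) := ⟨Subtype.val, continuous_subtype_val⟩ with hε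
  set g : C(ℂ × S, M) := ⟨η.toFun, η.continuous_toFun⟩ with hg
  have hcov : Set.range ε ∪ Set.range g = Set.univ := by
    rw [Set.eq_univ_iff_forall]
    intro u
    by_cases h : u ∈ Set.range η.emb
    · obtain ⟨t, rfl⟩ := h
      exact Or.inr ⟨_, rfl⟩
    · exact Or.inl ⟨⟨u, h⟩, rfl⟩
  -- On the tube, `Σ` included, use the holonomy of the path projected to `{1} × S`. It equals the
  -- gauged holonomy on the overlap, so the two combine to a holonomy of `M`.
  obtain ⟨d, hd, hdε⟩ := IsHolonomy.exists_union (ε := ε) (δ := g)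
    η.isOpenEmbedding_val.isEmbedding η.isOpenEmbedding.isEmbedding hcov (hc.gauge f)
    (hc.comp (η.expTube.comp ⟨fun p : ℂ × S => (0, p.2), by fun_prop⟩) rfl fun _ => trivial) (by
    intro γ γ' h
    have hne : ∀ t, (γ' t).1 ≠ 0 := fun t h0 => (γ t).2 ⟨(γ' t).2, by
      refine Eq.trans ?_ (DFunLike.congr_fun h t).symm
      exact congrArg η.toFun (Prod.ext h0.symm rfl)⟩
    set γ'' : C(unitInterval, Punctured S) := ⟨fun t => ⟨γ' t, hne t⟩, by fun_prop⟩
    obtain rfl : γ = (⟨η.tube, η.isOpenEmbedding_tube.continuous⟩ : C(_, _)).comp γ'' :=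
      ContinuousMap.ext fun t => Subtype.ext (DFunLike.congr_fun h t)
    exact hf γ'')
  have h1 := hd.eq_one_of_nullhomotopic η.isOpenEmbedding_val.isOpen_range
    η.isOpenEmbedding.isOpen_range hcov (p := p.map ε.continuous)
    (SimplyConnectedSpace.paths_homotopic _ _) fun t => ⟨p t, rfl⟩
  -- A loop has equal gauge factors at its ends, so its original holonomy is conjugate to the
  -- trivial one.
  have h2 : f (p 0) * c p.toContinuousMap * (f (p 1))⁻¹ = 1 := (hdε p.toContinuousMap).symm.trans h1
  rw [p.source, p.target, mul_inv_eq_one, mul_eq_left] at h2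
  exact Path.Homotopic.Quotient.exact ((hcx p).1 h2)

end ZTwo.FramedSurface

end


/-! ### The simply connected double covering and the fundamental group -/

noncomputable section

theorem Sing.isOpenEmbedding_prodMk {Y D : Type*} [TopologicalSpace Y] [TopologicalSpace D]
    [DiscreteTopology D] (d : D) : Topology.IsOpenEmbedding fun y : Y => (y, d) := by
  refine .of_continuous_injective_isOpenMap (by fun_prop) (fun u v h => congrArg Prod.fst h)
    fun U hU => ?_
  convert hU.prod (isOpen_discrete ({d} : Set D)) using 1
  ext ⟨u, c⟩
  simp [eq_comm]

namespace ZTwo.FramedSurface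

open Sing

variable {S M : Type u} [TopologicalSpace S] [TopologicalSpace M]
  [ChartedSpace (EuclideanSpace ℝ (Fin 2)) S] [ChartedSpace (EuclideanSpace ℝ (Fin 4)) M]
  {φ : S → S} (hφ : Function.Involutive φ)

/-! ### The double covering of the `ℤ₂`-construction -/

/-- The two copies of the punctured tube. -/
def tubes (η : FramedSurface S M) : Punctured S × Bool → η.Complement × Bool :=
  Prod.map η.tube id

theorem tubes_injective (η : FramedSurface S M) : Function.Injective η.tubes :=
  η.tube_injective.prodMap Function.injective_id

/-- The reflection that interchanges the two copies of the punctured tube. -/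
def reflects (φ : S → S) : Punctured S × Bool → Punctured S × Bool :=
  Prod.map (reflect φ) not

include hφ in
theorem involutive_reflects : Function.Involutive (reflects φ) := fun p =>
  Prod.ext (involutive_reflect hφ _) (Bool.not_not _)

/-- Two copies of the complement of the surface, glued along the punctured tube. -/
abbrev OpenDouble (η : FramedSurface S M) : Type u :=
  Quotient (glueSetoid η.tubes_injective (involutive_reflects hφ))

/-- The inclusion of a copy of the complement in the open double. -/
def incl (η : FramedSurface S M) (b : Bool) (u : η.Complement) : η.OpenDouble hφ :=
  Quotient.mk _ (u, b)

theorem incl_eq_iff (η : FramedSurface S M) {u v : η.Complement} {b c : Bool} :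
    η.incl hφ b u = η.incl hφ c v ↔
      (v = u ∧ c = b) ∨ ∃ p, u = η.tube p ∧ v = η.tube (reflect φ p) ∧ c = !b := by
  refine (glue_eq_iff _ _).trans (or_congr Prod.ext_iff ⟨?_, ?_⟩)
  · rintro ⟨⟨p, d⟩, h1, h2⟩
    obtain ⟨h3, rfl⟩ := Prod.ext_iff.1 h1
    obtain ⟨h5, h6⟩ := Prod.ext_iff.1 h2
    exact ⟨p, h3, h5, h6⟩
  · rintro ⟨p, rfl, rfl, rfl⟩
    exact ⟨(p, b), rfl, rfl⟩

theorem incl_reflect (η : FramedSurface S M) (b : Bool) (p : Punctured S) :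
    η.incl hφ (!b) (η.tube (reflect φ p)) = η.incl hφ b (η.tube p) :=
  ((η.incl_eq_iff hφ).2 (Or.inr ⟨p, rfl, rfl, rfl⟩)).symm

theorem incl_injective (η : FramedSurface S M) (b : Bool) : Function.Injective (η.incl hφ b) := by
  intro u v h
  obtain ⟨h, -⟩ | ⟨-, -, -, h⟩ := (η.incl_eq_iff hφ).1 h
  · exact h.symm
  · cases b <;> cases h

theorem exists_incl_eq (η : FramedSurface S M) (x : η.OpenDouble hφ) :
    ∃ b u, η.incl hφ b u = x := by
  obtain ⟨⟨u, b⟩⟩ := x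
  exact ⟨b, u, rfl⟩

theorem range_incl_union (η : FramedSurface S M) :
    Set.range (η.incl hφ false) ∪ Set.range (η.incl hφ true) = Set.univ := by
  rw [Set.eq_univ_iff_forall]
  intro x
  obtain ⟨_ | _, u, rfl⟩ := η.exists_incl_eq hφ x
  exacts [Or.inl ⟨u, rfl⟩, Or.inr ⟨u, rfl⟩]

/-- The involution of the open double that swaps the two copies. -/
def flip (η : FramedSurface S M) : η.OpenDouble hφ → η.OpenDouble hφ :=
  Quotient.lift (fun p => η.incl hφ (!p.2) p.1) (by
    rintro ⟨u, b⟩ ⟨v, c⟩ h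
    refine (η.incl_eq_iff hφ).2 ?_
    obtain ⟨rfl, rfl⟩ | ⟨p, rfl, rfl, rfl⟩ := (η.incl_eq_iff hφ).1 (Quotient.sound h)
    · exact Or.inl ⟨rfl, rfl⟩
    · exact Or.inr ⟨p, rfl, rfl, rfl⟩)

theorem flip_incl (η : FramedSurface S M) (b : Bool) (u : η.Complement) :
    η.flip hφ (η.incl hφ b u) = η.incl hφ (!b) u := rfl

theorem flip_flip (η : FramedSurface S M) (x : η.OpenDouble hφ) :
    η.flip hφ (η.flip hφ x) = x := by
  obtain ⟨b, u, rfl⟩ := η.exists_incl_eq hφ x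
  rw [flip_incl, flip_incl, Bool.not_not]

variable [CompactSpace S] [T2Space M] (hc : Continuous φ)

include hc

theorem isOpenEmbedding_incl (η : FramedSurface S M) (b : Bool) :
    Topology.IsOpenEmbedding (η.incl hφ b) := by
  have ho : Topology.IsOpenEmbedding η.tubes :=
    η.isOpenEmbedding_tube.prodMap Topology.IsOpenEmbedding.id
  have hq := isOpenQuotientMap_glue η.tubes_injective (involutive_reflects hφ) ho
    ((continuous_reflect hc).prodMap continuous_of_discreteTopology)
  refine .of_continuous_injective_isOpenMap (hq.continuous.comp (by fun_prop))
    (η.incl_injective hφ b) (hq.isOpenMap.comp (isOpenEmbedding_prodMk b).isOpenMap)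

theorem continuous_flip (η : FramedSurface S M) : Continuous (η.flip hφ) := by
  refine continuous_quot_lift _ ?_
  rw [continuous_iff_continuousAt]
  rintro ⟨u, b⟩
  exact ((isOpenEmbedding_prodMk b).continuousAt_iff (x := u)).1
    (η.isOpenEmbedding_incl hφ hc (!b)).continuous.continuousAt

theorem pathConnectedSpace_openDouble [ConnectedSpace S] [PreconnectedSpace M]
    (η : FramedSurface S M) : PathConnectedSpace (η.OpenDouble hφ) := by
  haveI := η.pathConnectedSpace_complement
  obtain ⟨p⟩ := (pathConnectedSpace_punctured (S := S)).nonempty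
  have h : ∀ b u v, Joined (η.incl hφ b u) (η.incl hφ b v) := fun b u v =>
    (PathConnectedSpace.joined u v).map (η.isOpenEmbedding_incl hφ hc b).continuous
  have h' : ∀ x, Joined (η.incl hφ false (η.tube p)) x := by
    intro x
    obtain ⟨_ | _, u, rfl⟩ := η.exists_incl_eq hφ x
    · exact h _ _ _
    · rw [← η.incl_reflect hφ]
      exact h _ _ _
  exact ⟨⟨η.incl hφ false (η.tube p)⟩, fun x y => (h' x).symm.trans (h' y)⟩

/-- Both copies are simply connected and open, so the universal holonomy has a potential on each. As
the overlap is connected, the potentials differ there by one left factor `k` and combine to a global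
potential, which forces every loop to be trivial. -/
theorem simplyConnectedSpace_openDouble [ConnectedSpace S] [PreconnectedSpace M]
    (η : FramedSurface S M) [SimplyConnectedSpace η.Complement] :
    SimplyConnectedSpace (η.OpenDouble hφ) := by
  haveI := η.pathConnectedSpace_openDouble hφ hc
  haveI := pathConnectedSpace_punctured (S := S)
  rw [simply_connected_iff_loops_nullhomotopic]
  refine ⟨inferInstance, fun x p => ?_⟩
  obtain ⟨c, hc', hcx⟩ := exists_holonomy x
  set j : Bool → C(η.Complement, η.OpenDouble hφ) := fun b =>
    ⟨_, (η.isOpenEmbedding_incl hφ hc b).continuous⟩ with hj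
  choose f hf using fun b => (hc'.comp (j b) rfl fun _ => trivial).exists_potential
  -- A path in the punctured tube and its reflection are the same path in the double, so both
  -- potentials change by the same right factor along it.
  have hconst : ∃ k, ∀ q, f false (η.tube (reflect φ q)) = k * f true (η.tube q) := by
    obtain ⟨q₀⟩ := (inferInstance : Nonempty (Punctured S))
    refine ⟨f false (η.tube (reflect φ q₀)) * (f true (η.tube q₀))⁻¹, fun q => ?_⟩
    set γ := (PathConnectedSpace.somePath q₀ q).toContinuousMap with hγ
    have h0 : γ 0 = q₀ := Path.source _
    have h1 : γ 1 = q := Path.target _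
    set t : C(Punctured S, η.Complement) := ⟨η.tube, η.isOpenEmbedding_tube.continuous⟩
    set r : C(Punctured S, Punctured S) := ⟨reflect φ, continuous_reflect hc⟩
    have e : (j false).comp ((t.comp r).comp γ) = (j true).comp (t.comp γ) :=
      ContinuousMap.ext fun s => η.incl_reflect hφ true (γ s)
    have h2 := hf false ((t.comp r).comp γ)
    have h3 := hf true (t.comp γ)
    rw [e] at h2
    change f false (η.tube (reflect φ (γ 0))) * _ = f false (η.tube (reflect φ (γ 1))) at h2
    change f true (η.tube (γ 0)) * _ = f true (η.tube (γ 1)) at h3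
    rw [h0, h1] at h2 h3
    rw [← h2, ← h3]
    group
  obtain ⟨k, hk⟩ := hconst
  set F : η.OpenDouble hφ → (FundamentalGroup _ x)ᵐᵒᵖ :=
    Quotient.lift (fun p => cond p.2 (k * f true p.1) (f false p.1)) (by
      rintro ⟨u, b⟩ ⟨v, d⟩ h
      obtain ⟨rfl, rfl⟩ | ⟨q, rfl, rfl, rfl⟩ := (η.incl_eq_iff hφ).1 (Quotient.sound h)
      · rfl
      · cases b
        · change f false (η.tube q) = k * f true (η.tube (reflect φ q))
          rw [← hk, involutive_reflect hφ]
        · exact (hk q).symm) with hF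
  have hFf : ∀ u, F (η.incl hφ false u) = f false u := fun _ => rfl
  have hFt : ∀ u, F (η.incl hφ true u) = k * f true u := fun _ => rfl
  -- After gauging with the potential `F` the holonomy is trivial on paths within either copy, hence
  -- on all paths by subdivision.
  have htriv := (hc'.gauge F).eq_one_of_cover (η.isOpenEmbedding_incl hφ hc false).isOpen_range
    (η.isOpenEmbedding_incl hφ hc true).isOpen_range (η.range_incl_union hφ) (fun γ hγ => by
      obtain ⟨γ, rfl⟩ := exists_comp_eq (ε := j false)
        (η.isOpenEmbedding_incl hφ hc false).isEmbedding γ hγ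
      change F (η.incl hφ false (γ 0)) * _ * (F (η.incl hφ false (γ 1)))⁻¹ = 1
      rw [hFf, hFf, mul_inv_eq_one]
      exact hf false γ) (fun γ hγ => by
      obtain ⟨γ, rfl⟩ := exists_comp_eq (ε := j true)
        (η.isOpenEmbedding_incl hφ hc true).isEmbedding γ hγ
      change F (η.incl hφ true (γ 0)) * _ * (F (η.incl hφ true (γ 1)))⁻¹ = 1
      rw [hFt, hFt, mul_inv_eq_one, mul_assoc]
      exact congrArg (k * ·) (hf true γ)) p.toContinuousMap
  have h2 : F (p 0) * c p.toContinuousMap * (F (p 1))⁻¹ = 1 := htriv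
  rw [p.source, p.target, mul_inv_eq_one, mul_eq_left] at h2
  exact Path.Homotopic.Quotient.exact ((hcx p).1 h2)

omit hc [CompactSpace S] [T2Space M] in
/-- The action of `ℤ/2` on the open double. -/
@[reducible] def flipAction (η : FramedSurface S M) : AddAction (ZMod 2) (η.OpenDouble hφ) where
  vadd n x := if n = 0 then x else η.flip hφ x
  zero_vadd x := if_pos rfl
  add_vadd m n x := by
    change (if m + n = 0 then x else η.flip hφ x) =
      if m = 0 then (if n = 0 then x else η.flip hφ x) else
        η.flip hφ (if n = 0 then x else η.flip hφ x)
    fin_cases m <;> fin_cases n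
    · rfl
    · rfl
    · rfl
    · exact (η.flip_flip hφ x).symm

variable [CompactSpace M]

/-- The projection of the open double to the `ℤ₂`-construction. -/
def cover (η : FramedSurface S M) : η.OpenDouble hφ → η.Construction φ hφ :=
  Quotient.lift (fun p => η.fold hφ hc p.1) (by
    rintro ⟨u, b⟩ ⟨v, d⟩ h
    refine (η.fold_eq_iff hφ hc).2 ?_
    obtain ⟨rfl, rfl⟩ | ⟨p, rfl, rfl, rfl⟩ := (η.incl_eq_iff hφ).1 (Quotient.sound h)
    · exact Or.inl rfl
    · exact Or.inr ⟨p, rfl, rfl⟩)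

theorem cover_eq_iff (η : FramedSurface S M) {x y : η.OpenDouble hφ} :
    η.cover hφ hc x = η.cover hφ hc y ↔ x = y ∨ x = η.flip hφ y := by
  obtain ⟨b, u, rfl⟩ := η.exists_incl_eq hφ x
  obtain ⟨d, v, rfl⟩ := η.exists_incl_eq hφ y
  rw [flip_incl, incl_eq_iff, incl_eq_iff]
  refine (η.fold_eq_iff hφ hc).trans ?_
  constructor
  · rintro (rfl | ⟨p, rfl, rfl⟩)
    · cases b <;> cases d <;> simp
    · have h : ∃ q, η.tube p = η.tube q ∧ η.tube (reflect φ p) = η.tube (reflect φ q) :=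
        ⟨p, rfl, rfl⟩
      cases b <;> cases d <;> simp [h]
  · rintro ((⟨h, -⟩ | ⟨p, h1, h2, -⟩) | (⟨h, -⟩ | ⟨p, h1, h2, -⟩))
    exacts [Or.inl h, Or.inr ⟨p, h1, h2⟩, Or.inl h, Or.inr ⟨p, h1, h2⟩]

/-- Freeness of `φ` gives an open set of the complement on which the folding is injective. Its
copies in the two sheets are disjoint, so the action is properly discontinuous. -/
theorem isAddQuotientCoveringMap_cover (η : FramedSurface S M) (hf : ∀ s, φ s ≠ s) :
    letI := η.flipAction hφ
    IsAddQuotientCoveringMap (η.cover hφ hc) (ZMod 2) := by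
  letI := η.flipAction hφ
  have hv : ∀ (n : ZMod 2) (x : η.OpenDouble hφ), n +ᵥ x = if n = 0 then x else η.flip hφ x :=
    fun _ _ => rfl
  refine { toIsQuotientMap := ?_, continuous_const_vadd := ?_, apply_eq_iff_mem_orbit := ?_,
           disjoint := ?_ }
  · have hcont : Continuous (η.cover hφ hc) := continuous_quot_lift _
      ((η.isOpenQuotientMap_fold hφ hc).continuous.comp continuous_fst)
    refine .of_comp (f := Quotient.mk (glueSetoid η.tubes_injective (involutive_reflects hφ)))
      continuous_quotient_mk' hcont ?_
    exact ((η.isOpenQuotientMap_fold hφ hc).comp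
      (⟨Prod.fst_surjective, continuous_fst, isOpenMap_fst⟩ : IsOpenQuotientMap
        (Prod.fst : η.Complement × Bool → η.Complement))).isQuotientMap
  · intro n
    by_cases hn : n = 0
    · simp only [hv, if_pos hn]
      exact continuous_id
    · simp only [hv, if_neg hn]
      exact η.continuous_flip hφ hc
  · intro x y
    rw [cover_eq_iff]
    constructor
    · rintro (rfl | rfl)
      · exact ⟨0, rfl⟩
      · exact ⟨1, rfl⟩
    · rintro ⟨n, rfl⟩
      change (if n = 0 then y else η.flip hφ y) = y ∨ (if n = 0 then y else η.flip hφ y) = _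
      split_ifs
      exacts [Or.inl rfl, Or.inr rfl]
  · intro x
    obtain ⟨b, u, rfl⟩ := η.exists_incl_eq hφ x
    obtain ⟨U, hU, hinj⟩ := exists_injOn_glue η.tube_injective (involutive_reflect hφ)
      (reflect_ne hf) (η.isClosed_range_reflect hc) u
    refine ⟨η.incl hφ b '' U, (η.isOpenEmbedding_incl hφ hc b).isOpenMap.image_mem_nhds hU, ?_⟩
    rintro n ⟨_, ⟨_, ⟨v, hv', rfl⟩, rfl⟩, ⟨w, hw, h⟩⟩
    by_contra hn
    change _ = n +ᵥ _ at h
    rw [hv, if_neg hn, flip_incl] at h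
    obtain ⟨-, h⟩ | ⟨p, rfl, h, -⟩ := (η.incl_eq_iff hφ).1 h
    · cases b <;> cases h
    · subst h
      have := hinj hw hv' ((glue_eq_iff _ _).2 (Or.inr ⟨p, rfl, rfl⟩))
      exact reflect_ne hf p (η.tube_injective this).symm

theorem pathConnectedSpace_construction [ConnectedSpace S] [PreconnectedSpace M]
    (η : FramedSurface S M) : PathConnectedSpace (η.Construction φ hφ) :=
  haveI := η.pathConnectedSpace_complement
  (η.isOpenQuotientMap_fold hφ hc).surjective.pathConnectedSpace
    (η.isOpenQuotientMap_fold hφ hc).continuous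

theorem nonempty_fundamentalGroup_mulEquiv [ConnectedSpace S] [SimplyConnectedSpace M]
    (η : FramedSurface S M) (hf : ∀ s, φ s ≠ s) {s : S} (hs : η.meridianClass s = 1)
    (x : η.Construction φ hφ) :
    Nonempty (FundamentalGroup (η.Construction φ hφ) x ≃* Multiplicative (ZMod 2)) := by
  haveI := η.simplyConnectedSpace_complement hs
  haveI := η.simplyConnectedSpace_openDouble hφ hc
  letI := η.flipAction hφ
  have h := η.isAddQuotientCoveringMap_cover hφ hc hf
  obtain ⟨y, hy⟩ := h.surjective x
  -- Deck transformations give the opposite group, which is the same here because `ℤ/2` is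
  -- commutative.
  exact ⟨(h.fundamentalGroupEquiv ⟨y, hy⟩).trans MulOpposite.opMulEquiv.symm⟩

end ZTwo.FramedSurface

end


theorem mainTheorem5 {M S : Type u}
    [TopologicalSpace M] [T2Space M] [CompactSpace M]
    [ChartedSpace (EuclideanSpace ℝ (Fin 4)) M] [IsManifold (𝓡 4) ∞ M] [SimplyConnectedSpace M]
    (μ : SingularHomology.H 4 M) (hμ : SingularHomology.IsFundamentalClass 4 μ)
    [TopologicalSpace S] [T2Space S] [CompactSpace S] [ConnectedSpace S]
    [ChartedSpace (EuclideanSpace ℝ (Fin 2)) S] [IsManifold (𝓡 2) ∞ S]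
    (σ : SingularHomology.H 2 S) (hσ : SingularHomology.IsFundamentalClass 2 σ)
    (η : ZTwo.FramedSurface S M) (φ : C(S, S)) (hφ : ZTwo.IsReversingFreeInvolution σ φ) :
    (∀ s : S, η.meridianClass s = 1 →
      PathConnectedSpace (η.Construction φ hφ.involutive) ∧
      ∀ x : η.Construction φ hφ.involutive,
        Nonempty (FundamentalGroup (η.Construction φ hφ.involutive) x ≃*
          Multiplicative (ZMod 2))) ∧
    (∀ (F : Type u) [TopologicalSpace F] [T2Space F] [CompactSpace F]
      [ChartedSpace (EuclideanSpace ℝ (Fin 2)) F] [IsManifold (𝓡 2) ∞ F]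
      (κ : SingularHomology.H 2 F) (_ : SingularHomology.IsFundamentalClass 2 κ)
      (f : C(F, M)) (_ : Manifold.IsImmersion (𝓡 2) (𝓡 4) ∞ f),
      SingularHomology.intersectionNumber μ (SingularHomology.push 2 f κ)
        (SingularHomology.push 2 η.emb σ) = 0 →
      Odd (SingularHomology.intersectionNumber μ (SingularHomology.push 2 f κ)
        (SingularHomology.push 2 f κ)) →
      SingularHomology.HasOddIntersectionForm (η.Construction φ hφ.involutive)) := by
  haveI : PathConnectedSpace (η.Construction φ hφ.involutive) :=
    η.pathConnectedSpace_construction hφ.involutive φ.continuous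
  refine ⟨fun s hs => ⟨inferInstance, fun x =>
    η.nonempty_fundamentalGroup_mulEquiv hφ.involutive φ.continuous hφ.free hs x⟩, ?_⟩
  intro F _ _ _ _ _ κ _ f _ h0 hodd
  unfold SingularHomology.intersectionNumber at h0 hodd
  split_ifs at h0 hodd with hd
  -- The Poincaré dual chosen in the intersection number is the cocycle to use. Applied to itself,
  -- its defining property turns `α · α` into its square.
  · refine ZTwo.hasOddIntersectionForm_of_cocycle hμ hσ η hφ hd.choose h0 ?_
    rwa [← hd.choose_spec]
  -- Without a dual the intersection number would have the default value zero, which is not odd.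
  · exact absurd hodd (by decide)
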